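/- Let $c>1$, let $b_0>0$ be arbitrary and $b_n=n^c$ for $n\ge 1$. Let $P_n$ and $Q_n$ be the polynomials determined by $xr_n=b_nr_{n+1}+b_{n-1}r_{n-1}$ for $n\ge 0$, with $P_{-1}=0,\ P_0=1$ and $Q_{-1}=-1,\ Q_0=0$, $b_{-1}:=1$. The associated symmetric Hamburger moment problem asks for the positive measures $\mu$ on $\mathbb R$ with moments of every order for which $\int P_mP_n\,d\mu=\delta_{mn}$ for all $m,n\ge 0$. Its order and type are the common order and the common type of the four functions $$A(z)=z\sum_{k\ge0}Q_k(0)Q_k(z),\quad B(z)=-1+z\sum_{k\ge0}Q_k(0)P_k(z),\quad C(z)=1+z\sum_{k\ge0}P_k(0)Q_k(z),\quad D(z)=z\sum_{k\ge0}P_k(0)P_k(z).$$ Here the order of a non-constant entire function $f$ with $M_f(r)=\max_{|z|=r}|f(z)|$ is $\rho_f=\limsup_{r\to\infty}\frac{\log\log M_f(r)}{\log r}$, and, if $0<\rho_f<\infty$, its type is $\tau_f=\limsup_{r\to\infty}\frac{\log M_f(r)}{r^{\rho_f}}\in[0,\infty]$. For real $p>2$ put $$\gamma_n(p)=\sum_{1\le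 k_1\le k_2<k_3\le k_4<\cdots<k_{2n-1}\le k_{2n}}(k_1k_2\cdots k_{2n})^{-p/2}\quad(n\ge1),$$ $$\zeta_n(p)=\sum_{1\le k_1<k_2<\cdots<k_n}(k_2-k_1)(k_3-k_2)\cdots(k_n-k_{n-1})(k_1k_2\cdots k_n)^{-p}\quad(n\ge2),$$ $$G_p(z)=\sum_{n=1}^\infty\gamma_n(p)z^n,\qquad Z_p(z)=\sum_{n=2}^\infty\zeta_n(p)z^n.$$ Then the moment problem is indeterminate (it has more than one solution $\mu$), the series for $A,B,C,D$ converge on $\mathbb C$ to entire functions, and each of these four functions has order $1/c$. The series defining $\gamma_n(2c)$, $\zeta_n(2c)$, $G_{2c}$ and $Z_{2c}$ converge, the functions $G_{2c}$ and $Z_{2c}$ are entire, both have order $1/(2c)$, and they have a common type $T_c$. Each of $A,B,C,D$ has type $T_c/2$. In short, the moment problem has order $1/c$ and type $T_c/2$. -/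

import Mathlib

open Filter MeasureTheory

noncomputable section

namespace BergSzwarc

/-! ### Growth of entire functions -/

/-- Maximum modulus `M_f(r) = max_{|z| = r} |f z|`. -/
def maxModulus (f : ℂ → ℂ) (r : ℝ) : ℝ :=
  sSup ((fun z => ‖f z‖) '' Metric.sphere (0 : ℂ) r)

/-- Order of a non-constant entire function: `limsup_{r → ∞} log log M_f(r) / log r`. -/
def growthOrder (f : ℂ → ℂ) : EReal :=
  limsup (fun r : ℝ =>
    ((Real.log (Real.log (maxModulus f r)) / Real.log r : ℝ) : EReal)) atTop

/-- Type of an entire function of order `0 < ρ < ∞`: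
`limsup_{r → ∞} log M_f(r) / r ^ ρ`, where `ρ` is the order of `f`. -/
def growthType (f : ℂ → ℂ) : EReal :=
  limsup (fun r : ℝ =>
    ((Real.log (maxModulus f r) / r ^ (growthOrder f).toReal : ℝ) : EReal)) atTop

/-! ### The moment problem with Jacobi parameters `a`, `b` -/

/-- Orthonormal polynomials: `x P_n = b_n P_{n+1} + a_n P_n + b_{n-1} P_{n-1}`,
`P_{-1} = 0`, `P_0 = 1`. -/
def orthoP (a b : ℕ → ℝ) : ℕ → Polynomial ℝ
  | 0 => 1
  | 1 => Polynomial.C (b 0)⁻¹ * (Polynomial.X - Polynomial.C (a 0))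
  | n + 2 => Polynomial.C (b (n + 1))⁻¹ *
      ((Polynomial.X - Polynomial.C (a (n + 1))) * orthoP a b (n + 1)
        - Polynomial.C (b n) * orthoP a b n)

/-- Polynomials of the second kind: the same recurrence with
`Q_{-1} = -1`, `Q_0 = 0`, `b_{-1} = 1` (so that `Q_1 = 1 / b_0`). -/
def orthoQ (a b : ℕ → ℝ) : ℕ → Polynomial ℝ
  | 0 => 0
  | 1 => Polynomial.C (b 0)⁻¹
  | n + 2 => Polynomial.C (b (n + 1))⁻¹ *
      ((Polynomial.X - Polynomial.C (a (n + 1))) * orthoQ a b (n + 1)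
        - Polynomial.C (b n) * orthoQ a b n)

/-- `μ` solves the (normalized) Hamburger moment problem with Jacobi parameters `a`, `b`:
it has moments of every order and the `P_n` are orthonormal in `L²(μ)`. -/
def IsSolution (a b : ℕ → ℝ) (μ : Measure ℝ) : Prop :=
  (∀ n : ℕ, Integrable (fun x : ℝ => x ^ n) μ) ∧
  ∀ m n : ℕ, ∫ x, (orthoP a b m).eval x * (orthoP a b n).eval x ∂μ = if m = n then 1 else 0

/-- The moment problem is indeterminate: it has more than one solution. -/
def Indeterminate (a b : ℕ → ℝ) : Prop :=
  ∃ μ ν : Measure ℝ, IsSolution a b μ ∧ IsSolution a b ν ∧ μ ≠ ν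

/-- `P_n(z)` for complex `z`. -/
def cP (a b : ℕ → ℝ) (n : ℕ) (z : ℂ) : ℂ := Polynomial.aeval z (orthoP a b n)

/-- `Q_n(z)` for complex `z`. -/
def cQ (a b : ℕ → ℝ) (n : ℕ) (z : ℂ) : ℂ := Polynomial.aeval z (orthoQ a b n)

/-! The entries of the Nevanlinna matrix. -/

def nevA (a b : ℕ → ℝ) (z : ℂ) : ℂ := z * ∑' k, cQ a b k 0 * cQ a b k z

def nevB (a b : ℕ → ℝ) (z : ℂ) : ℂ := -1 + z * ∑' k, cQ a b k 0 * cP a b k z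

def nevC (a b : ℕ → ℝ) (z : ℂ) : ℂ := 1 + z * ∑' k, cP a b k 0 * cQ a b k z

def nevD (a b : ℕ → ℝ) (z : ℂ) : ℂ := z * ∑' k, cP a b k 0 * cP a b k z

/-- The series defining the Nevanlinna matrix converge on the whole complex plane and its
four entries are entire functions. -/
def NevanlinnaEntire (a b : ℕ → ℝ) : Prop :=
  (∀ z : ℂ, Summable (fun k => cQ a b k 0 * cQ a b k z) ∧
    Summable (fun k => cQ a b k 0 * cP a b k z) ∧
    Summable (fun k => cP a b k 0 * cQ a b k z) ∧
    Summable (fun k => cP a b k 0 * cP a b k z)) ∧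
  Differentiable ℂ (nevA a b) ∧ Differentiable ℂ (nevB a b) ∧
  Differentiable ℂ (nevC a b) ∧ Differentiable ℂ (nevD a b)

/-- The moment problem has order `ρ`: this is the common order of `A`, `B`, `C`, `D`. -/
def MomentOrder (a b : ℕ → ℝ) (ρ : EReal) : Prop :=
  growthOrder (nevA a b) = ρ ∧ growthOrder (nevB a b) = ρ ∧
  growthOrder (nevC a b) = ρ ∧ growthOrder (nevD a b) = ρ

/-- The moment problem has type `τ`: this is the common type of `A`, `B`, `C`, `D`. -/
def MomentType (a b : ℕ → ℝ) (τ : EReal) : Prop :=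
  growthType (nevA a b) = τ ∧ growthType (nevB a b) = τ ∧
  growthType (nevC a b) = τ ∧ growthType (nevD a b) = τ

/-! ### Multi-zeta values -/

/-- Index tuples `1 ≤ k_1 ≤ k_2 < k_3 ≤ k_4 < ⋯ < k_{2n-1} ≤ k_{2n}`
(here `k_1` is `k 0`, so the inequality after an even position is weak). -/
def gammaIndex (n : ℕ) : Set (Fin (2 * n) → ℕ) :=
  {k | (∀ i, 1 ≤ k i) ∧
    ∀ i j : Fin (2 * n), (i : ℕ) + 1 = j →
      (Even (i : ℕ) → k i ≤ k j) ∧ (Odd (i : ℕ) → k i < k j)}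

/-- `(k_1 k_2 ⋯ k_{2n}) ^ (-p/2)`. -/
def gammaTerm (n : ℕ) (p : ℝ) (k : gammaIndex n) : ℝ :=
  (∏ i, (k.1 i : ℝ)) ^ (-(p / 2))

/-- The multi-zeta value `γ_n(p)`. -/
def gammaMZ (n : ℕ) (p : ℝ) : ℝ := ∑' k : gammaIndex n, gammaTerm n p k

/-- Index tuples `1 ≤ k_1 < k_2 < ⋯ < k_{m+1}`. -/
def zetaIndex (m : ℕ) : Set (Fin (m + 1) → ℕ) :=
  {k | (∀ i, 1 ≤ k i) ∧ StrictMono k}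

/-- `(k_2 - k_1)(k_3 - k_2) ⋯ (k_{m+1} - k_m) (k_1 k_2 ⋯ k_{m+1}) ^ (-p)`. -/
def zetaTerm (m : ℕ) (p : ℝ) (k : zetaIndex m) : ℝ :=
  (∏ i : Fin m, ((k.1 i.succ : ℝ) - (k.1 i.castSucc : ℝ))) * (∏ i, (k.1 i : ℝ)) ^ (-p)

/-- The modified multi-zeta value `ζ_{m+1}(p)`, with `m + 1` summation indices. -/
def zetaMZsucc (m : ℕ) (p : ℝ) : ℝ := ∑' k : zetaIndex m, zetaTerm m p k

/-- `G_p(z) = ∑_{n ≥ 1} γ_n(p) z ^ n`. -/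
def G (p : ℝ) (z : ℂ) : ℂ := ∑' n : ℕ, (gammaMZ (n + 1) p : ℂ) * z ^ (n + 1)

/-- `Z_p(z) = ∑_{n ≥ 2} ζ_n(p) z ^ n`. -/
def Z (p : ℝ) (z : ℂ) : ℂ := ∑' n : ℕ, (zetaMZsucc (n + 1) p : ℂ) * z ^ (n + 2)

/-- All the series defining `γ_n(p)` (`n ≥ 1`), `ζ_n(p)` (`n ≥ 2`), `G_p` and `Z_p` converge,
and `G_p`, `Z_p` are entire. -/
def GZEntire (p : ℝ) : Prop :=
  (∀ n : ℕ, Summable (gammaTerm (n + 1) p)) ∧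
  (∀ n : ℕ, Summable (zetaTerm (n + 1) p)) ∧
  (∀ z : ℂ, Summable (fun n : ℕ => (gammaMZ (n + 1) p : ℂ) * z ^ (n + 1))) ∧
  (∀ z : ℂ, Summable (fun n : ℕ => (zetaMZsucc (n + 1) p : ℂ) * z ^ (n + 2))) ∧
  Differentiable ℂ (G p) ∧ Differentiable ℂ (Z p)

end BergSzwarc

end

noncomputable section

open scoped Topology

namespace BergSzwarc

/-! Divide the recurrence at even and odd indices by `α_n = |P_{2n}(0)|` and `β_n = |Q_{2n+1}(0)|`
and replace `z` by `-iz`. What remains is a two-component chain with nonnegative weights `m_n =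
α_n²`, `s_n = β_n²` (`recurrence_eq_chain`). Up to unimodular factors, `A, B, C, D` are the limits
of its components for the starts `(0,1)` and `(1,0)`. Since every coefficient is nonnegative, the
maximum modulus on `|z| = r` is attained at `z = ir` and equals the limit of the real chain at `y =
r` (`maxModulus_nev`).

Expanding chain limits in powers of `y` produces multi-zeta sums. With both weights `k^{-c}` the
limit of `U` is `1 + ∑ γ_n(2c) y^{2n}` (`ofReal_symU`). With masses `k^{-2c}` at unit distances, `y`
times the limit of `V` is `∑_{n≥1} ζ_n(2c) y^{2n}`: summing out the unit weights counts the gaps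
`k_{i+1} - k_i` (`ofReal_strV`). So everything reduces to comparing three chains.

Order and type only see `log M(r)` up to `O(log r)`, so factors polynomial in `r` are free
(`PolyLE`, `growth_of_polyLE`). The comparisons come from rescaling the components by monotone
sequences (`chain_le_of_gauge`). Between the two model chains the rescaling is by `n^c`, and the
unbounded factor is handled by cutting the chain at an index polynomial in `y` (`str_le_sym`,
`sym_le_str`, `symU_le_of_tail`). For `b_n = n^c` one has `α_n² = ρ_n (2n)^{-c}` and `β_n² =
ρ_n^{-1} (2n)^{-c}` for `n ≥ 1`, where `ρ_n` decreases and stays at least `b_0²`. Rescaling by `ρ_n`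
leaves the symmetric model chain at `y / 2^c` (`limU_power_le`, `symU_le_limU_power`). Both model
chains have order `1/c` in `y`. Putting `y = √r` gives order `1/(2c)` for `G` and `Z` with a common
type, and `y = r / 2^c` multiplies that type by `(2^{-c})^{1/c} = 1/2`.

For indeterminacy, Gauss quadrature measures converge along subsequences to solutions. Jacobi
truncations of odd size have the vector `(P_k(0))` in their kernel, hence an atom at `0` of mass at
least `1/∑ P_k(0)²`. For even size `(Q_k(0))` solves `Jw = e_0`, which bounds the mass near `0` by
`δ² ∑ Q_k(0)²`. The two limits therefore differ (`indeterminate_of_summable`). -/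

/-! ### Two-component chains -/

/-- The chain `V_{n+1} = V_n + y m_n U_n`, `U_{n+1} = U_n + y s_n V_{n+1}` started at `a`. -/
def chain {R : Type*} [CommSemiring R] (m s : ℕ → R) (y : R) (a : R × R) : ℕ → R × R
  | 0 => a
  | n + 1 => ((chain m s y a n).1
        + y * s n * ((chain m s y a n).2 + y * m n * (chain m s y a n).1),
      (chain m s y a n).2 + y * m n * (chain m s y a n).1)

section Algebra

variable {R S : Type*} [CommSemiring R] [CommSemiring S]

/-- The first component of the chain. -/
def chainU (m s : ℕ → R) (y : R) (a : R × R) (n : ℕ) : R := (chain m s y a n).1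

/-- The second component of the chain. -/
def chainV (m s : ℕ → R) (y : R) (a : R × R) (n : ℕ) : R := (chain m s y a n).2

variable (m s : ℕ → R) (y : R) (a : R × R) (n : ℕ)

@[simp] lemma chainU_zero : chainU m s y a 0 = a.1 := rfl

@[simp] lemma chainV_zero : chainV m s y a 0 = a.2 := rfl

lemma chainV_succ : chainV m s y a (n + 1) = chainV m s y a n + y * m n * chainU m s y a n := rfl

lemma chainU_succ :
    chainU m s y a (n + 1) = chainU m s y a n + y * s n * chainV m s y a (n + 1) := rfl

lemma chainU_eq_sum :
    chainU m s y a n = a.1 + y * ∑ k ∈ Finset.range n, s k * chainV m s y a (k + 1) := by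
  induction n with
  | zero => simp
  | succ n ih => rw [chainU_succ, ih, Finset.sum_range_succ]; ring

lemma chainV_eq_sum :
    chainV m s y a n = a.2 + y * ∑ k ∈ Finset.range n, m k * chainU m s y a k := by
  induction n with
  | zero => simp
  | succ n ih => rw [chainV_succ, ih, Finset.sum_range_succ]; ring

lemma chain_map (f : R →+* S) (n : ℕ) :
    chainU (fun k => f (m k)) (fun k => f (s k)) (f y) (f a.1, f a.2) n = f (chainU m s y a n) ∧
    chainV (fun k => f (m k)) (fun k => f (s k)) (f y) (f a.1, f a.2) n
      = f (chainV m s y a n) := by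
  induction n with
  | zero => simp
  | succ n ih =>
    have hV : chainV (fun k => f (m k)) (fun k => f (s k)) (f y) (f a.1, f a.2) (n + 1)
        = f (chainV m s y a (n + 1)) := by
      rw [chainV_succ, chainV_succ, ih.1, ih.2]; simp
    refine ⟨?_, hV⟩
    rw [chainU_succ, chainU_succ, hV, ih.1]; simp

end Algebra

/-- The limit of the first component. -/
def limU {R : Type*} [CommSemiring R] [TopologicalSpace R] (m s : ℕ → R) (y : R) (a : R × R) : R :=
  a.1 + y * ∑' k, s k * chainV m s y a (k + 1)

/-- The limit of the second component. -/
def limV {R : Type*} [CommSemiring R] [TopologicalSpace R] (m s : ℕ → R) (y : R) (a : R × R) : R :=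
  a.2 + y * ∑' k, m k * chainU m s y a k

/-! ### Chains with nonnegative real data -/

lemma chain_nonneg {m s : ℕ → ℝ} (hm : ∀ k, 0 ≤ m k) (hs : ∀ k, 0 ≤ s k) {y : ℝ} (hy : 0 ≤ y)
    {a : ℝ × ℝ} (ha : 0 ≤ a) (n : ℕ) : 0 ≤ chainU m s y a n ∧ 0 ≤ chainV m s y a n := by
  induction n with
  | zero => exact ⟨ha.1, ha.2⟩
  | succ n ih =>
    have hV : 0 ≤ chainV m s y a (n + 1) := by
      rw [chainV_succ]
      have := mul_nonneg (mul_nonneg hy (hm n)) ih.1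
      linarith [ih.2]
    refine ⟨?_, hV⟩
    rw [chainU_succ]
    have := mul_nonneg (mul_nonneg hy (hs n)) hV
    linarith [ih.1]

/-- Comparison of two chains up to a gauge transformation, from the index `n₀` on. -/
lemma chain_le_of_gauge {m s m' s' g h : ℕ → ℝ} {y y' κ : ℝ} {a a' : ℝ × ℝ} {n₀ : ℕ}
    (hm : ∀ k, 0 ≤ m k) (hs : ∀ k, 0 ≤ s k)
    (hm' : ∀ k, 0 ≤ m' k) (hs' : ∀ k, 0 ≤ s' k) (hy : 0 ≤ y) (hy' : 0 ≤ y')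
    (ha' : 0 ≤ a') (hκ : 0 ≤ κ)
    (hg : ∀ n ≥ n₀, g n ≤ g (n + 1)) (hh : ∀ n ≥ n₀, h n ≤ h (n + 1))
    (hgm : ∀ n ≥ n₀, y * m n * g n ≤ h (n + 1) * (y' * m' n))
    (hhs : ∀ n ≥ n₀, y * s n * h (n + 1) ≤ g (n + 1) * (y' * s' n))
    (hU : chainU m s y a n₀ ≤ κ * g n₀ * chainU m' s' y' a' n₀)
    (hV : chainV m s y a n₀ ≤ κ * h n₀ * chainV m' s' y' a' n₀) (n : ℕ) (hn : n₀ ≤ n) :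
    chainU m s y a n ≤ κ * g n * chainU m' s' y' a' n ∧
    chainV m s y a n ≤ κ * h n * chainV m' s' y' a' n := by
  induction n, hn using Nat.le_induction with
  | base => exact ⟨hU, hV⟩
  | succ n hn ih =>
    have hpos := chain_nonneg hm' hs' hy' ha' n
    have hpos' := chain_nonneg hm' hs' hy' ha' (n + 1)
    -- The new `V` is bounded first because the new `U` is built from it. This staggering is why the
    -- weight conditions pair `g n` with `h (n + 1)` and `h (n + 1)` with `g (n + 1)`.
    have key : chainV m s y a (n + 1) ≤ κ * h (n + 1) * chainV m' s' y' a' (n + 1) := by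
      rw [chainV_succ, chainV_succ]
      have h1 : y * m n * chainU m s y a n
          ≤ y * m n * (κ * g n * chainU m' s' y' a' n) :=
        mul_le_mul_of_nonneg_left ih.1 (mul_nonneg hy (hm n))
      have h2 : y * m n * g n * (κ * chainU m' s' y' a' n)
          ≤ h (n + 1) * (y' * m' n) * (κ * chainU m' s' y' a' n) :=
        mul_le_mul_of_nonneg_right (hgm n hn) (mul_nonneg hκ hpos.1)
      have h3 : h n * (κ * chainV m' s' y' a' n) ≤ h (n + 1) * (κ * chainV m' s' y' a' n) :=
        mul_le_mul_of_nonneg_right (hh n hn) (mul_nonneg hκ hpos.2)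
      linarith [ih.2]
    refine ⟨?_, key⟩
    rw [chainU_succ, chainU_succ m' s']
    have h1 : y * s n * chainV m s y a (n + 1)
        ≤ y * s n * (κ * h (n + 1) * chainV m' s' y' a' (n + 1)) :=
      mul_le_mul_of_nonneg_left key (mul_nonneg hy (hs n))
    have h2 : y * s n * h (n + 1) * (κ * chainV m' s' y' a' (n + 1))
        ≤ g (n + 1) * (y' * s' n) * (κ * chainV m' s' y' a' (n + 1)) :=
      mul_le_mul_of_nonneg_right (hhs n hn) (mul_nonneg hκ hpos'.2)
    have h3 : g n * (κ * chainU m' s' y' a' n) ≤ g (n + 1) * (κ * chainU m' s' y' a' n) :=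
      mul_le_mul_of_nonneg_right (hg n hn) (mul_nonneg hκ hpos.1)
    linarith [ih.1]

lemma chainU_mono {m s : ℕ → ℝ} (hm : ∀ k, 0 ≤ m k) (hs : ∀ k, 0 ≤ s k) {y : ℝ} (hy : 0 ≤ y)
    {a : ℝ × ℝ} (ha : 0 ≤ a) : Monotone (chainU m s y a) :=
  monotone_nat_of_le_succ fun n => by
    rw [chainU_succ]
    have := mul_nonneg (mul_nonneg hy (hs n)) (chain_nonneg hm hs hy ha (n + 1)).2
    linarith

lemma chainV_mono {m s : ℕ → ℝ} (hm : ∀ k, 0 ≤ m k) (hs : ∀ k, 0 ≤ s k) {y : ℝ} (hy : 0 ≤ y)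
    {a : ℝ × ℝ} (ha : 0 ≤ a) : Monotone (chainV m s y a) :=
  monotone_nat_of_le_succ fun n => by
    rw [chainV_succ]
    have := mul_nonneg (mul_nonneg hy (hm n)) (chain_nonneg hm hs hy ha n).1
    linarith

/-- Each half step multiplies `U + V` by at most `1 + y m_n` or `1 + y s_n`. The exponents `e`, `f`
are left free: linear ones give boundedness, fractional powers give the sharp order. -/
lemma chain_add_le_exp {m s e f : ℕ → ℝ} (hm : ∀ k, 0 ≤ m k) (hs : ∀ k, 0 ≤ s k) {y : ℝ}
    (hy : 0 ≤ y) {a : ℝ × ℝ} (ha : 0 ≤ a) (he : ∀ k, 1 + y * m k ≤ Real.exp (e k))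
    (hf : ∀ k, 1 + y * s k ≤ Real.exp (f k)) (n : ℕ) :
    chainU m s y a n + chainV m s y a n
      ≤ (a.1 + a.2) * Real.exp (∑ k ∈ Finset.range n, (e k + f k)) := by
  induction n with
  | zero => simp
  | succ n ih =>
    obtain ⟨hU, hV⟩ := chain_nonneg hm hs hy ha n
    have hV' := (chain_nonneg hm hs hy ha (n + 1)).2
    have hym := mul_nonneg hy (hm n)
    have hys := mul_nonneg hy (hs n)
    have h1 : chainU m s y a n + chainV m s y a (n + 1)
        ≤ (1 + y * m n) * (chainU m s y a n + chainV m s y a n) := by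
      rw [chainV_succ]; nlinarith [mul_nonneg hym hV]
    have h2 : chainU m s y a (n + 1) + chainV m s y a (n + 1)
        ≤ (1 + y * s n) * (chainU m s y a n + chainV m s y a (n + 1)) := by
      rw [chainU_succ]; nlinarith [mul_nonneg hys hU]
    have h0 : 0 ≤ a.1 + a.2 := add_nonneg ha.1 ha.2
    calc chainU m s y a (n + 1) + chainV m s y a (n + 1)
        ≤ (1 + y * s n) * ((1 + y * m n) * (chainU m s y a n + chainV m s y a n)) :=
          h2.trans (mul_le_mul_of_nonneg_left h1 (by linarith))
      _ ≤ Real.exp (f n) * (Real.exp (e n)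
            * ((a.1 + a.2) * Real.exp (∑ k ∈ Finset.range n, (e k + f k)))) := by
          gcongr
          · exact hf n
          · exact he n
      _ = (a.1 + a.2) * Real.exp (∑ k ∈ Finset.range (n + 1), (e k + f k)) := by
          rw [Finset.sum_range_succ, Real.exp_add, Real.exp_add]; ring

lemma chain_add_le_exp_tsum {m s e f : ℕ → ℝ} (hm : ∀ k, 0 ≤ m k) (hs : ∀ k, 0 ≤ s k) {y : ℝ}
    (hy : 0 ≤ y) {a : ℝ × ℝ} (ha : 0 ≤ a) (he : ∀ k, 1 + y * m k ≤ Real.exp (e k))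
    (hf : ∀ k, 1 + y * s k ≤ Real.exp (f k)) (hes : Summable e) (hfs : Summable f) (n : ℕ) :
    chainU m s y a n + chainV m s y a n
      ≤ (a.1 + a.2) * Real.exp (∑' k, (e k + f k)) := by
  refine (chain_add_le_exp hm hs hy ha he hf n).trans ?_
  have hpos : ∀ {x t : ℝ}, 0 ≤ x → 1 + x ≤ Real.exp t → 0 ≤ t := fun hx h => by
    rw [← Real.one_le_exp_iff]; linarith
  refine mul_le_mul_of_nonneg_left (Real.exp_le_exp.2 ?_) (add_nonneg ha.1 ha.2)
  exact (hes.add hfs).sum_le_tsum _ fun k _ =>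
    add_nonneg (hpos (mul_nonneg hy (hm k)) (he k)) (hpos (mul_nonneg hy (hs k)) (hf k))

lemma chain_le_const {m s : ℕ → ℝ} (hm : ∀ k, 0 ≤ m k) (hs : ∀ k, 0 ≤ s k) (hmS : Summable m)
    (hsS : Summable s) {y : ℝ} (hy : 0 ≤ y) {a : ℝ × ℝ} (ha : 0 ≤ a) :
    ∃ C : ℝ, ∀ n, chainU m s y a n ≤ C ∧ chainV m s y a n ≤ C := by
  refine ⟨(a.1 + a.2) * Real.exp (∑' k, (y * m k + y * s k)), fun n => ?_⟩
  have h := chain_add_le_exp_tsum hm hs hy ha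
    (fun k => by linarith [Real.add_one_le_exp (y * m k)])
    (fun k => by linarith [Real.add_one_le_exp (y * s k)])
    (hmS.mul_left y) (hsS.mul_left y) n
  have hp := chain_nonneg hm hs hy ha n
  constructor <;> linarith [hp.1, hp.2]

lemma summable_chainU {m s : ℕ → ℝ} (hm : ∀ k, 0 ≤ m k) (hs : ∀ k, 0 ≤ s k) (hmS : Summable m)
    (hsS : Summable s) {y : ℝ} (hy : 0 ≤ y) {a : ℝ × ℝ} (ha : 0 ≤ a) :
    Summable fun k => m k * chainU m s y a k := by
  obtain ⟨C, hC⟩ := chain_le_const hm hs hmS hsS hy ha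
  exact (hmS.mul_right C).of_nonneg_of_le
    (fun k => mul_nonneg (hm k) (chain_nonneg hm hs hy ha k).1)
    fun k => mul_le_mul_of_nonneg_left (hC k).1 (hm k)

lemma summable_chainV {m s : ℕ → ℝ} (hm : ∀ k, 0 ≤ m k) (hs : ∀ k, 0 ≤ s k) (hmS : Summable m)
    (hsS : Summable s) {y : ℝ} (hy : 0 ≤ y) {a : ℝ × ℝ} (ha : 0 ≤ a) :
    Summable fun k => s k * chainV m s y a (k + 1) := by
  obtain ⟨C, hC⟩ := chain_le_const hm hs hmS hsS hy ha
  exact (hsS.mul_right C).of_nonneg_of_le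
    (fun k => mul_nonneg (hs k) (chain_nonneg hm hs hy ha (k + 1)).2)
    fun k => mul_le_mul_of_nonneg_left (hC (k + 1)).2 (hs k)

lemma tendsto_chainU {m s : ℕ → ℝ} {y : ℝ} {a : ℝ × ℝ}
    (h : Summable fun k => s k * chainV m s y a (k + 1)) :
    Tendsto (chainU m s y a) atTop (𝓝 (limU m s y a)) := by
  have : chainU m s y a = fun n => a.1 + y * ∑ k ∈ Finset.range n, s k * chainV m s y a (k + 1) :=
    funext fun n => chainU_eq_sum m s y a n
  rw [this]
  exact (h.hasSum.tendsto_sum_nat.const_mul y).const_add a.1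

lemma tendsto_chainV {m s : ℕ → ℝ} {y : ℝ} {a : ℝ × ℝ}
    (h : Summable fun k => m k * chainU m s y a k) :
    Tendsto (chainV m s y a) atTop (𝓝 (limV m s y a)) := by
  have : chainV m s y a = fun n => a.2 + y * ∑ k ∈ Finset.range n, m k * chainU m s y a k :=
    funext fun n => chainV_eq_sum m s y a n
  rw [this]
  exact (h.hasSum.tendsto_sum_nat.const_mul y).const_add a.2

lemma chainU_le_limU {m s : ℕ → ℝ} (hm : ∀ k, 0 ≤ m k) (hs : ∀ k, 0 ≤ s k) {y : ℝ} (hy : 0 ≤ y)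
    {a : ℝ × ℝ} (ha : 0 ≤ a) (h : Summable fun k => s k * chainV m s y a (k + 1)) (n : ℕ) :
    chainU m s y a n ≤ limU m s y a :=
  (chainU_mono hm hs hy ha).ge_of_tendsto (tendsto_chainU h) n

lemma chainV_le_limV {m s : ℕ → ℝ} (hm : ∀ k, 0 ≤ m k) (hs : ∀ k, 0 ≤ s k) {y : ℝ} (hy : 0 ≤ y)
    {a : ℝ × ℝ} (ha : 0 ≤ a) (h : Summable fun k => m k * chainU m s y a k) (n : ℕ) :
    chainV m s y a n ≤ limV m s y a :=
  (chainV_mono hm hs hy ha).ge_of_tendsto (tendsto_chainV h) n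

/-! ### Chains with a complex parameter -/

/-- The chain with real weights, a complex parameter and real starting values. -/
def cU (m s : ℕ → ℝ) (z : ℂ) (a : ℝ × ℝ) (n : ℕ) : ℂ :=
  chainU (fun k => (m k : ℂ)) (fun k => (s k : ℂ)) z ((a.1 : ℂ), (a.2 : ℂ)) n

/-- The second component of the chain with a complex parameter. -/
def cV (m s : ℕ → ℝ) (z : ℂ) (a : ℝ × ℝ) (n : ℕ) : ℂ :=
  chainV (fun k => (m k : ℂ)) (fun k => (s k : ℂ)) z ((a.1 : ℂ), (a.2 : ℂ)) n

/-- The limit of `cU`. -/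
def cLimU (m s : ℕ → ℝ) (z : ℂ) (a : ℝ × ℝ) : ℂ := a.1 + z * ∑' k, s k * cV m s z a (k + 1)

/-- The limit of `cV`. -/
def cLimV (m s : ℕ → ℝ) (z : ℂ) (a : ℝ × ℝ) : ℂ := a.2 + z * ∑' k, m k * cU m s z a k

lemma cU_succ (m s : ℕ → ℝ) (z : ℂ) (a : ℝ × ℝ) (n : ℕ) :
    cU m s z a (n + 1) = cU m s z a n + z * s n * cV m s z a (n + 1) := rfl

lemma cV_succ (m s : ℕ → ℝ) (z : ℂ) (a : ℝ × ℝ) (n : ℕ) :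
    cV m s z a (n + 1) = cV m s z a n + z * m n * cU m s z a n := rfl

lemma cU_ofReal (m s : ℕ → ℝ) (y : ℝ) (a : ℝ × ℝ) (n : ℕ) :
    cU m s y a n = chainU m s y a n := (chain_map m s y a Complex.ofRealHom n).1

lemma cV_ofReal (m s : ℕ → ℝ) (y : ℝ) (a : ℝ × ℝ) (n : ℕ) :
    cV m s y a n = chainV m s y a n := (chain_map m s y a Complex.ofRealHom n).2

lemma cLimU_ofReal (m s : ℕ → ℝ) (y : ℝ) (a : ℝ × ℝ) : cLimU m s y a = limU m s y a := by
  simp only [cLimU, limU, cV_ofReal]; push_cast; rfl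

lemma cLimV_ofReal (m s : ℕ → ℝ) (y : ℝ) (a : ℝ × ℝ) : cLimV m s y a = limV m s y a := by
  simp only [cLimV, limV, cU_ofReal]; push_cast; rfl

lemma differentiable_chain (m s : ℕ → ℝ) (a : ℝ × ℝ) (n : ℕ) :
    Differentiable ℂ (fun z => cU m s z a n) ∧ Differentiable ℂ (fun z => cV m s z a n) := by
  induction n with
  | zero => exact ⟨differentiable_const _, differentiable_const _⟩
  | succ n ih =>
    have hV : Differentiable ℂ (fun z => cV m s z a (n + 1)) := by
      have : (fun z => cV m s z a (n + 1)) = fun z => cV m s z a n + z * m n * cU m s z a n :=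
        funext fun z => chainV_succ _ _ _ _ _
      rw [this]
      exact ih.2.add ((differentiable_id.mul (differentiable_const _)).mul ih.1)
    refine ⟨?_, hV⟩
    have : (fun z => cU m s z a (n + 1)) = fun z => cU m s z a n + z * s n * cV m s z a (n + 1) :=
      funext fun z => chainU_succ _ _ _ _ _
    rw [this]
    exact ih.1.add ((differentiable_id.mul (differentiable_const _)).mul hV)

/-- The components are polynomials in the parameter with nonnegative coefficients, so the triangle
inequality is run through the recursion. -/
lemma norm_chain_le {m s : ℕ → ℝ} (hm : ∀ k, 0 ≤ m k) (hs : ∀ k, 0 ≤ s k) {a : ℝ × ℝ}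
    (ha : 0 ≤ a) {z : ℂ} {r : ℝ} (hz : ‖z‖ ≤ r) (n : ℕ) :
    ‖cU m s z a n‖ ≤ chainU m s r a n ∧ ‖cV m s z a n‖ ≤ chainV m s r a n := by
  have hr : 0 ≤ r := (norm_nonneg z).trans hz
  induction n with
  | zero =>
    refine ⟨?_, ?_⟩
    · simp [cU, abs_of_nonneg ha.1]
    · simp [cV, abs_of_nonneg ha.2]
  | succ n ih =>
    have hV : ‖cV m s z a (n + 1)‖ ≤ chainV m s r a (n + 1) := by
      rw [cV, chainV_succ, chainV_succ]
      refine (norm_add_le _ _).trans (add_le_add ih.2 ?_)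
      rw [norm_mul, norm_mul, Complex.norm_real, Real.norm_of_nonneg (hm n)]
      exact mul_le_mul (mul_le_mul_of_nonneg_right hz (hm n)) ih.1 (norm_nonneg _)
        (mul_nonneg hr (hm n))
    refine ⟨?_, hV⟩
    rw [cU, chainU_succ, chainU_succ]
    refine (norm_add_le _ _).trans (add_le_add ih.1 ?_)
    rw [norm_mul, norm_mul, Complex.norm_real, Real.norm_of_nonneg (hs n)]
    exact mul_le_mul (mul_le_mul_of_nonneg_right hz (hs n)) hV (norm_nonneg _)
      (mul_nonneg hr (hs n))

lemma differentiable_tsum_of_ball {f : ℕ → ℂ → ℂ} (hf : ∀ n, Differentiable ℂ (f n))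
    (u : ℝ → ℕ → ℝ) (hu : ∀ r, 0 ≤ r → Summable (u r))
    (hfu : ∀ r n z, ‖z‖ ≤ r → ‖f n z‖ ≤ u r n) : Differentiable ℂ fun z => ∑' n, f n z := by
  intro z
  have hr : 0 ≤ ‖z‖ + 1 := by positivity
  have hd := Complex.differentiableOn_tsum_of_summable_norm (hu _ hr) (F := f)
    (fun n => (hf n).differentiableOn) (Metric.isOpen_ball (x := (0 : ℂ)) (ε := ‖z‖ + 1))
    (fun n w hw => hfu _ n w (by simpa using (mem_ball_zero_iff.1 hw).le))
  exact hd.differentiableAt (Metric.isOpen_ball.mem_nhds (by simp))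

/-- Nonnegative summable weights. -/
structure Weights (m s : ℕ → ℝ) : Prop where
  nonneg_left : ∀ k, 0 ≤ m k
  nonneg_right : ∀ k, 0 ≤ s k
  summable_left : Summable m
  summable_right : Summable s

namespace Weights

variable {m s : ℕ → ℝ}

lemma norm_mul_cU_le (h : Weights m s) {a : ℝ × ℝ} (ha : 0 ≤ a) {z : ℂ} {r : ℝ}
    (hz : ‖z‖ ≤ r) (k : ℕ) : ‖m k * cU m s z a k‖ ≤ m k * chainU m s r a k := by
  rw [norm_mul, Complex.norm_real, Real.norm_of_nonneg (h.nonneg_left k)]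
  exact mul_le_mul_of_nonneg_left (norm_chain_le h.nonneg_left h.nonneg_right ha hz k).1
    (h.nonneg_left k)

lemma norm_mul_cV_le (h : Weights m s) {a : ℝ × ℝ} (ha : 0 ≤ a) {z : ℂ} {r : ℝ}
    (hz : ‖z‖ ≤ r) (k : ℕ) : ‖s k * cV m s z a (k + 1)‖ ≤ s k * chainV m s r a (k + 1) := by
  rw [norm_mul, Complex.norm_real, Real.norm_of_nonneg (h.nonneg_right k)]
  exact mul_le_mul_of_nonneg_left (norm_chain_le h.nonneg_left h.nonneg_right ha hz (k + 1)).2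
    (h.nonneg_right k)

lemma summableU (h : Weights m s) {a : ℝ × ℝ} (ha : 0 ≤ a) {y : ℝ} (hy : 0 ≤ y) :
    Summable fun k => m k * chainU m s y a k :=
  summable_chainU h.nonneg_left h.nonneg_right h.summable_left h.summable_right hy ha

lemma summableV (h : Weights m s) {a : ℝ × ℝ} (ha : 0 ≤ a) {y : ℝ} (hy : 0 ≤ y) :
    Summable fun k => s k * chainV m s y a (k + 1) :=
  summable_chainV h.nonneg_left h.nonneg_right h.summable_left h.summable_right hy ha

lemma summable_cU (h : Weights m s) {a : ℝ × ℝ} (ha : 0 ≤ a) (z : ℂ) :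
    Summable fun k => m k * cU m s z a k :=
  (h.summableU ha (norm_nonneg z)).of_norm_bounded (h.norm_mul_cU_le ha le_rfl)

lemma summable_cV (h : Weights m s) {a : ℝ × ℝ} (ha : 0 ≤ a) (z : ℂ) :
    Summable fun k => s k * cV m s z a (k + 1) :=
  (h.summableV ha (norm_nonneg z)).of_norm_bounded (h.norm_mul_cV_le ha le_rfl)

lemma norm_cLimU_le (h : Weights m s) {a : ℝ × ℝ} (ha : 0 ≤ a) (z : ℂ) :
    ‖cLimU m s z a‖ ≤ limU m s ‖z‖ a := by
  rw [cLimU, limU]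
  refine (norm_add_le _ _).trans (add_le_add ?_ ?_)
  · rw [Complex.norm_real, Real.norm_of_nonneg ha.1]
  · rw [norm_mul]
    exact mul_le_mul_of_nonneg_left (tsum_of_norm_bounded (h.summableV ha (norm_nonneg z)).hasSum
      (h.norm_mul_cV_le ha le_rfl)) (norm_nonneg z)

lemma norm_cLimV_le (h : Weights m s) {a : ℝ × ℝ} (ha : 0 ≤ a) (z : ℂ) :
    ‖cLimV m s z a‖ ≤ limV m s ‖z‖ a := by
  rw [cLimV, limV]
  refine (norm_add_le _ _).trans (add_le_add ?_ ?_)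
  · rw [Complex.norm_real, Real.norm_of_nonneg ha.2]
  · rw [norm_mul]
    exact mul_le_mul_of_nonneg_left (tsum_of_norm_bounded (h.summableU ha (norm_nonneg z)).hasSum
      (h.norm_mul_cU_le ha le_rfl)) (norm_nonneg z)

lemma differentiable_cLimU (h : Weights m s) {a : ℝ × ℝ} (ha : 0 ≤ a) :
    Differentiable ℂ fun z => cLimU m s z a := by
  unfold cLimU
  refine (differentiable_const _).add (differentiable_id.mul ?_)
  exact differentiable_tsum_of_ball
    (fun n => (differentiable_const _).mul (differentiable_chain m s a (n + 1)).2)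
    (fun r k => s k * chainV m s r a (k + 1)) (fun r hr => h.summableV ha hr)
    (fun r n z hz => h.norm_mul_cV_le ha hz n)

lemma differentiable_cLimV (h : Weights m s) {a : ℝ × ℝ} (ha : 0 ≤ a) :
    Differentiable ℂ fun z => cLimV m s z a := by
  unfold cLimV
  refine (differentiable_const _).add (differentiable_id.mul ?_)
  exact differentiable_tsum_of_ball
    (fun n => (differentiable_const _).mul (differentiable_chain m s a n).1)
    (fun r k => m k * chainU m s r a k) (fun r hr => h.summableU ha hr)
    (fun r n z hz => h.norm_mul_cU_le ha hz n)

end Weights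

/-! ### Order and type from two-sided bounds -/

lemma maxModulus_eq {f : ℂ → ℂ} {r F : ℝ} (hle : ∀ z : ℂ, ‖z‖ = r → ‖f z‖ ≤ F) {w : ℂ}
    (hw : ‖w‖ = r) (hwF : ‖f w‖ = F) : maxModulus f r = F := by
  refine IsGreatest.csSup_eq ⟨⟨w, by simpa using hw, hwF⟩, ?_⟩
  rintro _ ⟨z, hz, rfl⟩
  exact hle z (by simpa using hz)

/-- Taken in `EReal` because the limsup is not assumed finite; subadditivity applies since the
limsup of the difference is the finite number `0`. -/
lemma limsup_coe_eq_of_sub_tendsto_zero {f g : ℝ → ℝ}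
    (h : Tendsto (fun r => f r - g r) atTop (𝓝 0)) :
    limsup (fun r => (f r : EReal)) atTop = limsup (fun r => (g r : EReal)) atTop := by
  have key : ∀ {f g : ℝ → ℝ}, Tendsto (fun r => f r - g r) atTop (𝓝 0) →
      limsup (fun r => (f r : EReal)) atTop ≤ limsup (fun r => (g r : EReal)) atTop := by
    intro f g h
    have h0 : limsup (fun r => ((f r - g r : ℝ) : EReal)) atTop = 0 :=
      (EReal.tendsto_coe.2 h).limsup_eq
    have : (fun r => (f r : EReal))
        = (fun r => (g r : EReal)) + fun r => ((f r - g r : ℝ) : EReal) := by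
      funext r
      simp only [Pi.add_apply]
      rw [← EReal.coe_add]
      congr 1; ring
    rw [this]
    refine (EReal.limsup_add_le (.inr (by rw [h0]; simp)) (.inr (by rw [h0]; simp))).trans ?_
    rw [h0, add_zero]
  refine le_antisymm (key h) (key ?_)
  simpa using h.neg

lemma tendsto_log_log_div_log {ℓ : ℝ → ℝ} {ρ a : ℝ} (ha : 0 < a)
    (hlow : ∀ᶠ r in atTop, a * r ^ ρ ≤ ℓ r)
    (hup : ∀ θ > ρ, ∃ C, ∀ᶠ r in atTop, ℓ r ≤ C * r ^ θ) :
    Tendsto (fun r => Real.log (ℓ r) / Real.log r) atTop (𝓝 ρ) := by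
  have hinv : ∀ t : ℝ, Tendsto (fun r : ℝ => t / Real.log r) atTop (𝓝 0) := fun t =>
    Real.tendsto_log_atTop.const_div_atTop t
  have hlog : ∀ {C r θ : ℝ}, 0 < C → 1 < r →
      Real.log (C * r ^ θ) / Real.log r = θ + Real.log C / Real.log r := by
    intro C r θ hC hr
    have h0 : Real.log r ≠ 0 := (Real.log_pos hr).ne'
    rw [Real.log_mul hC.ne' (Real.rpow_pos_of_pos (by linarith) _).ne',
      Real.log_rpow (by linarith)]
    field_simp; ring
  rw [tendsto_order]
  constructor
  · intro b hb
    have h1 : ∀ᶠ r : ℝ in atTop, b < ρ + Real.log a / Real.log r := by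
      have := (hinv (Real.log a)).const_add ρ
      rw [add_zero] at this
      exact this.eventually (lt_mem_nhds hb)
    filter_upwards [hlow, h1, eventually_gt_atTop 1] with r hr h1 hr1
    refine h1.trans_le ?_
    rw [← hlog ha hr1]
    have : 0 < Real.log r := Real.log_pos hr1
    have hp : 0 < a * r ^ ρ := mul_pos ha (Real.rpow_pos_of_pos (by linarith) _)
    gcongr
  · intro b hb
    obtain ⟨θ, hθ1, hθ2⟩ := exists_between hb
    obtain ⟨C, hC⟩ := hup θ hθ1
    set C' := max C 1
    have hC' : 0 < C' := by positivity
    have h1 : ∀ᶠ r : ℝ in atTop, θ + Real.log C' / Real.log r < b := by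
      have := (hinv (Real.log C')).const_add θ
      rw [add_zero] at this
      exact this.eventually (gt_mem_nhds hθ2)
    filter_upwards [hlow, hC, h1, eventually_gt_atTop 1] with r hl hr h1 hr1
    refine lt_of_le_of_lt ?_ h1
    rw [← hlog hC' hr1]
    have : 0 < Real.log r := Real.log_pos hr1
    have hrp : 0 < r ^ ρ := Real.rpow_pos_of_pos (by linarith) _
    have hrp' : 0 < r ^ θ := Real.rpow_pos_of_pos (by linarith) _
    have hp : 0 < ℓ r := (mul_pos ha hrp).trans_le hl
    have : ℓ r ≤ C' * r ^ θ := hr.trans (by gcongr; exact le_max_left _ _)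
    gcongr

/-- The power map has an eventual inverse tending to infinity. Equality of filters is what makes a
limsup over `r` equal to the limsup over `y = κ r ^ q`, not merely bounded by it. -/
lemma map_const_mul_rpow_atTop {κ q : ℝ} (hκ : 0 < κ) (hq : 0 < q) :
    map (fun r : ℝ => κ * r ^ q) atTop = atTop := by
  refine le_antisymm ((tendsto_rpow_atTop hq).const_mul_atTop hκ) ?_
  have hψ : Tendsto (fun y : ℝ => (y / κ) ^ q⁻¹) atTop atTop :=
    (tendsto_rpow_atTop (inv_pos.2 hq)).comp (tendsto_id.atTop_div_const hκ)
  calc (atTop : Filter ℝ) = map (fun y : ℝ => κ * ((y / κ) ^ q⁻¹) ^ q) atTop := by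
        conv_lhs => rw [← map_id (f := (atTop : Filter ℝ))]
        refine Filter.map_congr ?_
        filter_upwards [eventually_gt_atTop 0] with y hy
        rw [← Real.rpow_mul (by positivity), inv_mul_cancel₀ hq.ne', Real.rpow_one]
        simp only [id]; field_simp
    _ = map (fun r : ℝ => κ * r ^ q) (map (fun y : ℝ => (y / κ) ^ q⁻¹) atTop) := by
        rw [map_map]; rfl
    _ ≤ _ := map_mono hψ

/-- If `log M_f(r)` agrees with `L (κ r ^ q)` up to a logarithmic error and `L` has order `ρ`,
then `f` has order `q ρ`, and its type is `κ ^ ρ` times that of `L`. -/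
lemma growth_of_log_close {f : ℂ → ℂ} {L : ℝ → ℝ} {ρ κ q a K : ℝ} (hρ : 0 < ρ) (hκ : 0 < κ)
    (hq : 0 < q) (ha : 0 < a) (hlow : ∀ᶠ y in atTop, a * y ^ ρ ≤ L y)
    (hup : ∀ θ > ρ, ∃ C, ∀ᶠ y in atTop, L y ≤ C * y ^ θ)
    (hclose : ∀ᶠ r in atTop, |Real.log (maxModulus f r) - L (κ * r ^ q)| ≤ K * Real.log r) :
    growthOrder f = ((q * ρ : ℝ) : EReal) ∧
    growthType f = ((κ ^ ρ : ℝ) : EReal) * limsup (fun y => ((L y / y ^ ρ : ℝ) : EReal)) atTop := by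
  have hmap := map_const_mul_rpow_atTop hκ hq
  have htend : Tendsto (fun r : ℝ => κ * r ^ q) atTop atTop := hmap.le
  have hqρ : 0 < q * ρ := mul_pos hq hρ
  have hpow : ∀ {θ r : ℝ}, 0 < r → (κ * r ^ q) ^ θ = κ ^ θ * r ^ (q * θ) := by
    intro θ r hr
    rw [Real.mul_rpow hκ.le (by positivity), ← Real.rpow_mul hr.le]
  have hlogo : ∀ {θ : ℝ}, 0 < θ → ∀ {ε : ℝ}, 0 < ε →
      ∀ᶠ r : ℝ in atTop, |K| * Real.log r ≤ ε * r ^ θ := by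
    intro θ hθ ε hε
    have := (isLittleO_log_rpow_atTop hθ).const_mul_left |K|
    filter_upwards [this.bound hε, eventually_gt_atTop 0] with r hr h0
    have h1 := (le_abs_self _).trans hr
    rwa [Real.norm_of_nonneg (by positivity)] at h1
  have horder : growthOrder f = ((q * ρ : ℝ) : EReal) := by
    -- Half of the lower constant `a κ^ρ` is given up to absorb the logarithmic error.
    refine (EReal.tendsto_coe.2 (tendsto_log_log_div_log (a := a * κ ^ ρ / 2) (by positivity)
      ?_ ?_)).limsup_eq
    · filter_upwards [hclose, htend.eventually hlow, eventually_gt_atTop 1,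
        hlogo hqρ (ε := a * κ ^ ρ / 2) (by positivity)] with r h1 h2 h3 h4
      rw [hpow (by linarith)] at h2
      have h5 := (abs_le.1 h1).1
      have h6 : K * Real.log r ≤ |K| * Real.log r :=
        mul_le_mul_of_nonneg_right (le_abs_self K) (Real.log_nonneg h3.le)
      linarith
    · intro θ hθ
      have hθ' : ρ < θ / q := by rw [lt_div_iff₀ hq]; linarith
      obtain ⟨C, hC⟩ := hup _ hθ'
      refine ⟨C * κ ^ (θ / q) + 1, ?_⟩
      filter_upwards [hclose, htend.eventually hC, eventually_gt_atTop 1,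
        hlogo (hqρ.trans hθ) one_pos] with r h1 h2 h3 h4
      rw [hpow (by linarith), mul_div_cancel₀ θ hq.ne'] at h2
      have h5 := (abs_le.1 h1).2
      have h6 : K * Real.log r ≤ |K| * Real.log r :=
        mul_le_mul_of_nonneg_right (le_abs_self K) (Real.log_nonneg h3.le)
      linarith
  refine ⟨horder, ?_⟩
  rw [growthType, horder, EReal.toReal_coe]
  have h1 : limsup (fun r : ℝ => ((Real.log (maxModulus f r) / r ^ (q * ρ) : ℝ) : EReal)) atTop
      = limsup (fun r : ℝ => ((L (κ * r ^ q) / r ^ (q * ρ) : ℝ) : EReal)) atTop := by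
    refine limsup_coe_eq_of_sub_tendsto_zero ?_
    rw [Metric.tendsto_nhds]
    intro ε hε
    filter_upwards [hclose, eventually_gt_atTop 1, hlogo hqρ (half_pos hε)] with r h1 h3 h4
    have hr : 0 < r ^ (q * ρ) := by positivity
    rw [← sub_div, dist_zero_right, Real.norm_eq_abs, abs_div, abs_of_pos hr, div_lt_iff₀ hr]
    have h6 : K * Real.log r ≤ |K| * Real.log r :=
      mul_le_mul_of_nonneg_right (le_abs_self K) (Real.log_nonneg h3.le)
    nlinarith
  have h2 : limsup (fun r : ℝ => ((L (κ * r ^ q) / r ^ (q * ρ) : ℝ) : EReal)) atTop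
      = limsup (fun y : ℝ => ((κ ^ ρ * (L y / y ^ ρ) : ℝ) : EReal)) atTop := by
    conv_rhs => rw [← hmap]
    rw [← limsup_comp]
    refine limsup_congr ?_
    filter_upwards [eventually_gt_atTop 0] with r hr
    simp only [Function.comp]
    rw [hpow hr]
    congr 1
    have := Real.rpow_pos_of_pos hκ ρ
    field_simp
  rw [h1, h2]
  simp_rw [EReal.coe_mul]
  exact EReal.limsup_const_mul_of_nonneg_of_ne_top
    (by exact_mod_cast (Real.rpow_pos_of_pos hκ ρ).le) (EReal.coe_ne_top _)

/-- For `r ≥ e` one has `log r ≥ 1`, so the constants `log C` and `log D` can be charged to `log r`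
as well. -/
lemma abs_log_sub_log_le {A B C D r : ℝ} {k l : ℕ} (hA : 0 < A) (hB : 0 < B)
    (hr : Real.exp 1 ≤ r) (hC : 0 < C) (hD : 0 < D) (hAB : A ≤ C * r ^ k * B)
    (hBA : B ≤ D * r ^ l * A) :
    |Real.log A - Real.log B| ≤ (|Real.log C| + |Real.log D| + k + l) * Real.log r := by
  have hr0 : 0 < r := (Real.exp_pos 1).trans_le hr
  have hl : 1 ≤ Real.log r := by rwa [Real.le_log_iff_exp_le hr0]
  have key : ∀ {A B C : ℝ} {k : ℕ}, 0 < A → 0 < B → 0 < C → A ≤ C * r ^ k * B →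
      Real.log A - Real.log B ≤ Real.log C + k * Real.log r := by
    intro A B C k hA hB hC h
    have := Real.log_le_log hA h
    rw [Real.log_mul (by positivity) hB.ne', Real.log_mul hC.ne' (by positivity),
      Real.log_pow] at this
    linarith
  have h1 := key hA hB hC hAB
  have h2 := key hB hA hD hBA
  have hk : 0 ≤ (k : ℝ) * Real.log r := by positivity
  have hl' : 0 ≤ (l : ℝ) * Real.log r := by positivity
  have hc := le_abs_self (Real.log C)
  have hd := le_abs_self (Real.log D)
  have hc0 := abs_nonneg (Real.log C)
  have hd0 := abs_nonneg (Real.log D)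
  rw [abs_le]
  constructor <;> nlinarith

/-! ### Symmetric orthogonal polynomials as a chain -/

/-- `|P_{2n}(0)|` for a symmetric Jacobi matrix. -/
def alpha (b : ℕ → ℝ) : ℕ → ℝ
  | 0 => 1
  | n + 1 => alpha b n * (b (2 * n) / b (2 * n + 1))

/-- `|Q_{2n+1}(0)|` for a symmetric Jacobi matrix. -/
def beta (b : ℕ → ℝ) : ℕ → ℝ
  | 0 => (b 0)⁻¹
  | n + 1 => beta b n * (b (2 * n + 1) / b (2 * n + 2))

/-- The squares of the numbers `alpha`. -/
def alphaSq (b : ℕ → ℝ) (n : ℕ) : ℝ := alpha b n ^ 2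

/-- The squares of the numbers `beta`. -/
def betaSq (b : ℕ → ℝ) (n : ℕ) : ℝ := beta b n ^ 2

lemma alpha_pos {b : ℕ → ℝ} (hb : ∀ n, 0 < b n) (n : ℕ) : 0 < alpha b n := by
  induction n with
  | zero => simp [alpha]
  | succ n ih => rw [alpha]; exact mul_pos ih (div_pos (hb _) (hb _))

lemma beta_pos {b : ℕ → ℝ} (hb : ∀ n, 0 < b n) (n : ℕ) : 0 < beta b n := by
  induction n with
  | zero => simpa [beta] using hb 0
  | succ n ih => rw [beta]; exact mul_pos ih (div_pos (hb _) (hb _))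

/-- This is the Wronskian identity `b_{2n} (P_{2n} Q_{2n+1} - P_{2n+1} Q_{2n}) = 1` at the origin,
where the second product vanishes. -/
lemma alpha_mul_beta {b : ℕ → ℝ} (hb : ∀ n, 0 < b n) (n : ℕ) :
    b (2 * n) * alpha b n * beta b n = 1 := by
  induction n with
  | zero => simpa [alpha, beta] using mul_inv_cancel₀ (hb 0).ne'
  | succ n ih =>
    have h1 := (hb (2 * n + 1)).ne'
    have h2 := (hb (2 * n + 2)).ne'
    rw [alpha, beta, show 2 * (n + 1) = 2 * n + 2 by ring]
    field_simp
    linarith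

/-- Solutions of the three-term recurrence in terms of the chain. -/
lemma recurrence_eq_chain {b : ℕ → ℝ} (hb : ∀ n, 0 < b n) {z t : ℂ} {a : ℝ × ℝ} {r : ℕ → ℂ}
    (h0 : r 0 = t * a.1) (h1 : r 1 = t * Complex.I * beta b 0 *
      cV (alphaSq b) (betaSq b) (-Complex.I * z) a 1)
    (hr : ∀ n, r (n + 2) = (b (n + 1) : ℂ)⁻¹ * (z * r (n + 1) - b n * r n)) (n : ℕ) :
    r (2 * n) = t * (-1) ^ n * alpha b n *
      cU (alphaSq b) (betaSq b) (-Complex.I * z) a n ∧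
    r (2 * n + 1) = t * (-1) ^ n * Complex.I * beta b n *
      cV (alphaSq b) (betaSq b) (-Complex.I * z) a (n + 1) := by
  have hI : Complex.I ^ 2 = -1 := Complex.I_sq
  induction n with
  | zero =>
    refine ⟨?_, ?_⟩
    · simpa [alpha, cU] using h0
    · simpa using h1
  | succ n ih =>
    obtain ⟨ihU, ihV⟩ := ih
    have hb1 : (b (2 * n + 1) : ℂ) ≠ 0 := by exact_mod_cast (hb _).ne'
    have hb2 : (b (2 * n + 2) : ℂ) ≠ 0 := by exact_mod_cast (hb _).ne'
    have hab : (b (2 * n) : ℂ) * alpha b n * beta b n = 1 := by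
      exact_mod_cast alpha_mul_beta hb n
    have hab' : (b (2 * n + 2) : ℂ) * alpha b (n + 1) * beta b (n + 1) = 1 := by
      exact_mod_cast alpha_mul_beta hb (n + 1)
    have hα : (b (2 * n + 1) : ℂ) * alpha b (n + 1) = b (2 * n) * alpha b n := by
      rw [alpha]; push_cast; field_simp
    have hβ : (b (2 * n + 2) : ℂ) * beta b (n + 1) = b (2 * n + 1) * beta b n := by
      rw [beta]; push_cast; field_simp
    have hU : r (2 * (n + 1)) = t * (-1) ^ (n + 1) * alpha b (n + 1) *
        cU (alphaSq b) (betaSq b) (-Complex.I * z) a (n + 1) := by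
      rw [cU_succ, show 2 * (n + 1) = 2 * n + 2 by ring, hr, ihU, ihV,
        inv_mul_eq_iff_eq_mul₀ hb1]
      generalize cU (alphaSq b) (betaSq b) (-Complex.I * z) a n = u
      generalize cV (alphaSq b) (betaSq b) (-Complex.I * z) a (n + 1) = v
      rw [betaSq]
      push_cast
      linear_combination (-t * (-1) ^ n * Complex.I * z * beta b n * v) * hab
        + (t * (-1) ^ n * (u - Complex.I * z * beta b n ^ 2 * v)) * hα
    refine ⟨hU, ?_⟩
    rw [cV_succ, show 2 * (n + 1) + 1 = 2 * n + 1 + 2 by ring, hr,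
      show 2 * n + 1 + 1 = 2 * (n + 1) by ring, hU, ihV]
    rw [show 2 * (n + 1) = 2 * n + 2 by ring, inv_mul_eq_iff_eq_mul₀ hb2]
    generalize cU (alphaSq b) (betaSq b) (-Complex.I * z) a (n + 1) = u
    generalize cV (alphaSq b) (betaSq b) (-Complex.I * z) a (n + 1) = v
    rw [alphaSq]
    push_cast
    linear_combination (-t * (-1) ^ n * Complex.I ^ 2 * z * alpha b (n + 1) * u) * hab'
      + (t * (-1) ^ n * Complex.I * v) * hβ
      - (t * (-1) ^ n * z * alpha b (n + 1) * u) * hI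

lemma cP_eq_chain {b : ℕ → ℝ} (hb : ∀ n, 0 < b n) (z : ℂ) (n : ℕ) :
    cP (fun _ => 0) b (2 * n) z = (-1) ^ n * alpha b n *
      cU (alphaSq b) (betaSq b) (-Complex.I * z) (1, 0) n ∧
    cP (fun _ => 0) b (2 * n + 1) z = (-1) ^ n * Complex.I * beta b n *
      cV (alphaSq b) (betaSq b) (-Complex.I * z) (1, 0) (n + 1) := by
  have := recurrence_eq_chain hb (z := z) (t := 1) (a := (1, 0))
    (r := fun n => cP (fun _ => 0) b n z) (by simp [cP, orthoP])
    (by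
      rw [cV_succ]
      simp [cP, orthoP, alphaSq, beta, alpha, cU, cV]
      linear_combination ((b 0 : ℂ)⁻¹ * z) * Complex.I_sq)
    (fun n => by simp [cP, orthoP]) n
  simpa using this

lemma cQ_eq_chain {b : ℕ → ℝ} (hb : ∀ n, 0 < b n) (z : ℂ) (n : ℕ) :
    cQ (fun _ => 0) b (2 * n) z = -Complex.I * (-1) ^ n * alpha b n *
      cU (alphaSq b) (betaSq b) (-Complex.I * z) (0, 1) n ∧
    cQ (fun _ => 0) b (2 * n + 1) z = (-1) ^ n * beta b n *
      cV (alphaSq b) (betaSq b) (-Complex.I * z) (0, 1) (n + 1) := by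
  have := recurrence_eq_chain hb (z := z) (t := -Complex.I) (a := (0, 1))
    (r := fun n => cQ (fun _ => 0) b n z) (by simp [cQ, orthoQ])
    (by
      rw [cV_succ]
      simp [cQ, orthoQ, beta, cU, cV])
    (fun n => by simp [cQ, orthoQ]) n
  refine ⟨this.1, this.2.trans ?_⟩
  linear_combination (-(-1) ^ n * beta b n *
      cV (alphaSq b) (betaSq b) (-Complex.I * z) (0, 1) (n + 1)) * Complex.I_sq

lemma chain_at_zero (m s : ℕ → ℝ) (a : ℝ × ℝ) (n : ℕ) :
    cU m s 0 a n = a.1 ∧ cV m s 0 a n = a.2 := by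
  rw [cU, cV, chainU_eq_sum, chainV_eq_sum]; simp

lemma cP_zero {b : ℕ → ℝ} (hb : ∀ n, 0 < b n) (n : ℕ) :
    cP (fun _ => 0) b (2 * n) 0 = (-1) ^ n * alpha b n ∧ cP (fun _ => 0) b (2 * n + 1) 0 = 0 := by
  have := cP_eq_chain hb 0 n
  simpa [chain_at_zero] using this

lemma cQ_zero {b : ℕ → ℝ} (hb : ∀ n, 0 < b n) (n : ℕ) :
    cQ (fun _ => 0) b (2 * n) 0 = 0 ∧ cQ (fun _ => 0) b (2 * n + 1) 0 = (-1) ^ n * beta b n := by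
  have := cQ_eq_chain hb 0 n
  simpa [chain_at_zero] using this

lemma hasSum_iff_of_eq {f g : ℕ → ℂ} {S : ℂ} (h : ∀ n, f n = g n) : HasSum f S ↔ HasSum g S := by
  rw [funext h]

lemma hasSum_of_even {f : ℕ → ℂ} {S : ℂ} (h : HasSum (fun n => f (2 * n)) S)
    (h' : ∀ n, f (2 * n + 1) = 0) : HasSum f S := by
  have : HasSum (fun n => f (2 * n + 1)) 0 := by simp [h']
  simpa using h.even_add_odd this

lemma hasSum_of_odd {f : ℕ → ℂ} {S : ℂ} (h : HasSum (fun n => f (2 * n + 1)) S)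
    (h' : ∀ n, f (2 * n) = 0) : HasSum f S := by
  have : HasSum (fun n => f (2 * n)) 0 := by simp [h']
  simpa using this.even_add_odd h

lemma neg_one_pow_mul_self (n : ℕ) : ((-1 : ℂ) ^ n) * (-1) ^ n = 1 := by
  rw [← mul_pow]; simp

/-! ### The Nevanlinna entries as limits of the rotated chain -/

section Series

variable {b : ℕ → ℝ}

/-- Only even indices survive because `P_{2n+1}(0) = 0`, and the signs `(-1)^n` of `P_{2n}(0)` and
`P_{2n}(z)` cancel. The other three series follow the same pattern. -/
lemma hasSum_PP (hb : ∀ n, 0 < b n) (h : Weights (alphaSq b) (betaSq b)) (z : ℂ) :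
    HasSum (fun k => cP (fun _ => 0) b k 0 * cP (fun _ => 0) b k z)
      (∑' n, alphaSq b n * cU (alphaSq b) (betaSq b) (-Complex.I * z) (1, 0) n) := by
  refine hasSum_of_even ?_ fun n => by rw [(cP_zero hb n).2, zero_mul]
  have := (h.summable_cU (a := (1, 0)) (by simp [Prod.le_def]) (-Complex.I * z)).hasSum
  refine (hasSum_iff_of_eq fun n => ?_).mpr this
  rw [(cP_zero hb n).1, (cP_eq_chain hb z n).1, alphaSq]
  push_cast
  linear_combination (alpha b n ^ 2 * cU (alphaSq b) (betaSq b) (-Complex.I * z) (1, 0) n)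
    * neg_one_pow_mul_self n

lemma hasSum_PQ (hb : ∀ n, 0 < b n) (h : Weights (alphaSq b) (betaSq b)) (z : ℂ) :
    HasSum (fun k => cP (fun _ => 0) b k 0 * cQ (fun _ => 0) b k z)
      (-Complex.I * ∑' n, alphaSq b n * cU (alphaSq b) (betaSq b) (-Complex.I * z) (0, 1) n) := by
  refine hasSum_of_even ?_ fun n => by rw [(cP_zero hb n).2, zero_mul]
  have := (h.summable_cU (a := (0, 1)) (by simp [Prod.le_def]) (-Complex.I * z)).hasSum
  refine (hasSum_iff_of_eq fun n => ?_).mpr (this.mul_left (-Complex.I))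
  rw [(cP_zero hb n).1, (cQ_eq_chain hb z n).1, alphaSq]
  push_cast
  linear_combination (-Complex.I * alpha b n ^ 2 *
    cU (alphaSq b) (betaSq b) (-Complex.I * z) (0, 1) n) * neg_one_pow_mul_self n

lemma hasSum_QP (hb : ∀ n, 0 < b n) (h : Weights (alphaSq b) (betaSq b)) (z : ℂ) :
    HasSum (fun k => cQ (fun _ => 0) b k 0 * cP (fun _ => 0) b k z)
      (Complex.I *
        ∑' n, betaSq b n * cV (alphaSq b) (betaSq b) (-Complex.I * z) (1, 0) (n + 1)) := by
  refine hasSum_of_odd ?_ fun n => by rw [(cQ_zero hb n).1, zero_mul]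
  have := (h.summable_cV (a := (1, 0)) (by simp [Prod.le_def]) (-Complex.I * z)).hasSum
  refine (hasSum_iff_of_eq fun n => ?_).mpr (this.mul_left Complex.I)
  rw [(cQ_zero hb n).2, (cP_eq_chain hb z n).2, betaSq]
  push_cast
  linear_combination (Complex.I * beta b n ^ 2 *
    cV (alphaSq b) (betaSq b) (-Complex.I * z) (1, 0) (n + 1)) * neg_one_pow_mul_self n

lemma hasSum_QQ (hb : ∀ n, 0 < b n) (h : Weights (alphaSq b) (betaSq b)) (z : ℂ) :
    HasSum (fun k => cQ (fun _ => 0) b k 0 * cQ (fun _ => 0) b k z)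
      (∑' n, betaSq b n * cV (alphaSq b) (betaSq b) (-Complex.I * z) (0, 1) (n + 1)) := by
  refine hasSum_of_odd ?_ fun n => by rw [(cQ_zero hb n).1, zero_mul]
  have := (h.summable_cV (a := (0, 1)) (by simp [Prod.le_def]) (-Complex.I * z)).hasSum
  refine (hasSum_iff_of_eq fun n => ?_).mpr this
  rw [(cQ_zero hb n).2, (cQ_eq_chain hb z n).2, betaSq]
  push_cast
  linear_combination (beta b n ^ 2 *
    cV (alphaSq b) (betaSq b) (-Complex.I * z) (0, 1) (n + 1)) * neg_one_pow_mul_self n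

lemma nevA_eq (hb : ∀ n, 0 < b n) (h : Weights (alphaSq b) (betaSq b)) (z : ℂ) :
    nevA (fun _ => 0) b z
      = Complex.I * cLimU (alphaSq b) (betaSq b) (-Complex.I * z) (0, 1) := by
  rw [nevA, (hasSum_QQ hb h z).tsum_eq, cLimU]
  push_cast
  linear_combination (z * ∑' n, betaSq b n * cV (alphaSq b) (betaSq b) (-Complex.I * z) (0, 1)
    (n + 1)) * Complex.I_sq

lemma nevB_eq (hb : ∀ n, 0 < b n) (h : Weights (alphaSq b) (betaSq b)) (z : ℂ) :
    nevB (fun _ => 0) b z = -cLimU (alphaSq b) (betaSq b) (-Complex.I * z) (1, 0) := by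
  rw [nevB, (hasSum_QP hb h z).tsum_eq, cLimU]
  push_cast
  ring

lemma nevC_eq (hb : ∀ n, 0 < b n) (h : Weights (alphaSq b) (betaSq b)) (z : ℂ) :
    nevC (fun _ => 0) b z = cLimV (alphaSq b) (betaSq b) (-Complex.I * z) (0, 1) := by
  rw [nevC, (hasSum_PQ hb h z).tsum_eq, cLimV]
  push_cast
  ring

lemma nevD_eq (hb : ∀ n, 0 < b n) (h : Weights (alphaSq b) (betaSq b)) (z : ℂ) :
    nevD (fun _ => 0) b z
      = Complex.I * cLimV (alphaSq b) (betaSq b) (-Complex.I * z) (1, 0) := by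
  rw [nevD, (hasSum_PP hb h z).tsum_eq, cLimV]
  push_cast
  linear_combination (z * ∑' n, alphaSq b n * cU (alphaSq b) (betaSq b) (-Complex.I * z) (1, 0) n)
    * Complex.I_sq

lemma nevanlinnaEntire (hb : ∀ n, 0 < b n) (h : Weights (alphaSq b) (betaSq b)) :
    NevanlinnaEntire (fun _ => 0) b := by
  have hrot : Differentiable ℂ fun z : ℂ => -Complex.I * z := differentiable_id.const_mul _
  have h10 : (0 : ℝ × ℝ) ≤ (1, 0) := by simp [Prod.le_def]
  have h01 : (0 : ℝ × ℝ) ≤ (0, 1) := by simp [Prod.le_def]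
  refine ⟨fun z => ⟨(hasSum_QQ hb h z).summable, (hasSum_QP hb h z).summable,
    (hasSum_PQ hb h z).summable, (hasSum_PP hb h z).summable⟩, ?_, ?_, ?_, ?_⟩
  · rw [funext (nevA_eq hb h)]
    exact ((h.differentiable_cLimU h01).comp hrot).const_mul _
  · rw [funext (nevB_eq hb h)]
    exact ((h.differentiable_cLimU h10).comp hrot).neg
  · rw [funext (nevC_eq hb h)]
    exact (h.differentiable_cLimV h01).comp hrot
  · rw [funext (nevD_eq hb h)]
    exact ((h.differentiable_cLimV h10).comp hrot).const_mul _

/-- The bound by the real limit is attained at `z = ir`, which the rotation sends to the positive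
number `r`. -/
lemma maxModulus_rotated {f F : ℂ → ℂ} {L : ℝ → ℝ} (hf : ∀ z, ‖f z‖ = ‖F (-Complex.I * z)‖)
    (hF : ∀ z, ‖F z‖ ≤ L ‖z‖) (hL : ∀ r : ℝ, 0 ≤ r → F r = L r) (hL0 : ∀ r, 0 ≤ r → 0 ≤ L r)
    {r : ℝ} (hr : 0 ≤ r) : maxModulus f r = L r := by
  refine maxModulus_eq (w := Complex.I * r) (fun z hz => ?_) (by simp [abs_of_nonneg hr]) ?_
  · rw [hf]
    refine (hF _).trans ?_
    simp [hz]
  · rw [hf, show -Complex.I * (Complex.I * r) = r by linear_combination (-(r : ℂ)) * Complex.I_sq,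
      hL r hr, Complex.norm_real, Real.norm_of_nonneg (hL0 r hr)]

end Series

namespace Weights

variable {m s : ℕ → ℝ}

lemma limU_nonneg (h : Weights m s) {a : ℝ × ℝ} (ha : 0 ≤ a) {y : ℝ} (hy : 0 ≤ y) :
    0 ≤ limU m s y a :=
  ha.1.trans (chainU_le_limU h.nonneg_left h.nonneg_right hy ha (h.summableV ha hy) 0)

lemma limV_nonneg (h : Weights m s) {a : ℝ × ℝ} (ha : 0 ≤ a) {y : ℝ} (hy : 0 ≤ y) :
    0 ≤ limV m s y a :=
  ha.2.trans (chainV_le_limV h.nonneg_left h.nonneg_right hy ha (h.summableU ha hy) 0)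

end Weights

lemma maxModulus_nev {b : ℕ → ℝ} (hb : ∀ n, 0 < b n) (h : Weights (alphaSq b) (betaSq b))
    {r : ℝ} (hr : 0 ≤ r) :
    maxModulus (nevA (fun _ => 0) b) r = limU (alphaSq b) (betaSq b) r (0, 1) ∧
    maxModulus (nevB (fun _ => 0) b) r = limU (alphaSq b) (betaSq b) r (1, 0) ∧
    maxModulus (nevC (fun _ => 0) b) r = limV (alphaSq b) (betaSq b) r (0, 1) ∧
    maxModulus (nevD (fun _ => 0) b) r = limV (alphaSq b) (betaSq b) r (1, 0) := by
  have h10 : (0 : ℝ × ℝ) ≤ (1, 0) := by simp [Prod.le_def]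
  have h01 : (0 : ℝ × ℝ) ≤ (0, 1) := by simp [Prod.le_def]
  refine ⟨?_, ?_, ?_, ?_⟩
  · exact maxModulus_rotated (F := fun z => cLimU (alphaSq b) (betaSq b) z (0, 1))
      (L := fun r => limU (alphaSq b) (betaSq b) r (0, 1))
      (fun z => by rw [nevA_eq hb h]; simp) (h.norm_cLimU_le h01)
      (fun r _ => cLimU_ofReal _ _ _ _) (fun r hr => h.limU_nonneg h01 hr) hr
  · exact maxModulus_rotated (F := fun z => cLimU (alphaSq b) (betaSq b) z (1, 0))
      (L := fun r => limU (alphaSq b) (betaSq b) r (1, 0))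
      (fun z => by rw [nevB_eq hb h]; simp) (h.norm_cLimU_le h10)
      (fun r _ => cLimU_ofReal _ _ _ _) (fun r hr => h.limU_nonneg h10 hr) hr
  · exact maxModulus_rotated (F := fun z => cLimV (alphaSq b) (betaSq b) z (0, 1))
      (L := fun r => limV (alphaSq b) (betaSq b) r (0, 1))
      (fun z => by rw [nevC_eq hb h]) (h.norm_cLimV_le h01)
      (fun r _ => cLimV_ofReal _ _ _ _) (fun r hr => h.limV_nonneg h01 hr) hr
  · exact maxModulus_rotated (F := fun z => cLimV (alphaSq b) (betaSq b) z (1, 0))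
      (L := fun r => limV (alphaSq b) (betaSq b) r (1, 0))
      (fun z => by rw [nevD_eq hb h]; simp) (h.norm_cLimV_le h10)
      (fun r _ => cLimV_ofReal _ _ _ _) (fun r hr => h.limV_nonneg h10 hr) hr

section

open scoped ENNReal

/-! ### Power series coefficients of the limits of a chain -/

/-- The sum of all weights `m_{k_1} s_{k_2} m_{k_3} ⋯` over `k_1 ≤ k_2 < k_3 ≤ ⋯` of length `j + 1`
with last entry `K`. -/
def chainCoeff (m s : ℕ → ℝ≥0∞) : ℕ → ℕ → ℝ≥0∞
  | 0, K => m K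
  | j + 1, K => if Even j then s K * ∑ a ∈ Finset.range (K + 1), chainCoeff m s j a
      else m K * ∑ a ∈ Finset.range K, chainCoeff m s j a

lemma chainCoeff_odd (m s : ℕ → ℝ≥0∞) (n K : ℕ) : chainCoeff m s (2 * n + 1) K
    = s K * ∑ a ∈ Finset.range (K + 1), chainCoeff m s (2 * n) a := by
  rw [chainCoeff, if_pos (even_two_mul n)]

lemma chainCoeff_even (m s : ℕ → ℝ≥0∞) (n K : ℕ) : chainCoeff m s (2 * n + 2) K
    = m K * ∑ a ∈ Finset.range K, chainCoeff m s (2 * n + 1) a := by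
  rw [chainCoeff, if_neg (by simp)]

/-- Paths through the recursion are grouped by length and last index. Working in `ℝ≥0∞` lets all
rearrangements go through without summability side conditions; finiteness is recovered later from
the known real limit. -/
lemma chain_eq_tsum (m s : ℕ → ℝ≥0∞) (y : ℝ≥0∞) (N : ℕ) :
    chainU m s y (1, 0) N
      = 1 + ∑' n, y ^ (2 * n + 2) * ∑ K ∈ Finset.range N, chainCoeff m s (2 * n + 1) K ∧
    chainV m s y (1, 0) N
      = ∑' n, y ^ (2 * n + 1) * ∑ K ∈ Finset.range N, chainCoeff m s (2 * n) K := by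
  induction N with
  | zero => simp
  | succ N ih =>
    have hV : chainV m s y (1, 0) (N + 1)
        = ∑' n, y ^ (2 * n + 1) * ∑ K ∈ Finset.range (N + 1), chainCoeff m s (2 * n) K := by
      simp_rw [Finset.sum_range_succ, mul_add]
      rw [chainV_succ, ih.1, ih.2, ENNReal.tsum_add]
      congr 1
      rw [tsum_eq_zero_add' (f := fun n => y ^ (2 * n + 1) * chainCoeff m s (2 * n) N)
        ENNReal.summable, mul_add]
      congr 1
      · simp [chainCoeff]
      · rw [← ENNReal.tsum_mul_left]
        refine tsum_congr fun n => ?_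
        rw [show 2 * (n + 1) = 2 * n + 2 by ring, chainCoeff_even]
        ring
    refine ⟨?_, hV⟩
    rw [chainU_succ, hV, ih.1, add_assoc]
    congr 1
    rw [← ENNReal.tsum_mul_left, ← ENNReal.tsum_add]
    refine tsum_congr fun n => ?_
    rw [Finset.sum_range_succ (fun K => chainCoeff m s (2 * n + 1) K), chainCoeff_odd]
    ring

lemma chain_ofReal {m s : ℕ → ℝ} (hm : ∀ k, 0 ≤ m k) (hs : ∀ k, 0 ≤ s k) {y : ℝ} (hy : 0 ≤ y)
    (N : ℕ) :
    chainU (fun k => ENNReal.ofReal (m k)) (fun k => ENNReal.ofReal (s k)) (ENNReal.ofReal y)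
      (1, 0) N = ENNReal.ofReal (chainU m s y (1, 0) N) ∧
    chainV (fun k => ENNReal.ofReal (m k)) (fun k => ENNReal.ofReal (s k)) (ENNReal.ofReal y)
      (1, 0) N = ENNReal.ofReal (chainV m s y (1, 0) N) := by
  have h10 : (0 : ℝ × ℝ) ≤ (1, 0) := by simp [Prod.le_def]
  induction N with
  | zero => simp
  | succ N ih =>
    obtain ⟨h1, h2⟩ := chain_nonneg hm hs hy h10 N
    have h3 := (chain_nonneg hm hs hy h10 (N + 1)).2
    have hV : chainV (fun k => ENNReal.ofReal (m k)) (fun k => ENNReal.ofReal (s k))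
        (ENNReal.ofReal y) (1, 0) (N + 1) = ENNReal.ofReal (chainV m s y (1, 0) (N + 1)) := by
      have := hm N
      rw [chainV_succ, chainV_succ, ih.1, ih.2, ENNReal.ofReal_add h2 (by positivity),
        ENNReal.ofReal_mul (by positivity), ENNReal.ofReal_mul hy]
    refine ⟨?_, hV⟩
    have := hs N
    rw [chainU_succ, chainU_succ, hV, ih.1, ENNReal.ofReal_add h1 (by positivity),
        ENNReal.ofReal_mul (by positivity), ENNReal.ofReal_mul hy]

lemma ofReal_limU {m s : ℕ → ℝ} (hm : ∀ k, 0 ≤ m k) (hs : ∀ k, 0 ≤ s k) {y : ℝ} (hy : 0 ≤ y)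
    (h : Summable fun k => s k * chainV m s y (1, 0) (k + 1)) :
    ENNReal.ofReal (limU m s y (1, 0)) = 1 + ∑' n, ENNReal.ofReal y ^ (2 * n + 2) *
      ∑' K, chainCoeff (fun k => ENNReal.ofReal (m k)) (fun k => ENNReal.ofReal (s k))
        (2 * n + 1) K := by
  have h10 : (0 : ℝ × ℝ) ≤ (1, 0) := by simp [Prod.le_def]
  have hnn : ∀ k, 0 ≤ s k * chainV m s y (1, 0) (k + 1) := fun k =>
    mul_nonneg (hs k) (chain_nonneg hm hs hy h10 (k + 1)).2
  rw [limU, ENNReal.ofReal_add (by simp) (mul_nonneg hy (tsum_nonneg hnn)),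
    ENNReal.ofReal_mul hy, ENNReal.ofReal_tsum_of_nonneg hnn h]
  congr 1
  · simp
  rw [← ENNReal.tsum_mul_left]
  simp_rw [← ENNReal.tsum_mul_left]
  rw [ENNReal.tsum_comm]
  refine tsum_congr fun k => ?_
  rw [ENNReal.ofReal_mul (hs k), ← (chain_ofReal hm hs hy _).2, (chain_eq_tsum _ _ _ _).2,
    ← ENNReal.tsum_mul_left, ← ENNReal.tsum_mul_left]
  refine tsum_congr fun n => ?_
  rw [chainCoeff_odd]
  ring

lemma ofReal_limV {m s : ℕ → ℝ} (hm : ∀ k, 0 ≤ m k) (hs : ∀ k, 0 ≤ s k) {y : ℝ} (hy : 0 ≤ y)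
    (h : Summable fun k => m k * chainU m s y (1, 0) k) :
    ENNReal.ofReal (limV m s y (1, 0)) = ∑' n, ENNReal.ofReal y ^ (2 * n + 1) *
      ∑' K, chainCoeff (fun k => ENNReal.ofReal (m k)) (fun k => ENNReal.ofReal (s k))
        (2 * n) K := by
  have h10 : (0 : ℝ × ℝ) ≤ (1, 0) := by simp [Prod.le_def]
  have hnn : ∀ k, 0 ≤ m k * chainU m s y (1, 0) k := fun k =>
    mul_nonneg (hm k) (chain_nonneg hm hs hy h10 k).1
  rw [limV, zero_add, ENNReal.ofReal_mul hy, ENNReal.ofReal_tsum_of_nonneg hnn h,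
    ← ENNReal.tsum_mul_left]
  conv_rhs => enter [1, n]; rw [← ENNReal.tsum_mul_left]
  rw [ENNReal.tsum_comm]
  refine tsum_congr fun k => ?_
  rw [ENNReal.ofReal_mul (hm k), ← (chain_ofReal hm hs hy _).1, (chain_eq_tsum _ _ _ _).1,
    tsum_eq_zero_add' (f := fun n => ENNReal.ofReal y ^ (2 * n + 1) *
      chainCoeff (fun k => ENNReal.ofReal (m k)) (fun k => ENNReal.ofReal (s k)) (2 * n) k)
      ENNReal.summable, mul_add, mul_add]
  congr 1
  · simp [chainCoeff]
  rw [← ENNReal.tsum_mul_left, ← ENNReal.tsum_mul_left]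
  refine tsum_congr fun n => ?_
  rw [show 2 * (n + 1) = 2 * n + 2 by ring, chainCoeff_even]
  ring

/-! ### Iterated sums over tuples -/

/-- Iterated transition sums. -/
def iterSum (f : ℕ → ℝ≥0∞) (κ : ℕ → ℕ → ℕ → ℝ≥0∞) : ℕ → ℕ → ℝ≥0∞
  | 0, K => f K
  | j + 1, K => ∑' a, iterSum f κ j a * κ j a K

/-- Transfer-matrix summation: peel off the last coordinate. The test function `φ` is there for the
induction, where it becomes the next transition weight. -/
lemma tsum_tuple_eq_iterSum (f : ℕ → ℝ≥0∞) (κ : ℕ → ℕ → ℕ → ℝ≥0∞) (j : ℕ) (φ : ℕ → ℝ≥0∞) :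
    ∑' k : Fin (j + 1) → ℕ, f (k 0) * (∏ i : Fin j, κ i (k i.castSucc) (k i.succ))
      * φ (k (Fin.last j)) = ∑' K, iterSum f κ j K * φ K := by
  induction j generalizing φ with
  | zero =>
    rw [← (Equiv.funUnique (Fin 1) ℕ).symm.tsum_eq]
    refine tsum_congr fun K => ?_
    simp [iterSum]
  | succ j ih =>
    rw [← (Fin.snocEquiv fun _ : Fin (j + 2) => ℕ).tsum_eq, ENNReal.tsum_prod']
    refine tsum_congr fun K => ?_
    have := ih fun a => κ j a K
    rw [iterSum, ← this, ← ENNReal.tsum_mul_right]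
    refine tsum_congr fun k => ?_
    simp only [Fin.snocEquiv, Equiv.coe_fn_mk, Fin.snoc_last]
    rw [Fin.prod_univ_castSucc]
    have h0 : (Fin.snoc (α := fun _ : Fin (j + 2) => ℕ) k K : Fin (j + 2) → ℕ) 0 = k 0 := by
      have := Fin.snoc_castSucc (α := fun _ : Fin (j + 2) => ℕ) K k 0
      exact this
    rw [h0]
    simp only [Fin.snoc_castSucc, Fin.succ_last, Fin.snoc_last, Fin.succ_castSucc, Fin.val_castSucc,
      Fin.val_last]
    ring

/-- The transition weights for `gammaMZ`. -/
def gammaStep (q : ℝ) (i a b : ℕ) : ℝ≥0∞ :=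
  if (Even i → a ≤ b) ∧ (Odd i → a < b) then ENNReal.ofReal ((b : ℝ) ^ (-q)) else 0

/-- The transition weights for `zetaMZsucc`. -/
def zetaStep (p : ℝ) (_i a b : ℕ) : ℝ≥0∞ :=
  if a < b then ENNReal.ofReal (((b : ℝ) - a) * (b : ℝ) ^ (-p)) else 0

lemma iterSum_gammaStep (q : ℝ) (j K : ℕ) :
    iterSum (fun k => ENNReal.ofReal ((k : ℝ) ^ (-q))) (gammaStep q) j K
      = chainCoeff (fun k => ENNReal.ofReal ((k : ℝ) ^ (-q)))
        (fun k => ENNReal.ofReal ((k : ℝ) ^ (-q))) j K := by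
  induction j generalizing K with
  | zero => rfl
  | succ j ih =>
    rw [iterSum, chainCoeff]
    simp_rw [ih]
    split_ifs with hj
    · rw [tsum_eq_sum (s := Finset.range (K + 1)), Finset.mul_sum]
      · refine Finset.sum_congr rfl fun a ha => ?_
        have : a ≤ K := Nat.lt_succ_iff.1 (Finset.mem_range.1 ha)
        rw [gammaStep, if_pos ⟨fun _ => this, fun h => absurd hj (Nat.not_even_iff_odd.2 h)⟩,
          mul_comm]
      · intro a ha
        rw [gammaStep, if_neg, mul_zero]
        rintro ⟨h, -⟩
        exact ha (Finset.mem_range.2 (Nat.lt_succ_iff.2 (h hj)))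
    · have hj' := Nat.not_even_iff_odd.1 hj
      rw [tsum_eq_sum (s := Finset.range K), Finset.mul_sum]
      · refine Finset.sum_congr rfl fun a ha => ?_
        have : a < K := Finset.mem_range.1 ha
        rw [gammaStep, if_pos ⟨fun h => absurd h hj, fun _ => this⟩, mul_comm]
      · intro a ha
        rw [gammaStep, if_neg, mul_zero]
        rintro ⟨-, h⟩
        exact ha (Finset.mem_range.2 (h hj'))

/-- Exchanging the sums, `f b` is counted once for each `a` with `b ≤ a < K`. This is the source of
the gap factors in `ζ_n`. -/
lemma sum_range_sum_range_succ (f : ℕ → ℝ≥0∞) (K : ℕ) :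
    ∑ a ∈ Finset.range K, ∑ b ∈ Finset.range (a + 1), f b
      = ∑ b ∈ Finset.range K, ((K - b : ℕ) : ℝ≥0∞) * f b := by
  induction K with
  | zero => simp
  | succ K ih =>
    rw [Finset.sum_range_succ, ih, Finset.sum_range_succ, Finset.sum_range_succ, ← add_assoc,
      ← Finset.sum_add_distrib]
    congr 1
    · refine Finset.sum_congr rfl fun b hb => ?_
      have : b < K := Finset.mem_range.1 hb
      rw [show K + 1 - b = (K - b) + 1 by omega]
      push_cast
      ring
    · simp

lemma iterSum_zetaStep (p : ℝ) (j K : ℕ) :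
    iterSum (fun k => ENNReal.ofReal ((k : ℝ) ^ (-p))) (zetaStep p) j K
      = chainCoeff (fun k => ENNReal.ofReal ((k : ℝ) ^ (-p)))
        (fun _ => ENNReal.ofReal 1) (2 * j) K := by
  induction j generalizing K with
  | zero => rfl
  | succ j ih =>
    rw [iterSum, show 2 * (j + 1) = 2 * j + 2 by ring, chainCoeff_even]
    simp_rw [ih, chainCoeff_odd, ENNReal.ofReal_one, one_mul]
    rw [sum_range_sum_range_succ, tsum_eq_sum (s := Finset.range K), Finset.mul_sum]
    · refine Finset.sum_congr rfl fun a ha => ?_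
      have : a < K := Finset.mem_range.1 ha
      rw [zetaStep, if_pos this, ENNReal.ofReal_mul (by
        rw [sub_nonneg]; exact_mod_cast this.le), ← Nat.cast_sub this.le, ENNReal.ofReal_natCast]
      ring
    · intro a ha
      rw [zetaStep, if_neg (by simpa using ha), mul_zero]

/-- The sum over admissible tuples is extended by zero to all tuples, where it factors into
transitions. An inadmissible tuple contributes nothing: it either breaks an order relation or has a
zero entry. -/
lemma tsum_gammaTerm {p : ℝ} (hp : 0 < p) (n : ℕ) :
    ∑' k : gammaIndex (n + 1), ENNReal.ofReal (gammaTerm (n + 1) p k)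
      = ∑' K, chainCoeff (fun k => ENNReal.ofReal ((k : ℝ) ^ (-(p / 2))))
        (fun k => ENNReal.ofReal ((k : ℝ) ^ (-(p / 2)))) (2 * n + 1) K := by
  have key := tsum_tuple_eq_iterSum (fun k => ENNReal.ofReal ((k : ℝ) ^ (-(p / 2))))
    (gammaStep (p / 2)) (2 * n + 1) fun _ => 1
  simp only [mul_one, iterSum_gammaStep] at key
  rw [← key]
  have hsub := tsum_subtype (gammaIndex (n + 1)) fun k : Fin (2 * (n + 1)) → ℕ =>
    ENNReal.ofReal ((∏ i, (k i : ℝ)) ^ (-(p / 2)))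
  refine hsub.trans (tsum_congr fun k => ?_)
  change Fin (2 * n + 1 + 1) → ℕ at k
  by_cases hk : k ∈ gammaIndex (n + 1)
  · rw [Set.indicator_of_mem hk, ← Real.finsetProd_rpow _ _ (fun i _ => Nat.cast_nonneg _),
      ENNReal.ofReal_prod_of_nonneg (fun i _ => Real.rpow_nonneg (Nat.cast_nonneg _) _)]
    refine (Fin.prod_univ_succ (n := 2 * n + 1)
      fun i => ENNReal.ofReal ((k i : ℝ) ^ (-(p / 2)))).trans ?_
    congr 1
    refine Finset.prod_congr rfl fun i _ => ?_
    have := hk.2 i.castSucc i.succ (by simp)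
    rw [gammaStep, if_pos (by simpa using this)]
  · rw [Set.indicator_of_notMem hk]
    symm
    by_cases hpos : ∀ i, 1 ≤ k i
    · have : ∃ i : Fin (2 * n + 1),
          ¬ ((Even (i : ℕ) → k i.castSucc ≤ k i.succ) ∧ (Odd (i : ℕ) → k i.castSucc < k i.succ)) := by
        by_contra! hcon
        refine hk ⟨hpos, fun i j hij => ?_⟩
        have hi : (i : ℕ) < 2 * n + 1 := by have := j.2; omega
        have h1 : i = (⟨i, hi⟩ : Fin (2 * n + 1)).castSucc := rfl
        have h2 : j = (⟨i, hi⟩ : Fin (2 * n + 1)).succ := Fin.ext hij.symm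
        have := hcon ⟨i, hi⟩
        rw [← h1, ← h2] at this
        exact this
      obtain ⟨i, hi⟩ := this
      rw [Finset.prod_eq_zero (Finset.mem_univ i) (by rw [gammaStep, if_neg hi]), mul_zero]
    · push Not at hpos
      obtain ⟨i, hi⟩ := hpos
      have hki : k i = 0 := by omega
      -- The convention that a real power of `0` with nonzero exponent is `0` removes tuples with a
      -- zero entry, so indices may range over all of `ℕ`.
      have h0 : ENNReal.ofReal (((0 : ℕ) : ℝ) ^ (-(p / 2))) = 0 := by
        rw [Nat.cast_zero, Real.zero_rpow (by linarith), ENNReal.ofReal_zero]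
      rcases Fin.eq_zero_or_eq_succ i with rfl | ⟨i, rfl⟩
      · simp only [hki, h0, zero_mul]
      · rw [Finset.prod_eq_zero (Finset.mem_univ i) (by
          rw [gammaStep, hki, h0, ite_self]), mul_zero]

lemma tsum_zetaTerm {p : ℝ} (hp : 0 < p) (m : ℕ) :
    ∑' k : zetaIndex m, ENNReal.ofReal (zetaTerm m p k)
      = ∑' K, chainCoeff (fun k => ENNReal.ofReal ((k : ℝ) ^ (-p)))
        (fun _ => ENNReal.ofReal 1) (2 * m) K := by
  have key := tsum_tuple_eq_iterSum (fun k => ENNReal.ofReal ((k : ℝ) ^ (-p)))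
    (zetaStep p) m fun _ => 1
  simp only [mul_one, iterSum_zetaStep] at key
  rw [← key]
  have hsub := tsum_subtype (zetaIndex m) fun k : Fin (m + 1) → ℕ =>
    ENNReal.ofReal ((∏ i : Fin m, ((k i.succ : ℝ) - (k i.castSucc : ℝ)))
      * (∏ i, (k i : ℝ)) ^ (-p))
  refine hsub.trans (tsum_congr fun k => ?_)
  by_cases hk : k ∈ zetaIndex m
  · have hlt := Fin.strictMono_iff_lt_succ.1 hk.2
    have hd : ∀ i : Fin m, (0 : ℝ) ≤ (k i.succ : ℝ) - (k i.castSucc : ℝ) := fun i => by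
      rw [sub_nonneg]; exact_mod_cast (hlt i).le
    rw [Set.indicator_of_mem hk, ← Real.finsetProd_rpow _ _ (fun i _ => Nat.cast_nonneg _),
      Fin.prod_univ_succ, mul_left_comm, ← Finset.prod_mul_distrib,
      ENNReal.ofReal_mul (Real.rpow_nonneg (Nat.cast_nonneg _) _),
      ENNReal.ofReal_prod_of_nonneg
        (fun i _ => mul_nonneg (hd i) (Real.rpow_nonneg (Nat.cast_nonneg _) _))]
    congr 1
    refine Finset.prod_congr rfl fun i _ => ?_
    rw [zetaStep, if_pos (hlt i)]
  · rw [Set.indicator_of_notMem hk]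
    symm
    by_cases hpos : ∀ i, 1 ≤ k i
    · have : ∃ i : Fin m, ¬ k i.castSucc < k i.succ := by
        by_contra! hcon
        exact hk ⟨hpos, Fin.strictMono_iff_lt_succ.2 hcon⟩
      obtain ⟨i, hi⟩ := this
      rw [Finset.prod_eq_zero (Finset.mem_univ i) (by rw [zetaStep, if_neg hi]), mul_zero]
    · push Not at hpos
      obtain ⟨i, hi⟩ := hpos
      have hki : k i = 0 := by omega
      have h0 : ENNReal.ofReal (((0 : ℕ) : ℝ) ^ (-p)) = 0 := by
        rw [Nat.cast_zero, Real.zero_rpow (by linarith), ENNReal.ofReal_zero]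
      rcases Fin.eq_zero_or_eq_succ i with rfl | ⟨i, rfl⟩
      · simp only [hki, h0, zero_mul]
      · rw [Finset.prod_eq_zero (Finset.mem_univ i) (by
          rw [zetaStep, hki, if_neg (by omega)]), mul_zero]

end

/-! ### Domination up to polynomial factors -/

/-- `F` is at most a polynomial times `H` on `[1, ∞)`. -/
def PolyLE (F H : ℝ → ℝ) : Prop :=
  ∃ C > 0, ∃ k : ℕ, ∀ y, 1 ≤ y → F y ≤ C * y ^ k * H y

lemma PolyLE.trans {F H J : ℝ → ℝ} (h₁ : PolyLE F H) (h₂ : PolyLE H J) : PolyLE F J := by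
  obtain ⟨C, hC, k, h₁⟩ := h₁
  obtain ⟨D, hD, l, h₂⟩ := h₂
  refine ⟨C * D, by positivity, k + l, fun y hy => (h₁ y hy).trans ?_⟩
  calc C * y ^ k * H y ≤ C * y ^ k * (D * y ^ l * J y) := by
        have := h₂ y hy
        gcongr
    _ = _ := by ring

lemma PolyLE.of_le {F H : ℝ → ℝ} (h : ∀ y, 1 ≤ y → F y ≤ H y) : PolyLE F H :=
  ⟨1, one_pos, 0, by simpa using h⟩

/-- Order and type of a function whose maximum modulus is comparable to `U (κ r ^ q)`. -/
lemma growth_of_polyLE {f : ℂ → ℂ} {U : ℝ → ℝ} {ρ κ q a : ℝ} (hρ : 0 < ρ) (hκ : 0 < κ)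
    (hq : 0 < q) (ha : 0 < a) (hU : ∀ y, 0 ≤ y → 0 < U y)
    (hlow : ∀ᶠ y in atTop, a * y ^ ρ ≤ Real.log (U y))
    (hup : ∀ θ > ρ, ∃ C, ∀ᶠ y in atTop, Real.log (U y) ≤ C * y ^ θ)
    (h₁ : PolyLE (maxModulus f) fun r => U (κ * r ^ q))
    (h₂ : PolyLE (fun r => U (κ * r ^ q)) (maxModulus f)) :
    growthOrder f = ((q * ρ : ℝ) : EReal) ∧
    growthType f = ((κ ^ ρ : ℝ) : EReal) *
      limsup (fun y => ((Real.log (U y) / y ^ ρ : ℝ) : EReal)) atTop := by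
  obtain ⟨C, hC, k, h₁⟩ := h₁
  obtain ⟨D, hD, l, h₂⟩ := h₂
  refine growth_of_log_close (L := fun y => Real.log (U y)) hρ hκ hq ha hlow hup
    (K := |Real.log C| + |Real.log D| + k + l) ?_
  filter_upwards [eventually_ge_atTop (Real.exp 1)] with r hr
  have hr1 : 1 ≤ r := (Real.one_le_exp zero_le_one).trans hr
  have hUr : 0 < U (κ * r ^ q) := hU _ (by positivity)
  have hM : 0 < maxModulus f r := by
    have h := h₂ r hr1
    by_contra! hcon
    have : D * r ^ l * maxModulus f r ≤ 0 := mul_nonpos_of_nonneg_of_nonpos (by positivity) hcon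
    linarith
  exact abs_log_sub_log_le hM hUr hr hC hD (h₁ r hr1) (h₂ r hr1)

/-! ### Power series with nonnegative coefficients -/

/-- With nonnegative coefficients the maximum modulus is the value at the positive point `r`. -/
lemma powerSeries_nonneg {a : ℕ → ℝ} {d : ℕ → ℕ} {L : ℝ → ℝ} (ha : ∀ n, 0 ≤ a n)
    (h : ∀ t, 0 ≤ t → HasSum (fun n => a n * t ^ d n) (L t)) :
    (∀ z : ℂ, Summable fun n => (a n : ℂ) * z ^ d n) ∧
    Differentiable ℂ (fun z : ℂ => ∑' n, (a n : ℂ) * z ^ d n) ∧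
    ∀ r, 0 ≤ r → maxModulus (fun z : ℂ => ∑' n, (a n : ℂ) * z ^ d n) r = L r := by
  have hnorm : ∀ r n (z : ℂ), ‖z‖ ≤ r → ‖(a n : ℂ) * z ^ d n‖ ≤ a n * r ^ d n := by
    intro r n z hz
    rw [norm_mul, norm_pow, Complex.norm_real, Real.norm_of_nonneg (ha n)]
    have := ha n
    gcongr
  refine ⟨fun z => (h ‖z‖ (norm_nonneg z)).summable.of_norm_bounded fun n => hnorm _ n z le_rfl,
    differentiable_tsum_of_ball (fun n => (differentiable_const _).mul (differentiable_pow _))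
      (fun r n => a n * r ^ d n) (fun r hr => (h r hr).summable) hnorm, fun r hr => ?_⟩
  refine maxModulus_eq (w := (r : ℂ)) (fun z hz => ?_) (by simp [abs_of_nonneg hr]) ?_
  · exact tsum_of_norm_bounded (h r hr) fun n => hnorm r n z hz.le
  · have : HasSum (fun n => (a n : ℂ) * (r : ℂ) ^ d n) ((L r : ℝ) : ℂ) := by
      exact_mod_cast Complex.hasSum_ofReal.2 (h r hr)
    rw [this.tsum_eq, Complex.norm_real, Real.norm_of_nonneg]
    exact (h r hr).nonneg fun n => mul_nonneg (ha n) (by positivity)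

/-! ### The model chains -/

/-- The weights `k ^ (-c)`. -/
def powWeight (c : ℝ) (k : ℕ) : ℝ := (k : ℝ) ^ (-c)

lemma powWeight_nonneg (c : ℝ) (k : ℕ) : 0 ≤ powWeight c k := Real.rpow_nonneg (Nat.cast_nonneg _) _

lemma powWeight_zero {c : ℝ} (hc : 0 < c) : powWeight c 0 = 0 := by
  rw [powWeight, Nat.cast_zero, Real.zero_rpow (by linarith)]

lemma summable_powWeight {c : ℝ} (hc : 1 < c) : Summable (powWeight c) :=
  Real.summable_nat_rpow.2 (by linarith)

lemma powWeight_mul_rpow {c : ℝ} {k : ℕ} (hk : 1 ≤ k) : powWeight c k * (k : ℝ) ^ c = 1 := by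
  have : (0 : ℝ) < k := by exact_mod_cast hk
  rw [powWeight, ← Real.rpow_add this]
  simp

lemma powWeight_two_mul {c : ℝ} (hc : 0 < c) (k : ℕ) :
    powWeight (2 * c) k = powWeight c k * powWeight c k := by
  rcases Nat.eq_zero_or_pos k with rfl | hk
  · rw [powWeight_zero hc, powWeight_zero (by linarith), zero_mul]
  have : (0 : ℝ) < k := by exact_mod_cast hk
  rw [powWeight, powWeight, ← Real.rpow_add this]
  congr 1; ring

lemma weights_powWeight {c : ℝ} (hc : 1 < c) : Weights (powWeight c) (powWeight c) :=
  ⟨powWeight_nonneg c, powWeight_nonneg c, summable_powWeight hc, summable_powWeight hc⟩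

lemma zero_le_one_zero : (0 : ℝ × ℝ) ≤ (1, 0) := by simp [Prod.le_def]

lemma zero_le_zero_one : (0 : ℝ × ℝ) ≤ (0, 1) := by simp [Prod.le_def]

/-- `U_∞(y)` for the symmetric chain with weights `k ^ (-c)`. -/
def symU (c y : ℝ) : ℝ := limU (powWeight c) (powWeight c) y (1, 0)

/-- `V_∞(y)` for the string with masses `k ^ (-2c)` at unit distances. -/
def strV (c y : ℝ) : ℝ := limV (powWeight (2 * c)) (fun _ => 1) y (1, 0)

/-! ### Comparison of the two model chains and their growth -/

section Model

variable {c : ℝ}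

/-- Multiplying the symmetric `U_n` by `n^c` turns the mass `n^{-c}` into `n^{-2c}` and makes the
other weight at least `1`. The comparison starts at `n = 1` because the factor `0^c` vanishes at the
start, where `U_0 = 1`. -/
lemma str_le_sym (hc : 1 < c) {y : ℝ} (hy : 0 ≤ y) {n : ℕ} (hn : 1 ≤ n) :
    chainU (powWeight (2 * c)) (fun _ => 1) y (1, 0) n
      ≤ (n : ℝ) ^ c * chainU (powWeight c) (powWeight c) y (1, 0) n ∧
    chainV (powWeight (2 * c)) (fun _ => 1) y (1, 0) n
      ≤ chainV (powWeight c) (powWeight c) y (1, 0) n := by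
  have h0 : powWeight (2 * c) 0 = 0 := powWeight_zero (by linarith)
  have h0' : powWeight c 0 = 0 := powWeight_zero (by linarith)
  have := chain_le_of_gauge (κ := 1) (n₀ := 1) (g := fun n => (n : ℝ) ^ c) (h := fun _ => 1)
    (a := (1, 0)) (powWeight_nonneg (2 * c)) (fun _ => zero_le_one) (powWeight_nonneg c)
    (powWeight_nonneg c) hy hy zero_le_one_zero zero_le_one
    (fun n _ => Real.rpow_le_rpow (Nat.cast_nonneg _) (by simp) (by linarith))
    (fun _ _ => le_rfl)
    (fun n hn => by
      rw [powWeight_two_mul (by linarith)]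
      have := powWeight_mul_rpow (c := c) hn
      linear_combination (y * powWeight c n) * this)
    (fun n hn => by
      have h1 := powWeight_mul_rpow (c := c) hn
      have h2 : (n : ℝ) ^ c ≤ ((n + 1 : ℕ) : ℝ) ^ c :=
        Real.rpow_le_rpow (Nat.cast_nonneg _) (by simp) (by linarith)
      have h3 := mul_le_mul_of_nonneg_right h2 (mul_nonneg hy (powWeight_nonneg c n))
      nlinarith)
    (by simp [chainU_succ, chainV_succ, h0, h0'])
    (by simp [chainV_succ, h0, h0']) n hn
  simpa using this

/-- Here `V` carries the factor instead of `U`. The shift `(n - 1)^c` matches the index at which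
`V_n` was last updated, and it vanishes at `0` and `1`, where `V` of the symmetric chain is still
`0`. -/
lemma sym_le_str (hc : 1 < c) {y : ℝ} (hy : 0 ≤ y) (n : ℕ) :
    chainU (powWeight c) (powWeight c) y (1, 0) n
      ≤ chainU (powWeight (2 * c)) (fun _ => 1) y (1, 0) n := by
  have h0 : powWeight c 0 = 0 := powWeight_zero (by linarith)
  have := chain_le_of_gauge (κ := 1) (n₀ := 0) (g := fun _ => 1)
    (h := fun n => ((n - 1 : ℕ) : ℝ) ^ c)
    (a := (1, 0)) (a' := (1, 0)) (powWeight_nonneg c) (powWeight_nonneg c)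
    (powWeight_nonneg (2 * c))
    (fun _ => zero_le_one) hy hy zero_le_one_zero zero_le_one (fun _ _ => le_rfl)
    (fun n _ => Real.rpow_le_rpow (Nat.cast_nonneg _) (by
      exact_mod_cast Nat.sub_le_sub_right (Nat.le_succ n) 1) (by linarith))
    (fun n _ => by
      rw [powWeight_two_mul (by linarith), Nat.add_sub_cancel]
      rcases Nat.eq_zero_or_pos n with rfl | hn
      · simp [h0]
      have := powWeight_mul_rpow (c := c) hn
      linear_combination (-y * powWeight c n) * this)
    (fun n _ => by
      rw [Nat.add_sub_cancel]
      rcases Nat.eq_zero_or_pos n with rfl | hn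
      · simp [h0, hy]
      have := powWeight_mul_rpow (c := c) hn
      linear_combination y * this)
    (by simp) (by simp) n (Nat.zero_le n)
  simpa using this.1

/-- Unit distances are not summable, so the general theory of `Weights` does not cover the string.
The bound `U_k ≤ k^c` times the symmetric `U_k` leaves the summable weight `k^{-c}`. -/
lemma summable_str (hc : 1 < c) {y : ℝ} (hy : 0 ≤ y) :
    Summable fun k => powWeight (2 * c) k
      * chainU (powWeight (2 * c)) (fun _ => 1) y (1, 0) k := by
  refine ((weights_powWeight hc).summableU zero_le_one_zero hy).of_nonneg_of_le (fun k => ?_)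
    fun k => ?_
  · exact mul_nonneg (powWeight_nonneg _ _)
      (chain_nonneg (powWeight_nonneg _) (fun _ => zero_le_one) hy zero_le_one_zero k).1
  · rcases Nat.eq_zero_or_pos k with rfl | hk
    · rw [powWeight_zero (by linarith), powWeight_zero (by linarith), zero_mul, zero_mul]
    rw [powWeight_two_mul (by linarith)]
    have h1 := mul_le_mul_of_nonneg_left (str_le_sym hc hy hk).1
      (mul_nonneg (powWeight_nonneg c k) (powWeight_nonneg c k))
    refine h1.trans (le_of_eq ?_)
    have := powWeight_mul_rpow (c := c) hk
    linear_combination (powWeight c k * chainU (powWeight c) (powWeight c) y (1, 0) k) * this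

lemma chainU_le_symU (hc : 1 < c) {y : ℝ} (hy : 0 ≤ y) (n : ℕ) :
    chainU (powWeight c) (powWeight c) y (1, 0) n ≤ symU c y :=
  chainU_le_limU (powWeight_nonneg c) (powWeight_nonneg c) hy zero_le_one_zero
    ((weights_powWeight hc).summableV zero_le_one_zero hy) n

lemma one_le_symU (hc : 1 < c) {y : ℝ} (hy : 0 ≤ y) : 1 ≤ symU c y := chainU_le_symU hc hy 0

lemma chainV_le_strV (hc : 1 < c) {y : ℝ} (hy : 0 ≤ y) (n : ℕ) :
    chainV (powWeight (2 * c)) (fun _ => 1) y (1, 0) n ≤ strV c y :=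
  chainV_le_limV (powWeight_nonneg _) (fun _ => zero_le_one) hy zero_le_one_zero
    (summable_str hc hy) n

namespace Weights

variable {m s : ℕ → ℝ}

lemma limV_le (h : Weights m s) {a : ℝ × ℝ} (ha : 0 ≤ a) {y : ℝ} (hy : 0 ≤ y) :
    limV m s y a ≤ a.2 + y * (∑' k, m k) * limU m s y a := by
  rw [limV, mul_assoc, ← tsum_mul_right]
  gcongr
  · exact h.summableU ha hy
  · exact h.summable_left.mul_right _
  · exact h.nonneg_left _
  · exact chainU_le_limU h.nonneg_left h.nonneg_right hy ha (h.summableV ha hy) _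

lemma limU_le (h : Weights m s) {a : ℝ × ℝ} (ha : 0 ≤ a) {y : ℝ} (hy : 0 ≤ y) :
    limU m s y a ≤ a.1 + y * (∑' k, s k) * limV m s y a := by
  rw [limU, mul_assoc, ← tsum_mul_right]
  gcongr
  · exact h.summableV ha hy
  · exact h.summable_right.mul_right _
  · exact h.nonneg_right _
  · exact chainV_le_limV h.nonneg_left h.nonneg_right hy ha (h.summableU ha hy) _

end Weights

lemma strV_le (hc : 1 < c) {y : ℝ} (hy : 0 ≤ y) :
    strV c y ≤ y * (∑' k, powWeight c k) * symU c y := by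
  have hw := weights_powWeight hc
  have h1 : strV c y ≤ limV (powWeight c) (powWeight c) y (1, 0) := by
    refine le_of_tendsto_of_tendsto (tendsto_chainV (summable_str hc hy))
      (tendsto_chainV (hw.summableU zero_le_one_zero hy)) ?_
    filter_upwards [eventually_ge_atTop 1] with n hn using (str_le_sym hc hy hn).2
  have h2 := hw.limV_le zero_le_one_zero hy
  simp only [zero_add] at h2
  exact h1.trans h2

lemma tsum_powWeight_tail_le (hc : 1 < c) {K : ℕ} (hK : 1 ≤ K) :
    ∑' k, powWeight c (k + K)
      ≤ (K : ℝ) ^ (-((c - 1) / 2)) * ∑' k, powWeight ((c + 1) / 2) k := by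
  have hc' : 1 < (c + 1) / 2 := by linarith
  have hs := summable_powWeight hc'
  have hpt : ∀ k, powWeight c (k + K)
      ≤ (K : ℝ) ^ (-((c - 1) / 2)) * powWeight ((c + 1) / 2) (k + K) := by
    intro k
    have hK0 : (0 : ℝ) < K := by exact_mod_cast hK
    have hk : (0 : ℝ) < ((k + K : ℕ) : ℝ) := by exact_mod_cast (by omega : 0 < k + K)
    have : powWeight c (k + K) = ((k + K : ℕ) : ℝ) ^ (-((c - 1) / 2)) *
        powWeight ((c + 1) / 2) (k + K) := by
      rw [powWeight, powWeight, ← Real.rpow_add hk]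
      congr 1; ring
    rw [this]
    refine mul_le_mul_of_nonneg_right ?_ (powWeight_nonneg _ _)
    exact Real.rpow_le_rpow_of_nonpos hK0 (by push_cast; linarith [(Nat.cast_nonneg k : (0:ℝ) ≤ k)])
      (by linarith)
  have hs' := (summable_nat_add_iff K).2 hs
  calc ∑' k, powWeight c (k + K)
      ≤ ∑' k, (K : ℝ) ^ (-((c - 1) / 2)) * powWeight ((c + 1) / 2) (k + K) :=
        ((summable_nat_add_iff K).2 (summable_powWeight hc)).tsum_le_tsum hpt (hs'.mul_left _)
    _ = (K : ℝ) ^ (-((c - 1) / 2)) * ∑' k, powWeight ((c + 1) / 2) (k + K) := tsum_mul_left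
    _ ≤ _ := by
        refine mul_le_mul_of_nonneg_left ?_ (by positivity)
        rw [← hs.sum_add_tsum_nat_add K]
        have := Finset.sum_nonneg fun k (_ : k ∈ Finset.range K) =>
          powWeight_nonneg ((c + 1) / 2) k
        linarith

/-- Beyond `K` the increments of `U` are at most `y² W T_K` times the full limit, where `W` is the
total and `T_K` the tail of the weights. When that factor is at most `1/2` they are absorbed on the
left. Up to `K` the symmetric chain is below the string, whose `U_K` has only `K` increments of size
at most `y` times the limit of `V`. -/
lemma symU_le_of_tail (hc : 1 < c) {y : ℝ} (hy : 0 ≤ y) {K : ℕ}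
    (hK : y ^ 2 * (∑' k, powWeight c k) * ∑' k, powWeight c (k + K) ≤ 1 / 2) :
    symU c y ≤ 2 * (1 + K * (y * strV c y)) := by
  have hw := weights_powWeight hc
  have hsV := hw.summableV zero_le_one_zero hy
  have hsw := summable_powWeight hc
  have hU0 := one_le_symU hc hy
  have h1 : symU c y = chainU (powWeight c) (powWeight c) y (1, 0) K
      + y * ∑' k, powWeight c (k + K) *
        chainV (powWeight c) (powWeight c) y (1, 0) (k + K + 1) := by
    rw [symU, limU, chainU_eq_sum, ← hsV.sum_add_tsum_nat_add K]
    ring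
  have h2 : ∑' k, powWeight c (k + K) * chainV (powWeight c) (powWeight c) y (1, 0) (k + K + 1)
      ≤ (∑' k, powWeight c (k + K)) * limV (powWeight c) (powWeight c) y (1, 0) := by
    rw [← tsum_mul_right]
    refine ((summable_nat_add_iff K).2 hsV).tsum_le_tsum (fun k => ?_)
      (((summable_nat_add_iff K).2 hsw).mul_right _)
    exact mul_le_mul_of_nonneg_left (chainV_le_limV (powWeight_nonneg c) (powWeight_nonneg c) hy
      zero_le_one_zero (hw.summableU zero_le_one_zero hy) _) (powWeight_nonneg _ _)
  have h3 : limV (powWeight c) (powWeight c) y (1, 0) ≤ y * (∑' k, powWeight c k) * symU c y := by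
    have := hw.limV_le zero_le_one_zero hy
    simp only [zero_add] at this
    exact this
  have hT : 0 ≤ ∑' k, powWeight c (k + K) := tsum_nonneg fun k => powWeight_nonneg _ _
  have h4 : y * ∑' k, powWeight c (k + K) *
      chainV (powWeight c) (powWeight c) y (1, 0) (k + K + 1) ≤ 1 / 2 * symU c y := by
    calc _ ≤ y * ((∑' k, powWeight c (k + K)) * (y * (∑' k, powWeight c k) * symU c y)) := by
          gcongr
          exact h2.trans (by gcongr)
      _ = (y ^ 2 * (∑' k, powWeight c k) * ∑' k, powWeight c (k + K)) * symU c y := by ring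
      _ ≤ _ := by gcongr
  have h5 : chainU (powWeight c) (powWeight c) y (1, 0) K ≤ 1 + K * (y * strV c y) := by
    refine (sym_le_str hc hy K).trans ?_
    rw [chainU_eq_sum]
    have : ∑ k ∈ Finset.range K, (1 : ℝ) * chainV (powWeight (2 * c)) (fun _ => 1) y (1, 0) (k + 1)
        ≤ K * strV c y := by
      have := Finset.sum_le_card_nsmul (Finset.range K)
        (fun k => (1 : ℝ) * chainV (powWeight (2 * c)) (fun _ => 1) y (1, 0) (k + 1)) (strV c y)
        (fun k _ => by rw [one_mul]; exact chainV_le_strV hc hy _)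
      simpa using this
    have := mul_le_mul_of_nonneg_left this hy
    simp only at this ⊢
    linarith
  linarith

lemma exists_tail_index (hc : 1 < c) : ∃ C > 0, ∃ j : ℕ, ∀ y : ℝ, 1 ≤ y → ∃ K : ℕ,
    (K : ℝ) ≤ C * y ^ j ∧
      y ^ 2 * (∑' k, powWeight c k) * ∑' k, powWeight c (k + K) ≤ 1 / 2 := by
  set W := ∑' k, powWeight c k
  set W' := ∑' k, powWeight ((c + 1) / 2) k
  have hW : 0 ≤ W := tsum_nonneg fun k => powWeight_nonneg _ _
  have hW' : 0 ≤ W' := tsum_nonneg fun k => powWeight_nonneg _ _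
  set δ := (c - 1) / 2 with hδ
  have hδ0 : 0 < δ := by rw [hδ]; linarith
  set B := 2 * W * W' + 1
  have hB : 0 < B := by positivity
  obtain ⟨j, hj⟩ := exists_nat_ge (2 * δ⁻¹)
  refine ⟨B ^ δ⁻¹ + 1, by positivity, j, fun y hy => ?_⟩
  have hy0 : 0 < y := by linarith
  -- Solves `x^{-δ} = 1 / (B y²)`, since the tail beyond `K` is `O(K^{-δ})`; `B` exceeds `2WW'`, so
  -- the final quotient `WW'/B` is at most `1/2`.
  set x := (B * y ^ 2) ^ δ⁻¹ with hx
  have hx0 : 0 < x := by positivity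
  refine ⟨⌈x⌉₊, ?_, ?_⟩
  · have h1 : (⌈x⌉₊ : ℝ) ≤ x + 1 := (Nat.ceil_lt_add_one hx0.le).le
    have h2 : x ≤ B ^ δ⁻¹ * y ^ j := by
      rw [hx, Real.mul_rpow hB.le (by positivity), ← Real.rpow_natCast y 2, ← Real.rpow_mul hy0.le,
        ← Real.rpow_natCast y j]
      gcongr
      exact_mod_cast hj
    have h3 : 1 ≤ y ^ j := one_le_pow₀ hy
    linarith
  · have hK1 : 1 ≤ ⌈x⌉₊ := Nat.one_le_iff_ne_zero.2 (Nat.ceil_pos.2 hx0).ne'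
    have h1 := tsum_powWeight_tail_le hc hK1
    have h2 : ((⌈x⌉₊ : ℕ) : ℝ) ^ (-δ) ≤ (B * y ^ 2)⁻¹ := by
      calc ((⌈x⌉₊ : ℕ) : ℝ) ^ (-δ) ≤ x ^ (-δ) :=
            Real.rpow_le_rpow_of_nonpos hx0 (Nat.le_ceil x) (by linarith)
        _ = (B * y ^ 2)⁻¹ := by
            rw [hx, ← Real.rpow_mul (by positivity), mul_neg, inv_mul_cancel₀ hδ0.ne',
              Real.rpow_neg_one]
    calc y ^ 2 * W * ∑' k, powWeight c (k + ⌈x⌉₊)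
        ≤ y ^ 2 * W * ((B * y ^ 2)⁻¹ * W') := by
          gcongr
          exact h1.trans (by gcongr)
      _ = W * W' / B := by field_simp
      _ ≤ 1 / 2 := by
          rw [div_le_iff₀ hB]
          simp only [B]
          linarith

/-- For indices `1 ≤ k ≤ y^{1/c}` the factor `y k^{-c}` is at least `1`, so each such step at least
doubles `U`. This gives the lower bound of order `1/c`. -/
lemma two_pow_le_chainU {y : ℝ} (hc : 1 < c) (hy : 0 ≤ y) {N : ℕ} (hN : (N : ℝ) ^ c ≤ y) {n : ℕ}
    (hn : n ≤ N) : 2 ^ n ≤ chainU (powWeight c) (powWeight c) y (1, 0) (n + 1) := by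
  induction n with
  | zero =>
    have h0 : powWeight c 0 = 0 := powWeight_zero (by linarith)
    simp [chainU_succ, h0]
  | succ n ih =>
    have hpos := chain_nonneg (powWeight_nonneg c) (powWeight_nonneg c) hy zero_le_one_zero (n + 1)
    have h1 : 1 ≤ y * powWeight c (n + 1) := by
      rw [← powWeight_mul_rpow (c := c) (Nat.le_add_left 1 n), mul_comm y]
      refine mul_le_mul_of_nonneg_left (le_trans ?_ hN) (powWeight_nonneg _ _)
      exact Real.rpow_le_rpow (Nat.cast_nonneg _) (by exact_mod_cast hn) (by linarith)
    have h2 : chainU (powWeight c) (powWeight c) y (1, 0) (n + 1)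
        ≤ chainV (powWeight c) (powWeight c) y (1, 0) (n + 1 + 1) := by
      rw [chainV_succ]
      nlinarith [hpos.1, hpos.2]
    have h3 : 2 * chainU (powWeight c) (powWeight c) y (1, 0) (n + 1)
        ≤ chainU (powWeight c) (powWeight c) y (1, 0) (n + 1 + 1) := by
      rw [chainU_succ (n := n + 1)]
      nlinarith [hpos.1]
    rw [pow_succ]
    linarith [ih (by omega)]

lemma log_symU_ge (hc : 1 < c) :
    ∀ᶠ y in atTop, Real.log 2 / 2 * y ^ (1 / c) ≤ Real.log (symU c y) := by
  have hc0 : 0 < c := by linarith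
  have ht : Tendsto (fun y : ℝ => y ^ (1 / c)) atTop atTop := tendsto_rpow_atTop (by positivity)
  filter_upwards [eventually_ge_atTop 0, ht.eventually_ge_atTop 2] with y hy hy2
  set N := ⌊y ^ (1 / c)⌋₊
  have hN : (N : ℝ) ^ c ≤ y := by
    calc (N : ℝ) ^ c ≤ (y ^ (1 / c)) ^ c :=
          Real.rpow_le_rpow (Nat.cast_nonneg _) (Nat.floor_le (by positivity)) hc0.le
      _ = y := by rw [← Real.rpow_mul hy, one_div_mul_cancel hc0.ne', Real.rpow_one]
  have h1 := (two_pow_le_chainU hc hy hN le_rfl).trans (chainU_le_symU hc hy _)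
  have h2 := Real.log_le_log (by positivity) h1
  rw [Real.log_pow] at h2
  have h3 : y ^ (1 / c) < N + 1 := Nat.lt_floor_add_one _
  have hl : 0 < Real.log 2 := Real.log_pos one_lt_two
  nlinarith

/-- Subadditivity of `x ↦ x^θ` gives `(1 + x)^θ ≤ 1 + x^θ ≤ exp (x^θ)`. Applied to `x = y k^{-c}` it
converts convergence of `∑ k^{-cθ}` into growth `y^θ`. -/
lemma one_add_le_exp_rpow {x θ : ℝ} (hx : 0 ≤ x) (hθ : 0 < θ) (hθ1 : θ ≤ 1) :
    1 + x ≤ Real.exp (x ^ θ / θ) := by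
  have h1 : (1 + x) ^ θ ≤ 1 + x ^ θ := by
    have := NNReal.coe_le_coe.2 (NNReal.rpow_add_le_add_rpow 1 ⟨x, hx⟩ hθ.le hθ1)
    push_cast [NNReal.one_rpow] at this
    exact this
  have h2 : (1 + x) ^ θ ≤ Real.exp (x ^ θ) := by linarith [Real.add_one_le_exp (x ^ θ)]
  calc 1 + x = ((1 + x) ^ θ) ^ θ⁻¹ := by
        rw [← Real.rpow_mul (by linarith), mul_inv_cancel₀ hθ.ne', Real.rpow_one]
    _ ≤ (Real.exp (x ^ θ)) ^ θ⁻¹ := by gcongr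
    _ = Real.exp (x ^ θ / θ) := by rw [← Real.exp_mul, div_eq_mul_inv]

lemma log_symU_le (hc : 1 < c) (θ : ℝ) (hθ : 1 / c < θ) :
    ∃ C, ∀ᶠ y in atTop, Real.log (symU c y) ≤ C * y ^ θ := by
  have hc0 : 0 < c := by linarith
  -- For `θ > 1` the bound with exponent `1`, admissible as `1/c < 1`, is already enough.
  wlog hθ1 : θ ≤ 1 generalizing θ
  · obtain ⟨C, hC⟩ := this 1 (by rw [div_lt_one hc0]; exact hc) le_rfl
    refine ⟨|C|, ?_⟩
    filter_upwards [hC, eventually_ge_atTop 1] with y h hy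
    calc Real.log (symU c y) ≤ C * y ^ (1 : ℝ) := h
      _ ≤ |C| * y ^ θ := by
        have h2 := Real.rpow_le_rpow_of_exponent_le hy (le_of_not_ge hθ1)
        exact mul_le_mul (le_abs_self C) h2 (by positivity) (abs_nonneg C)
  have hθ0 : 0 < θ := (by positivity : 0 < 1 / c).trans hθ
  have hcθ : 1 < c * θ := by rwa [div_lt_iff₀ hc0, mul_comm] at hθ
  refine ⟨2 / θ * ∑' k, powWeight (c * θ) k, ?_⟩
  filter_upwards [eventually_ge_atTop 0] with y hy
  have he : ∀ k, 1 + y * powWeight c k ≤ Real.exp (y ^ θ / θ * powWeight (c * θ) k) := by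
    intro k
    refine (one_add_le_exp_rpow (mul_nonneg hy (powWeight_nonneg c k)) hθ0 hθ1).trans (le_of_eq ?_)
    rw [Real.mul_rpow hy (powWeight_nonneg c k), powWeight, powWeight,
      ← Real.rpow_mul (Nat.cast_nonneg k), neg_mul]
    congr 1; ring
  have hsum := (summable_powWeight hcθ).mul_left (y ^ θ / θ)
  have hb : symU c y ≤ Real.exp (2 / θ * (∑' k, powWeight (c * θ) k) * y ^ θ) := by
    refine le_of_tendsto (tendsto_chainU ((weights_powWeight hc).summableV zero_le_one_zero hy))
      (Eventually.of_forall fun n => ?_)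
    have h1 := chain_add_le_exp_tsum (powWeight_nonneg c) (powWeight_nonneg c) hy zero_le_one_zero
      he he hsum hsum n
    have h2 := (chain_nonneg (powWeight_nonneg c) (powWeight_nonneg c) hy zero_le_one_zero n).2
    rw [Summable.tsum_add hsum hsum, tsum_mul_left] at h1
    rw [show 2 / θ * (∑' k, powWeight (c * θ) k) * y ^ θ
      = y ^ θ / θ * (∑' k, powWeight (c * θ) k) + y ^ θ / θ * ∑' k, powWeight (c * θ) k by ring]
    simp only [add_zero, one_mul] at h1
    linarith
  have := Real.log_le_log (by linarith [one_le_symU hc hy]) hb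
  rwa [Real.log_exp] at this

end Model

section

open scoped ENNReal

/-! ### The functions `G` and `Z` -/

lemma summable_of_tsum_ofReal {ι : Type*} {f : ι → ℝ} (hf : ∀ i, 0 ≤ f i)
    (h : ∑' i, ENNReal.ofReal (f i) ≠ ∞) : Summable f := by
  have := ENNReal.summable_toReal h
  simpa only [ENNReal.toReal_ofReal (hf _)] using this

lemma gammaTerm_nonneg (n : ℕ) (p : ℝ) (k : gammaIndex n) : 0 ≤ gammaTerm n p k :=
  Real.rpow_nonneg (Finset.prod_nonneg fun _ _ => Nat.cast_nonneg _) _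

lemma zetaTerm_nonneg (m : ℕ) (p : ℝ) (k : zetaIndex m) : 0 ≤ zetaTerm m p k := by
  refine mul_nonneg (Finset.prod_nonneg fun i _ => ?_)
    (Real.rpow_nonneg (Finset.prod_nonneg fun _ _ => Nat.cast_nonneg _) _)
  rw [sub_nonneg]
  exact_mod_cast (Fin.strictMono_iff_lt_succ.1 k.2.2 i).le

lemma gammaMZ_nonneg (n : ℕ) (p : ℝ) : 0 ≤ gammaMZ n p := tsum_nonneg (gammaTerm_nonneg n p)

lemma zetaMZsucc_nonneg (m : ℕ) (p : ℝ) : 0 ≤ zetaMZsucc m p := tsum_nonneg (zetaTerm_nonneg m p)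

lemma hasSum_of_ofReal_eq {a : ℕ → ℝ} {d : ℕ → ℕ} {t L : ℝ} (ha : ∀ n, 0 ≤ a n) (ht : 0 ≤ t)
    (hL : 0 ≤ L)
    (h : ENNReal.ofReal L = ∑' n, ENNReal.ofReal t ^ d n * ENNReal.ofReal (a n)) :
    HasSum (fun n => a n * t ^ d n) L := by
  have hterm : ∀ n, ENNReal.ofReal t ^ d n * ENNReal.ofReal (a n)
      = ENNReal.ofReal (a n * t ^ d n) := fun n => by
    rw [ENNReal.ofReal_mul (ha n), ENNReal.ofReal_pow ht, mul_comm]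
  simp_rw [hterm] at h
  have hnn : ∀ n, 0 ≤ a n * t ^ d n := fun n => mul_nonneg (ha n) (by positivity)
  have hs : Summable fun n => a n * t ^ d n :=
    summable_of_tsum_ofReal hnn (h ▸ ENNReal.ofReal_ne_top)
  rw [← ENNReal.ofReal_tsum_of_nonneg hnn hs,
    ENNReal.ofReal_eq_ofReal_iff hL (tsum_nonneg hnn)] at h
  exact h ▸ hs.hasSum

section

variable {c : ℝ}

lemma ofReal_symU (hc : 1 < c) {y : ℝ} (hy : 0 ≤ y) :
    ENNReal.ofReal (symU c y - 1) = ∑' n, ENNReal.ofReal (y ^ 2) ^ (n + 1) *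
      ∑' k : gammaIndex (n + 1), ENNReal.ofReal (gammaTerm (n + 1) (2 * c) k) := by
  have h := ofReal_limU (powWeight_nonneg c) (powWeight_nonneg c) hy
    ((weights_powWeight hc).summableV zero_le_one_zero hy)
  have h1 := one_le_symU hc hy
  change ENNReal.ofReal (symU c y) = _ at h
  rw [show symU c y = 1 + (symU c y - 1) by ring, ENNReal.ofReal_add zero_le_one (by linarith),
    ENNReal.ofReal_one, ENNReal.add_right_inj ENNReal.one_ne_top] at h
  rw [h]
  refine tsum_congr fun n => ?_
  rw [tsum_gammaTerm (by linarith), mul_div_cancel_left₀ c two_ne_zero, ENNReal.ofReal_pow hy,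
    ← pow_mul]
  rfl

lemma ofReal_strV (hc : 1 < c) {y : ℝ} (hy : 0 ≤ y) :
    ENNReal.ofReal (y * strV c y) = ∑' n, ENNReal.ofReal (y ^ 2) ^ (n + 1) *
      ∑' k : zetaIndex n, ENNReal.ofReal (zetaTerm n (2 * c) k) := by
  have h := ofReal_limV (powWeight_nonneg (2 * c)) (fun _ => zero_le_one) hy (summable_str hc hy)
  change ENNReal.ofReal (strV c y) = _ at h
  rw [ENNReal.ofReal_mul hy, h, ← ENNReal.tsum_mul_left]
  refine tsum_congr fun n => ?_
  rw [tsum_zetaTerm (by linarith), ENNReal.ofReal_pow hy, ← pow_mul, ← mul_assoc, ← pow_succ']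
  rfl

lemma tsum_ofReal_gammaTerm_ne_top (hc : 1 < c) (n : ℕ) :
    ∑' k : gammaIndex (n + 1), ENNReal.ofReal (gammaTerm (n + 1) (2 * c) k) ≠ ∞ := by
  have h := ofReal_symU hc zero_le_one
  simp only [one_pow, ENNReal.ofReal_one, one_mul] at h
  exact ENNReal.ne_top_of_tsum_ne_top (h ▸ ENNReal.ofReal_ne_top) n

lemma tsum_ofReal_zetaTerm_ne_top (hc : 1 < c) (n : ℕ) :
    ∑' k : zetaIndex n, ENNReal.ofReal (zetaTerm n (2 * c) k) ≠ ∞ := by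
  have h := ofReal_strV hc zero_le_one
  simp only [one_pow, ENNReal.ofReal_one, one_mul] at h
  exact ENNReal.ne_top_of_tsum_ne_top (h ▸ ENNReal.ofReal_ne_top) n

lemma summable_gammaTerm (hc : 1 < c) (n : ℕ) : Summable (gammaTerm (n + 1) (2 * c)) :=
  summable_of_tsum_ofReal (gammaTerm_nonneg _ _) (tsum_ofReal_gammaTerm_ne_top hc n)

lemma summable_zetaTerm (hc : 1 < c) (n : ℕ) : Summable (zetaTerm n (2 * c)) :=
  summable_of_tsum_ofReal (zetaTerm_nonneg _ _) (tsum_ofReal_zetaTerm_ne_top hc n)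

lemma hasSum_gammaMZ (hc : 1 < c) {t : ℝ} (ht : 0 ≤ t) :
    HasSum (fun n => gammaMZ (n + 1) (2 * c) * t ^ (n + 1)) (symU c (√t) - 1) := by
  refine hasSum_of_ofReal_eq (fun n => gammaMZ_nonneg _ _) ht
    (by linarith [one_le_symU hc (Real.sqrt_nonneg t)]) ?_
  rw [ofReal_symU hc (Real.sqrt_nonneg t), Real.sq_sqrt ht]
  refine tsum_congr fun n => ?_
  rw [gammaMZ, ENNReal.ofReal_tsum_of_nonneg (gammaTerm_nonneg _ _) (summable_gammaTerm hc n)]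

lemma hasSum_zetaMZ (hc : 1 < c) {t : ℝ} (ht : 0 ≤ t) :
    HasSum (fun n => zetaMZsucc n (2 * c) * t ^ (n + 1)) (√t * strV c (√t)) := by
  have hy := Real.sqrt_nonneg t
  refine hasSum_of_ofReal_eq (fun n => zetaMZsucc_nonneg _ _) ht
    (mul_nonneg hy (chainV_le_strV hc hy 0)) ?_
  rw [ofReal_strV hc hy, Real.sq_sqrt ht]
  refine tsum_congr fun n => ?_
  rw [zetaMZsucc, ENNReal.ofReal_tsum_of_nonneg (zetaTerm_nonneg _ _) (summable_zetaTerm hc n)]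

lemma hasSum_zetaMZ_tail (hc : 1 < c) {t : ℝ} (ht : 0 ≤ t) :
    HasSum (fun n => zetaMZsucc (n + 1) (2 * c) * t ^ (n + 2))
      (√t * strV c (√t) - zetaMZsucc 0 (2 * c) * t) := by
  have := (hasSum_nat_add_iff' (f := fun n => zetaMZsucc n (2 * c) * t ^ (n + 1)) 1).2
    (hasSum_zetaMZ hc ht)
  simpa using this

lemma GZEntire_two_mul (hc : 1 < c) : GZEntire (2 * c) := by
  have hG := powerSeries_nonneg (d := fun n => n + 1) (fun n => gammaMZ_nonneg (n + 1) (2 * c))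
    fun _ ht => hasSum_gammaMZ hc ht
  have hZ := powerSeries_nonneg (d := fun n => n + 2) (fun n => zetaMZsucc_nonneg (n + 1) (2 * c))
    fun _ ht => hasSum_zetaMZ_tail hc ht
  exact ⟨summable_gammaTerm hc, fun n => summable_zetaTerm hc (n + 1), hG.1, hZ.1, hG.2.1, hZ.2.1⟩

lemma maxModulus_G (hc : 1 < c) {r : ℝ} (hr : 0 ≤ r) :
    maxModulus (G (2 * c)) r = symU c (√r) - 1 :=
  (powerSeries_nonneg (d := fun n => n + 1) (fun n => gammaMZ_nonneg (n + 1) (2 * c))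
    fun _ ht => hasSum_gammaMZ hc ht).2.2 r hr

lemma maxModulus_Z (hc : 1 < c) {r : ℝ} (hr : 0 ≤ r) :
    maxModulus (Z (2 * c)) r = √r * strV c (√r) - zetaMZsucc 0 (2 * c) * r :=
  (powerSeries_nonneg (d := fun n => n + 2) (fun n => zetaMZsucc_nonneg (n + 1) (2 * c))
    fun _ ht => hasSum_zetaMZ_tail hc ht).2.2 r hr

lemma one_two_mem_zetaIndex : (![1, 2] : Fin 2 → ℕ) ∈ zetaIndex 1 := by
  refine ⟨fun i => by fin_cases i <;> simp, Fin.strictMono_iff_lt_succ.2 fun i => ?_⟩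
  fin_cases i; simp

lemma zetaMZsucc_one_pos (hc : 1 < c) : 0 < zetaMZsucc 1 (2 * c) := by
  refine (summable_zetaTerm hc 1).tsum_pos (zetaTerm_nonneg _ _) ⟨![1, 2], one_two_mem_zetaIndex⟩ ?_
  simp only [zetaTerm]
  simp [Fin.prod_univ_two]
  positivity

lemma sqrt_pow_le {r : ℝ} (hr : 1 ≤ r) (k : ℕ) : √r ^ k ≤ r ^ k :=
  pow_le_pow_left₀ (Real.sqrt_nonneg r) (Real.sqrt_le_self_iff.2 (.inr hr)) k

lemma G_polyLE (hc : 1 < c) :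
    PolyLE (maxModulus (G (2 * c))) (fun r => symU c (√r)) ∧
    PolyLE (fun r => symU c (√r)) (maxModulus (G (2 * c))) := by
  constructor
  · refine .of_le fun r hr => ?_
    rw [maxModulus_G hc (by linarith)]
    linarith
  · refine ⟨2, two_pos, 0, fun r hr => ?_⟩
    rw [maxModulus_G hc (by linarith)]
    have hy : 1 ≤ √r := Real.one_le_sqrt.2 hr
    -- Since `U_2 = 1 + y² ≥ 2`, subtracting the constant term `1` costs at most a factor `2`.
    have h2 := chainU_le_symU hc (zero_le_one.trans hy) 2
    have h0 : powWeight c 0 = 0 := powWeight_zero (by linarith)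
    have h1 : powWeight c 1 = 1 := by simp [powWeight]
    simp only [chainU_succ, chainV_succ, h0, h1, chainU_zero, chainV_zero] at h2
    nlinarith

/-- Omitting the `n = 1` term of the series is harmless: `ζ_2 r²` is a lower bound for the rest, so
for `r ≥ 1` both the constant `1` and the missing `ζ_1 r` are multiples of it. -/
lemma Z_polyLE (hc : 1 < c) :
    PolyLE (maxModulus (Z (2 * c))) (fun r => symU c (√r)) ∧
    PolyLE (fun r => symU c (√r)) (maxModulus (Z (2 * c))) := by
  have hζ := zetaMZsucc_nonneg 0 (2 * c)
  constructor
  · set W := ∑' k, powWeight c k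
    have hW : 0 ≤ W := tsum_nonneg fun k => powWeight_nonneg _ _
    refine ⟨W + 1, by positivity, 1, fun r hr => ?_⟩
    rw [maxModulus_Z hc (by linarith)]
    have hr0 : 0 ≤ r := by linarith
    have hy := Real.sqrt_nonneg r
    have h1 := mul_le_mul_of_nonneg_left (strV_le hc hy) hy
    have h2 : √r * √r = r := Real.mul_self_sqrt hr0
    have h3 : √r * (√r * W * symU c (√r)) = W * r * symU c (√r) := by
      linear_combination (W * symU c (√r)) * h2
    have h4 := one_le_symU hc hy
    have h5 : 0 ≤ r * symU c (√r) := by positivity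
    have h6 := mul_nonneg hζ hr0
    rw [h3] at h1
    linarith
  · obtain ⟨C, hC, j, hK⟩ := exists_tail_index hc
    set ζ₁ := zetaMZsucc 0 (2 * c)
    set ζ₂ := zetaMZsucc 1 (2 * c)
    have hζ₂ : 0 < ζ₂ := zetaMZsucc_one_pos hc
    refine ⟨2 * (1 / ζ₂ + C * (1 + ζ₁ / ζ₂)), by positivity, j, fun r hr => ?_⟩
    have hr0 : 0 ≤ r := by linarith
    have hy1 : 1 ≤ √r := Real.one_le_sqrt.2 hr
    have hy := Real.sqrt_nonneg r
    obtain ⟨K, hKle, hKt⟩ := hK (√r) hy1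
    have h1 := symU_le_of_tail hc hy hKt
    set M := maxModulus (Z (2 * c)) r with hMdef
    have hM : M = √r * strV c (√r) - ζ₁ * r := maxModulus_Z hc hr0
    have hMge : ζ₂ * r ^ 2 ≤ M := by
      rw [hM]
      exact le_hasSum (hasSum_zetaMZ_tail hc hr0) 0
        fun n _ => mul_nonneg (zetaMZsucc_nonneg _ _) (by positivity)
    have h2 : 1 ≤ 1 / ζ₂ * M := by
      rw [one_div, inv_mul_eq_div, le_div_iff₀ hζ₂]
      have := mul_le_mul_of_nonneg_left (one_le_pow₀ hr : 1 ≤ r ^ 2) hζ₂.le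
      linarith
    have h3 : √r * strV c (√r) ≤ (1 + ζ₁ / ζ₂) * M := by
      have : ζ₁ * r ≤ ζ₁ / ζ₂ * M := by
        rw [div_mul_eq_mul_div, le_div_iff₀ hζ₂, mul_assoc]
        refine mul_le_mul_of_nonneg_left ?_ hζ
        have := mul_le_mul_of_nonneg_left (le_self_pow₀ hr two_ne_zero) hζ₂.le
        linarith
      linarith
    have hM0 : 0 ≤ M := le_trans (by positivity) hMge
    have hrj : 1 ≤ r ^ j := one_le_pow₀ hr
    have h4 : (K : ℝ) * (√r * strV c (√r)) ≤ C * r ^ j * ((1 + ζ₁ / ζ₂) * M) := by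
      have hKr : (K : ℝ) ≤ C * r ^ j := 
        hKle.trans (mul_le_mul_of_nonneg_left (sqrt_pow_le hr j) hC.le)
      calc (K : ℝ) * (√r * strV c (√r)) ≤ K * ((1 + ζ₁ / ζ₂) * M) := by gcongr
        _ ≤ _ := by gcongr
    have h5 : 1 ≤ r ^ j * (1 / ζ₂ * M) := by nlinarith
    calc symU c (√r) ≤ 2 * (1 + K * (√r * strV c (√r))) := h1
      _ ≤ 2 * (r ^ j * (1 / ζ₂ * M) + C * r ^ j * ((1 + ζ₁ / ζ₂) * M)) := by linarith
      _ = _ := by ring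

end

end

/-! ### Jacobi parameters `n ^ c` -/

section Power

variable {c : ℝ} {b : ℕ → ℝ}

lemma pos_of_power (hb0 : 0 < b 0) (hb : ∀ n : ℕ, 1 ≤ n → b n = (n : ℝ) ^ c) (n : ℕ) : 0 < b n := by
  rcases Nat.eq_zero_or_pos n with rfl | hn
  · exact hb0
  · rw [hb n hn]
    exact Real.rpow_pos_of_pos (by exact_mod_cast hn) _

lemma alphaSq_pos (hb : ∀ n, 0 < b n) (n : ℕ) : 0 < alphaSq b n := pow_pos (alpha_pos hb n) 2

lemma betaSq_pos (hb : ∀ n, 0 < b n) (n : ℕ) : 0 < betaSq b n := pow_pos (beta_pos hb n) 2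

/-- The ratio `ρ_n` of `alphaSq` to `(2n) ^ (-c)`. -/
def alphaRatio (c : ℝ) (b : ℕ → ℝ) (n : ℕ) : ℝ := alphaSq b n * ((2 * n : ℕ) : ℝ) ^ c

lemma alphaRatio_pos (hb : ∀ n, 0 < b n) {n : ℕ} (hn : 1 ≤ n) : 0 < alphaRatio c b n :=
  mul_pos (alphaSq_pos hb n) (Real.rpow_pos_of_pos (by exact_mod_cast (by omega)) _)

lemma powWeight_even (c : ℝ) (n : ℕ) :
    powWeight c (2 * n) = powWeight c n / 2 ^ c := by
  rw [powWeight, powWeight, Nat.cast_mul, Nat.cast_ofNat,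
    Real.mul_rpow zero_le_two (Nat.cast_nonneg _), Real.rpow_neg zero_le_two]
  ring

lemma alphaSq_eq {n : ℕ} (hn : 1 ≤ n) :
    alphaSq b n = alphaRatio c b n * powWeight c (2 * n) := by
  have := powWeight_mul_rpow (c := c) (k := 2 * n) (by omega)
  rw [alphaRatio]
  linear_combination (-alphaSq b n) * this

lemma betaSq_eq (hb0 : 0 < b 0) (hb : ∀ n : ℕ, 1 ≤ n → b n = (n : ℝ) ^ c) {n : ℕ} (hn : 1 ≤ n) :
    betaSq b n = (alphaRatio c b n)⁻¹ * powWeight c (2 * n) := by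
  have hpos := pos_of_power hb0 hb
  have h1 := alpha_mul_beta hpos n
  have h2 := powWeight_mul_rpow (c := c) (k := 2 * n) (by omega)
  rw [hb _ (by omega)] at h1
  rw [inv_mul_eq_div, eq_div_iff (alphaRatio_pos hpos hn).ne', betaSq, alphaRatio, alphaSq]
  set x := ((2 * n : ℕ) : ℝ) ^ c
  set w := powWeight c (2 * n)
  have h3 : x * alpha b n * beta b n * (x * alpha b n * beta b n) = 1 := by rw [h1, one_mul]
  linear_combination w * h3 - (x * alpha b n ^ 2 * beta b n ^ 2) * h2

lemma alphaSq_succ (hb : ∀ n : ℕ, 1 ≤ n → b n = (n : ℝ) ^ c) {n : ℕ} (hn : 1 ≤ n) :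
    alphaSq b (n + 1) * ((2 * n + 1 : ℝ) ^ c) ^ 2 = alphaSq b n * ((2 * n : ℝ) ^ c) ^ 2 := by
  have h : (0 : ℝ) < (2 * n + 1 : ℝ) ^ c := Real.rpow_pos_of_pos (by positivity) _
  rw [alphaSq, alpha, hb (2 * n) (by omega), hb (2 * n + 1) (by omega), alphaSq]
  push_cast
  field_simp

/-- The ratio of consecutive terms is `(2n(2n+2) / (2n+1)²)^c`, at most `1` by the
arithmetic-geometric mean inequality. -/
lemma alphaRatio_succ_le (hb0 : 0 < b 0) (hb : ∀ n : ℕ, 1 ≤ n → b n = (n : ℝ) ^ c) (hc : 0 < c)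
    {n : ℕ} (hn : 1 ≤ n) : alphaRatio c b (n + 1) ≤ alphaRatio c b n := by
  have hpos := pos_of_power hb0 hb
  have h := alphaSq_succ hb hn
  have hn0 : (0 : ℝ) < n := by exact_mod_cast hn
  set x : ℝ := (2 * n : ℝ) ^ c
  set y : ℝ := (2 * n + 1 : ℝ) ^ c
  have hy : 0 < y := Real.rpow_pos_of_pos (by positivity) _
  have hx : 0 < x := Real.rpow_pos_of_pos (by positivity) _
  have hz : x * (2 * n + 2 : ℝ) ^ c ≤ y ^ 2 := by
    rw [sq, ← Real.mul_rpow (by positivity) (by positivity),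
      ← Real.mul_rpow (by positivity) (by positivity)]
    exact Real.rpow_le_rpow (by positivity) (by nlinarith) hc.le
  rw [alphaRatio, alphaRatio]
  push_cast
  rw [show (2 * ((n : ℝ) + 1)) = 2 * n + 2 by ring]
  change alphaSq b (n + 1) * _ ≤ alphaSq b n * x
  rw [← mul_le_mul_iff_left₀ (pow_pos hy 2)]
  calc alphaSq b (n + 1) * (2 * n + 2 : ℝ) ^ c * y ^ 2
      = alphaSq b n * x * (x * (2 * n + 2 : ℝ) ^ c) := by
        linear_combination (2 * n + 2 : ℝ) ^ c * h
    _ ≤ alphaSq b n * x * y ^ 2 :=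
        mul_le_mul_of_nonneg_left hz (mul_nonneg (alphaSq_pos hpos n).le hx.le)

/-- Shifting the power to `2n - 1` reverses the monotonicity, because `(2n-1)(2n+1) ≤ (2n)²`. The
increasing sequence starts at `b_0²`, which keeps the decreasing `ρ_n` away from zero. -/
lemma sq_le_alphaSq_mul (hb0 : 0 < b 0) (hb : ∀ n : ℕ, 1 ≤ n → b n = (n : ℝ) ^ c) (hc : 0 < c)
    {n : ℕ} (hn : 1 ≤ n) : b 0 ^ 2 ≤ alphaSq b n * (2 * n - 1 : ℝ) ^ c := by
  have hpos := pos_of_power hb0 hb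
  induction n, hn using Nat.le_induction with
  | base =>
    simp [alphaSq, alpha, hb 1 le_rfl]
    norm_num
  | succ n hn ih =>
    have h := alphaSq_succ hb hn
    have hn0 : (1 : ℝ) ≤ n := by exact_mod_cast hn
    refine ih.trans ?_
    push_cast
    rw [show (2 * ((n : ℝ) + 1) - 1) = 2 * n + 1 by ring]
    set x : ℝ := (2 * n : ℝ) ^ c
    set y : ℝ := (2 * n + 1 : ℝ) ^ c
    have hy : 0 < y := Real.rpow_pos_of_pos (by positivity) _
    have hz : (2 * n - 1 : ℝ) ^ c * y ≤ x ^ 2 := by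
      rw [sq, ← Real.mul_rpow (by linarith) (by positivity),
        ← Real.mul_rpow (by positivity) (by positivity)]
      exact Real.rpow_le_rpow (mul_nonneg (by linarith) (by positivity)) (by nlinarith) hc.le
    rw [← mul_le_mul_iff_left₀ hy]
    calc alphaSq b n * (2 * n - 1 : ℝ) ^ c * y = alphaSq b n * ((2 * n - 1 : ℝ) ^ c * y) := by ring
      _ ≤ alphaSq b n * x ^ 2 := mul_le_mul_of_nonneg_left hz (alphaSq_pos hpos n).le
      _ = alphaSq b (n + 1) * y * y := by linear_combination -h

lemma sq_le_alphaRatio (hb0 : 0 < b 0) (hb : ∀ n : ℕ, 1 ≤ n → b n = (n : ℝ) ^ c) (hc : 0 < c)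
    {n : ℕ} (hn : 1 ≤ n) : b 0 ^ 2 ≤ alphaRatio c b n := by
  have hn0 : (1 : ℝ) ≤ n := by exact_mod_cast hn
  refine (sq_le_alphaSq_mul hb0 hb hc hn).trans (mul_le_mul_of_nonneg_left ?_
    (alphaSq_pos (pos_of_power hb0 hb) n).le)
  push_cast
  exact Real.rpow_le_rpow (by linarith) (by linarith) hc.le

lemma alphaRatio_le_one (hb0 : 0 < b 0) (hb : ∀ n : ℕ, 1 ≤ n → b n = (n : ℝ) ^ c) (hc : 0 < c)
    {n : ℕ} (hn : 1 ≤ n) : alphaRatio c b n ≤ alphaRatio c b 1 := by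
  induction n, hn using Nat.le_induction with
  | base => exact le_rfl
  | succ n hn ih => exact (alphaRatio_succ_le hb0 hb hc hn).trans ih

lemma powWeight_even_le (hc : 0 < c) (n : ℕ) : powWeight c (2 * n) ≤ powWeight c n := by
  rw [powWeight_even]
  exact div_le_self (powWeight_nonneg c n) (Real.one_le_rpow one_le_two hc.le)

lemma weights_power (hc : 1 < c) (hb0 : 0 < b 0) (hb : ∀ n : ℕ, 1 ≤ n → b n = (n : ℝ) ^ c) :
    Weights (alphaSq b) (betaSq b) := by
  have hpos := pos_of_power hb0 hb
  have hc0 : 0 < c := by linarith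
  refine ⟨fun k => (alphaSq_pos hpos k).le, fun k => (betaSq_pos hpos k).le, ?_, ?_⟩
  · refine Summable.of_norm_bounded_eventually_nat
      ((summable_powWeight hc).mul_left (alphaRatio c b 1)) ?_
    filter_upwards [eventually_ge_atTop 1] with n hn
    rw [Real.norm_of_nonneg (alphaSq_pos hpos n).le, alphaSq_eq hn]
    exact mul_le_mul (alphaRatio_le_one hb0 hb hc0 hn) (powWeight_even_le hc0 n)
      (powWeight_nonneg _ _) (alphaRatio_pos hpos le_rfl).le
  · refine Summable.of_norm_bounded_eventually_nat
      ((summable_powWeight hc).mul_left (b 0 ^ 2)⁻¹) ?_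
    filter_upwards [eventually_ge_atTop 1] with n hn
    rw [Real.norm_of_nonneg (betaSq_pos hpos n).le, betaSq_eq hb0 hb hn]
    exact mul_le_mul (inv_anti₀ (by positivity) (sq_le_alphaRatio hb0 hb hc0 hn))
      (powWeight_even_le hc0 n) (powWeight_nonneg _ _) (by positivity)

/-- A full step costs at most a factor of order `y²`; this controls the finitely many steps before a
comparison begins. -/
lemma chain_le_pow {m s : ℕ → ℝ} (hm : ∀ k, 0 ≤ m k) (hs : ∀ k, 0 ≤ s k) {a : ℝ × ℝ} (ha : 0 ≤ a)
    (n : ℕ) : ∃ C > 0, ∀ y, 1 ≤ y →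
      chainU m s y a n ≤ C * y ^ (2 * n) ∧ chainV m s y a n ≤ C * y ^ (2 * n) := by
  induction n with
  | zero =>
    refine ⟨a.1 + a.2 + 1, by linarith [ha.1, ha.2, show 0 ≤ a.1 from ha.1, show 0 ≤ a.2 from ha.2],
      fun y _ => ?_⟩
    have h1 : 0 ≤ a.1 := ha.1
    have h2 : 0 ≤ a.2 := ha.2
    simp only [chainU_zero, chainV_zero, mul_zero, pow_zero, mul_one]
    constructor <;> linarith
  | succ n ih =>
    obtain ⟨C, hC, h⟩ := ih
    refine ⟨C * (1 + m n) * (1 + s n), by have := hm n; have := hs n; positivity, fun y hy => ?_⟩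
    have hy0 : 0 ≤ y := by linarith
    have hpos := chain_nonneg hm hs hy0 ha n
    have hpos' := chain_nonneg hm hs hy0 ha (n + 1)
    obtain ⟨hU, hV⟩ := h y hy
    have hmn := hm n
    have hsn := hs n
    have hV' : chainV m s y a (n + 1) ≤ C * (1 + m n) * y ^ (2 * n + 1) := by
      rw [chainV_succ]
      calc chainV m s y a n + y * m n * chainU m s y a n
          ≤ y * (C * y ^ (2 * n)) + y * m n * (C * y ^ (2 * n)) := by
            gcongr
            refine hV.trans (le_mul_of_one_le_left (by positivity) hy)
        _ = _ := by ring
    have hpow : y ^ (2 * n + 1) ≤ y ^ (2 * (n + 1)) := pow_le_pow_right₀ hy (by omega)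
    have hpow' : y ^ (2 * n) ≤ y ^ (2 * (n + 1)) := pow_le_pow_right₀ hy (by omega)
    constructor
    · rw [chainU_succ]
      calc chainU m s y a n + y * s n * chainV m s y a (n + 1)
          ≤ C * (1 + m n) * y ^ (2 * (n + 1)) + y * s n * (C * (1 + m n) * y ^ (2 * n + 1)) := by
            gcongr
            refine hU.trans ?_
            have : C * y ^ (2 * n) ≤ C * y ^ (2 * (n + 1)) := by gcongr
            have : 0 ≤ C * m n * y ^ (2 * (n + 1)) := by positivity
            linarith
        _ = _ := by ring
    · refine hV'.trans ?_
      calc C * (1 + m n) * y ^ (2 * n + 1) ≤ C * (1 + m n) * y ^ (2 * (n + 1)) := by gcongr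
        _ ≤ C * (1 + m n) * (1 + s n) * y ^ (2 * (n + 1)) :=
            mul_le_mul_of_nonneg_right
              (le_mul_of_one_le_right (by positivity) (by linarith)) (by positivity)

lemma limU_power_le (hc : 1 < c) (hb0 : 0 < b 0) (hb : ∀ n : ℕ, 1 ≤ n → b n = (n : ℝ) ^ c) :
    PolyLE (fun y => limU (alphaSq b) (betaSq b) y (1, 0)) fun y => symU c (y / 2 ^ c) := by
  have hpos := pos_of_power hb0 hb
  have hc0 : 0 < c := by linarith
  have hW := weights_power hc hb0 hb
  obtain ⟨C, hC, hCy⟩ := chain_le_pow hW.nonneg_left hW.nonneg_right zero_le_one_zero 2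
  have h2c : (0 : ℝ) < 2 ^ c := Real.rpow_pos_of_pos two_pos c
  have hρ2 := alphaRatio_pos (c := c) hpos (n := 2) (by norm_num)
  refine ⟨C * (alphaRatio c b 2 + 2 ^ c) / b 0 ^ 2, by positivity, 4, fun y hy => ?_⟩
  have hy0 : 0 ≤ y := by linarith
  set x := y / 2 ^ c with hx
  have hx0 : 0 ≤ x := by positivity
  -- Large enough for both components at the starting index. That index is `2`, since the model
  -- chain has zero weight at `0` and so `V_1 = 0`, whereas `V_2 = x` is positive.
  set κ := C * (alphaRatio c b 2 + 2 ^ c) * y ^ 4 with hκ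
  have hκ0 : 0 ≤ κ := by positivity
  have hκ1 : C * alphaRatio c b 2 * y ^ 4 ≤ κ := by
    have : 0 ≤ C * 2 ^ c * y ^ 4 := by positivity
    linarith
  have hκ2 : C * 2 ^ c * y ^ 4 ≤ κ := by
    have : 0 ≤ C * alphaRatio c b 2 * y ^ 4 := by positivity
    linarith
  have hw0 : powWeight c 0 = 0 := powWeight_zero hc0
  have hw1 : powWeight c 1 = 1 := by simp [powWeight]
  have hmul : ∀ n, y * powWeight c (2 * n) = x * powWeight c n := fun n => by
    rw [powWeight_even, hx]; ring
  have hgauge := chain_le_of_gauge (κ := κ) (n₀ := 2) (g := fun n => (alphaRatio c b n)⁻¹)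
    (h := fun _ => 1) (m := alphaSq b) (s := betaSq b) (a := (1, 0)) (a' := (1, 0))
    hW.nonneg_left hW.nonneg_right (powWeight_nonneg c)
    (powWeight_nonneg c) hy0 hx0 zero_le_one_zero hκ0
    (fun n hn => inv_anti₀ (alphaRatio_pos hpos (by omega))
      (alphaRatio_succ_le hb0 hb hc0 (by omega)))
    (fun _ _ => le_rfl)
    (fun n hn => by
      have := (alphaRatio_pos (c := c) hpos (n := n) (by omega)).ne'
      rw [alphaSq_eq (c := c) (by omega), one_mul, ← hmul]
      field_simp
      exact le_rfl)
    (fun n hn => by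
      rw [betaSq_eq hb0 hb (by omega), mul_one, ← hmul, ← mul_assoc, mul_comm y, mul_assoc]
      exact mul_le_mul_of_nonneg_right (inv_anti₀ (alphaRatio_pos hpos (by omega))
        (alphaRatio_succ_le hb0 hb hc0 (by omega))) (mul_nonneg hy0 (powWeight_nonneg _ _)))
    (by
      have h1 : 1 ≤ chainU (powWeight c) (powWeight c) x (1, 0) 2 :=
        chainU_mono (powWeight_nonneg c) (powWeight_nonneg c) hx0 zero_le_one_zero (Nat.zero_le 2)
      calc _ ≤ C * y ^ 4 := (hCy y hy).1
        _ = C * alphaRatio c b 2 * y ^ 4 * (alphaRatio c b 2)⁻¹ := by field_simp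
        _ ≤ κ * (alphaRatio c b 2)⁻¹ := by
            gcongr
        _ ≤ _ := le_mul_of_one_le_right (by positivity) h1)
    (by
      have h1 : chainV (powWeight c) (powWeight c) x (1, 0) 2 = x := by
        simp [chainV_succ, chainU_succ, hw0, hw1]
      rw [h1, mul_one]
      calc _ ≤ C * y ^ 4 := (hCy y hy).2
        _ = C * 2 ^ c * y ^ 4 * (1 / 2 ^ c) := by field_simp
        _ ≤ κ * x := by
            rw [hx]
            gcongr)
  refine le_of_tendsto (tendsto_chainU (hW.summableV zero_le_one_zero hy0)) ?_
  filter_upwards [eventually_ge_atTop 2] with n hn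
  have hs0 := (chain_nonneg (powWeight_nonneg c) (powWeight_nonneg c) hx0 zero_le_one_zero n).1
  calc _ ≤ κ * (alphaRatio c b n)⁻¹ * chainU (powWeight c) (powWeight c) x (1, 0) n :=
        (hgauge n hn).1
    _ ≤ κ * (b 0 ^ 2)⁻¹ * symU c x := by
        gcongr
        · exact sq_le_alphaRatio hb0 hb hc0 (by omega)
        · exact chainU_le_symU hc hx0 n
    _ = _ := by rw [hκ]; ring

lemma symU_le_limU_power (hc : 1 < c) (hb0 : 0 < b 0) (hb : ∀ n : ℕ, 1 ≤ n → b n = (n : ℝ) ^ c) :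
    PolyLE (fun y => symU c (y / 2 ^ c)) fun y => limU (alphaSq b) (betaSq b) y (1, 0) := by
  have hpos := pos_of_power hb0 hb
  have hc0 : 0 < c := by linarith
  have hW := weights_power hc hb0 hb
  refine .of_le fun y hy => ?_
  have h2c : (0 : ℝ) < 2 ^ c := Real.rpow_pos_of_pos two_pos c
  have hy0 : 0 ≤ y := by linarith
  set x := y / 2 ^ c with hx
  have hx0 : 0 ≤ x := by positivity
  have hw0 : powWeight c 0 = 0 := powWeight_zero hc0
  -- With `0⁻¹ = 0` the factor of `V` at the starting index `1` is `0`, which is consistent because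
  -- the model chain still has `V_1 = 0`.
  have hr0 : alphaRatio c b 0 = 0 := by simp [alphaRatio, Real.zero_rpow hc0.ne']
  have hmul : ∀ n, y * powWeight c (2 * n) = x * powWeight c n := fun n => by
    rw [powWeight_even, hx]; ring
  have hgauge := chain_le_of_gauge (κ := 1) (n₀ := 1) (g := fun _ => 1)
    (h := fun n => (alphaRatio c b (n - 1))⁻¹) (m := powWeight c) (s := powWeight c)
    (m' := alphaSq b) (s' := betaSq b) (a := (1, 0)) (a' := (1, 0)) (powWeight_nonneg c)
    (powWeight_nonneg c) hW.nonneg_left hW.nonneg_right hx0 hy0 zero_le_one_zero zero_le_one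
    (fun _ _ => le_rfl)
    (fun n hn => by
      rw [Nat.add_sub_cancel]
      rcases Nat.eq_or_lt_of_le hn with rfl | hn
      · simp only [Nat.sub_self, hr0, inv_zero]
        exact (inv_pos.2 (alphaRatio_pos hpos le_rfl)).le
      · obtain ⟨k, rfl⟩ : ∃ k, n = k + 1 := ⟨n - 1, by omega⟩
        rw [Nat.add_sub_cancel]
        exact inv_anti₀ (alphaRatio_pos hpos (by omega)) (alphaRatio_succ_le hb0 hb hc0 (by omega)))
    (fun n hn => by
      have := (alphaRatio_pos (c := c) hpos (n := n) (by omega)).ne'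
      rw [alphaSq_eq (c := c) (by omega), mul_one, ← hmul, Nat.add_sub_cancel]
      field_simp
      exact le_rfl)
    (fun n hn => by
      rw [betaSq_eq hb0 hb (by omega), ← hmul, Nat.add_sub_cancel]
      exact le_of_eq (by ring))
    (by
      have h1 : 1 ≤ chainU (alphaSq b) (betaSq b) y (1, 0) 1 :=
        chainU_mono hW.nonneg_left hW.nonneg_right hy0 zero_le_one_zero (Nat.zero_le 1)
      have h2 : chainU (powWeight c) (powWeight c) x (1, 0) 1 = 1 := by
        simp [chainU_succ, hw0]
      rw [h2]
      linarith)
    (by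
      have h2 : chainV (powWeight c) (powWeight c) x (1, 0) 1 = 0 := by
        simp [chainV_succ, hw0]
      rw [h2]
      simp [hr0])
  refine le_of_tendsto (tendsto_chainU ((weights_powWeight hc).summableV zero_le_one_zero hx0)) ?_
  filter_upwards [eventually_ge_atTop 1] with n hn
  have h1 := (hgauge n hn).1
  rw [one_mul, one_mul] at h1
  exact h1.trans (chainU_le_limU hW.nonneg_left hW.nonneg_right hy0 zero_le_one_zero
    (hW.summableV zero_le_one_zero hy0) n)

end Power

/-! ### Comparison of the four limits -/

section Four

variable {m s : ℕ → ℝ}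

lemma one_le_limU (h : Weights m s) {y : ℝ} (hy : 0 ≤ y) : 1 ≤ limU m s y (1, 0) :=
  chainU_le_limU h.nonneg_left h.nonneg_right hy zero_le_one_zero
    (h.summableV zero_le_one_zero hy) 0

lemma limU_polyLE_limV (h : Weights m s) (hm0 : 0 < m 0) :
    PolyLE (fun y => limU m s y (1, 0)) (fun y => limV m s y (1, 0)) := by
  have hS : 0 ≤ ∑' k, s k := tsum_nonneg h.nonneg_right
  refine ⟨1 / m 0 + ∑' k, s k, by positivity, 1, fun y hy => ?_⟩
  have hy0 : 0 ≤ y := by linarith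
  have h1 := h.limU_le zero_le_one_zero hy0
  have h2 := chainV_le_limV h.nonneg_left h.nonneg_right hy0 zero_le_one_zero
    (h.summableU zero_le_one_zero hy0) 1
  simp only [chainV_succ, chainU_zero, chainV_zero] at h2
  have h3 : 1 ≤ 1 / m 0 * limV m s y (1, 0) := by
    rw [one_div, inv_mul_eq_div, le_div_iff₀ hm0]
    nlinarith
  have h4 : 1 ≤ y * (1 / m 0 * limV m s y (1, 0)) := by nlinarith
  simp only at h1 ⊢
  linarith

lemma limV_polyLE_limU (h : Weights m s) :
    PolyLE (fun y => limV m s y (1, 0)) (fun y => limU m s y (1, 0)) := by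
  have hS : 0 ≤ ∑' k, m k := tsum_nonneg h.nonneg_left
  refine ⟨1 + ∑' k, m k, by positivity, 1, fun y hy => ?_⟩
  have hy0 : 0 ≤ y := by linarith
  have h1 := h.limV_le zero_le_one_zero hy0
  have h2 := one_le_limU h hy0
  have h3 : 0 ≤ y * limU m s y (1, 0) := by positivity
  simp only at h1 ⊢
  linarith

lemma limU_polyLE_limV' (h : Weights m s) :
    PolyLE (fun y => limU m s y (0, 1)) (fun y => limV m s y (0, 1)) := by
  have hS : 0 ≤ ∑' k, s k := tsum_nonneg h.nonneg_right
  refine ⟨1 + ∑' k, s k, by positivity, 1, fun y hy => ?_⟩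
  have hy0 : 0 ≤ y := by linarith
  have h1 := h.limU_le zero_le_zero_one hy0
  have h3 : 0 ≤ y * limV m s y (0, 1) := mul_nonneg hy0 (h.limV_nonneg zero_le_zero_one hy0)
  simp only at h1 ⊢
  linarith

lemma limV_polyLE_limU' (h : Weights m s) (hs0 : 0 < s 0) :
    PolyLE (fun y => limV m s y (0, 1)) (fun y => limU m s y (0, 1)) := by
  have hS : 0 ≤ ∑' k, m k := tsum_nonneg h.nonneg_left
  refine ⟨1 / s 0 + ∑' k, m k, by positivity, 1, fun y hy => ?_⟩
  have hy0 : 0 ≤ y := by linarith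
  have h1 := h.limV_le zero_le_zero_one hy0
  have h2 := chainU_le_limU h.nonneg_left h.nonneg_right hy0 zero_le_zero_one
    (h.summableV zero_le_zero_one hy0) 1
  simp only [chainU_succ, chainV_succ, chainU_zero, chainV_zero] at h2
  have h3 : 1 ≤ 1 / s 0 * limU m s y (0, 1) := by
    rw [one_div, inv_mul_eq_div, le_div_iff₀ hs0]
    nlinarith
  have h4 : 1 ≤ y * (1 / s 0 * limU m s y (0, 1)) := by nlinarith
  simp only at h1 ⊢
  linarith

/-- Linearity and positivity propagate a domination after one step. It is stated there because the
starts `(1,0)` and `(0,1)` are incomparable, but one step with positive weights fills both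
components. -/
lemma limU_le_of_start {a a' : ℝ × ℝ} (h : Weights m s) (ha : 0 ≤ a) (ha' : 0 ≤ a') {y κ : ℝ}
    (hy : 0 ≤ y) (hκ : 0 ≤ κ) (hU : chainU m s y a 1 ≤ κ * chainU m s y a' 1)
    (hV : chainV m s y a 1 ≤ κ * chainV m s y a' 1) :
    limU m s y a ≤ κ * limU m s y a' := by
  have hgauge := chain_le_of_gauge (κ := κ) (n₀ := 1) (g := fun _ => 1) (h := fun _ => 1)
    (a := a) (a' := a') h.nonneg_left h.nonneg_right h.nonneg_left h.nonneg_right hy hy ha' hκ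
    (fun _ _ => le_rfl) (fun _ _ => le_rfl) (fun n _ => by rw [mul_one, one_mul])
    (fun n _ => by rw [mul_one, one_mul]) (by simpa using hU) (by simpa using hV)
  refine le_of_tendsto (tendsto_chainU (h.summableV ha hy)) ?_
  filter_upwards [eventually_ge_atTop 1] with n hn
  have h1 := (hgauge n hn).1
  rw [mul_one] at h1
  exact h1.trans (mul_le_mul_of_nonneg_left
    (chainU_le_limU h.nonneg_left h.nonneg_right hy ha' (h.summableV ha' hy) n) hκ)

lemma limU_start_polyLE (h : Weights m s) (hm0 : 0 < m 0) (hs0 : 0 < s 0) :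
    PolyLE (fun y => limU m s y (0, 1)) (fun y => limU m s y (1, 0)) ∧
    PolyLE (fun y => limU m s y (1, 0)) (fun y => limU m s y (0, 1)) := by
  constructor
  · refine ⟨1 / m 0, by positivity, 0, fun y hy => ?_⟩
    have hy0 : 0 ≤ y := by linarith
    rw [pow_zero, mul_one]
    refine limU_le_of_start h zero_le_zero_one zero_le_one_zero hy0 (by positivity) ?_ ?_
    · simp only [chainU_succ, chainV_succ, chainU_zero, chainV_zero]
      rw [one_div, inv_mul_eq_div, le_div_iff₀ hm0]
      have : 0 ≤ y * s 0 * m 0 * (y - 1) :=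
        mul_nonneg (by positivity) (by linarith)
      nlinarith
    · simp only [chainV_succ, chainU_zero, chainV_zero]
      rw [one_div, inv_mul_eq_div, le_div_iff₀ hm0]
      nlinarith
  · refine ⟨1 / s 0 + m 0, by positivity, 1, fun y hy => ?_⟩
    have hy0 : 0 ≤ y := by linarith
    refine limU_le_of_start h zero_le_one_zero zero_le_zero_one hy0 (by positivity) ?_ ?_
    · simp only [chainU_succ, chainV_succ, chainU_zero, chainV_zero]
      have h1 : (1 / s 0 + m 0) * y ^ 1 * (0 + y * s 0 * (1 + y * m 0 * 0))
          = y ^ 2 + y ^ 2 * (s 0 * m 0) := by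
        field_simp
        ring
      rw [h1]
      nlinarith
    · simp only [chainV_succ, chainU_zero, chainV_zero]
      have : 0 ≤ 1 / s 0 * y := by positivity
      nlinarith

end Four

/-! ### Order and type -/

section OrderType

variable {c : ℝ}

/-- The type of the symmetric model chain. -/
def modelType (c : ℝ) : EReal :=
  limsup (fun y => ((Real.log (symU c y) / y ^ (1 / c) : ℝ) : EReal)) atTop

lemma growth_of_polyLE_symU (hc : 1 < c) {f : ℂ → ℂ} {κ q : ℝ} (hκ : 0 < κ) (hq : 0 < q)
    (h₁ : PolyLE (maxModulus f) fun r => symU c (κ * r ^ q))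
    (h₂ : PolyLE (fun r => symU c (κ * r ^ q)) (maxModulus f)) :
    growthOrder f = ((q * (1 / c) : ℝ) : EReal) ∧
    growthType f = ((κ ^ (1 / c) : ℝ) : EReal) * modelType c :=
  growth_of_polyLE (by positivity) hκ hq (half_pos (Real.log_pos one_lt_two))
    (fun _ hy => zero_lt_one.trans_le (one_le_symU hc hy)) (log_symU_ge hc) (log_symU_le hc) h₁ h₂

lemma growth_of_polyLE_sqrt (hc : 1 < c) {f : ℂ → ℂ}
    (h : PolyLE (maxModulus f) (fun r => symU c (√r)) ∧
      PolyLE (fun r => symU c (√r)) (maxModulus f)) :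
    growthOrder f = ((1 / (2 * c) : ℝ) : EReal) ∧ growthType f = modelType c := by
  have hsqrt : (fun r => symU c (√r)) = fun r => symU c (1 * r ^ (1 / 2 : ℝ)) := by
    funext r; rw [one_mul, Real.sqrt_eq_rpow]
  rw [hsqrt] at h
  obtain ⟨h1, h2⟩ := growth_of_polyLE_symU hc one_pos (by norm_num) h.1 h.2
  refine ⟨h1.trans ?_, h2.trans ?_⟩
  · congr 1
    rw [one_div_mul_one_div]
  · rw [Real.one_rpow, EReal.coe_one, one_mul]

lemma growth_of_polyLE_limU (hc : 1 < c) {b : ℕ → ℝ} (hb0 : 0 < b 0)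
    (hb : ∀ n : ℕ, 1 ≤ n → b n = (n : ℝ) ^ c) {f : ℂ → ℂ} {L : ℝ → ℝ}
    (hf : ∀ r, 0 ≤ r → maxModulus f r = L r)
    (h₁ : PolyLE L fun y => limU (alphaSq b) (betaSq b) y (1, 0))
    (h₂ : PolyLE (fun y => limU (alphaSq b) (betaSq b) y (1, 0)) L) :
    growthOrder f = ((1 / c : ℝ) : EReal) ∧ growthType f = modelType c / 2 := by
  have hc0 : 0 < c := by linarith
  have h2c : (0 : ℝ) < 2 ^ c := Real.rpow_pos_of_pos two_pos c
  have hscale : (fun y => symU c (y / 2 ^ c)) = fun r => symU c ((2 ^ c)⁻¹ * r ^ (1 : ℝ)) := by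
    funext r; rw [Real.rpow_one, inv_mul_eq_div]
  have e₁ : PolyLE (maxModulus f) L := .of_le fun y hy => (hf y (by linarith)).le
  have e₂ : PolyLE L (maxModulus f) := .of_le fun y hy => (hf y (by linarith)).ge
  have u₁ := limU_power_le hc hb0 hb
  have u₂ := symU_le_limU_power hc hb0 hb
  rw [hscale] at u₁ u₂
  obtain ⟨g1, g2⟩ := growth_of_polyLE_symU hc (inv_pos.2 h2c) one_pos
    (e₁.trans (h₁.trans u₁)) (u₂.trans (h₂.trans e₂))
  refine ⟨by rw [g1, one_mul], ?_⟩
  rw [g2, Real.inv_rpow h2c.le, ← Real.rpow_mul zero_le_two, mul_one_div_cancel hc0.ne',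
    Real.rpow_one, EReal.div_eq_inv_mul, EReal.coe_inv]
  rfl

lemma growth_nevanlinna (hc : 1 < c) {b : ℕ → ℝ} (hb0 : 0 < b 0)
    (hb : ∀ n : ℕ, 1 ≤ n → b n = (n : ℝ) ^ c) :
    MomentOrder (fun _ => 0) b ((1 / c : ℝ) : EReal) ∧
    MomentType (fun _ => 0) b (modelType c / 2) := by
  have hpos := pos_of_power hb0 hb
  have hW := weights_power hc hb0 hb
  have hm0 := alphaSq_pos hpos 0
  have hs0 := betaSq_pos hpos 0
  obtain ⟨s₁, s₂⟩ := limU_start_polyLE hW hm0 hs0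
  obtain ⟨A1, A2⟩ := growth_of_polyLE_limU hc hb0 hb
    (fun r hr => (maxModulus_nev hpos hW hr).1) s₁ s₂
  obtain ⟨B1, B2⟩ := growth_of_polyLE_limU hc hb0 hb
    (fun r hr => (maxModulus_nev hpos hW hr).2.1) (.of_le fun _ _ => le_rfl)
    (.of_le fun _ _ => le_rfl)
  obtain ⟨C1, C2⟩ := growth_of_polyLE_limU hc hb0 hb
    (fun r hr => (maxModulus_nev hpos hW hr).2.2.1) ((limV_polyLE_limU' hW hs0).trans s₁)
    (s₂.trans (limU_polyLE_limV' hW))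
  obtain ⟨D1, D2⟩ := growth_of_polyLE_limU hc hb0 hb
    (fun r hr => (maxModulus_nev hpos hW hr).2.2.2) (limV_polyLE_limU hW)
    (limU_polyLE_limV hW hm0)
  exact ⟨⟨A1, B1, C1, D1⟩, A2, B2, C2, D2⟩

end OrderType

/-! ### Passing to the limit in integrals of unbounded functions -/

/-- Truncation of a continuous function. -/
def truncation (f : ℝ → ℝ) (hf : Continuous f) {R : ℝ} (hR : 0 ≤ R) :
    BoundedContinuousFunction ℝ ℝ :=
  BoundedContinuousFunction.ofNormedAddCommGroup (fun x => max (-R) (min R (f x)))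
    (by fun_prop) R fun x => by
      rw [Real.norm_eq_abs, abs_le]
      exact ⟨le_max_left _ _, max_le (by linarith) (min_le_left _ _)⟩

/-- The error vanishes where `|f| ≤ R` and elsewhere is below `|f| ≤ f²/R`, so second moments
control truncation uniformly. -/
lemma abs_sub_truncation_le (f : ℝ → ℝ) (hf : Continuous f) {R : ℝ} (hR : 0 < R) (x : ℝ) :
    |f x - truncation f hf hR.le x| ≤ f x ^ 2 / R := by
  change |f x - max (-R) (min R (f x))| ≤ f x ^ 2 / R
  have h2 : 0 ≤ f x ^ 2 / R := by positivity
  rcases le_total R (f x) with h | h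
  · rw [min_eq_left h, max_eq_right (by linarith), abs_of_nonneg (by linarith), le_div_iff₀ hR]
    nlinarith
  · rw [min_eq_right h]
    rcases le_total (f x) (-R) with h' | h'
    · rw [max_eq_left h', abs_of_nonpos (by linarith), le_div_iff₀ hR]
      nlinarith
    · rw [max_eq_right h']
      simpa using h2

lemma integrable_of_sq {ν : Measure ℝ} [IsProbabilityMeasure ν] {f : ℝ → ℝ} (hf : Continuous f)
    (h : Integrable (fun x => f x ^ 2) ν) : Integrable f ν := by
  refine ((integrable_const (1 : ℝ)).add h).mono' hf.aestronglyMeasurable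
    (Eventually.of_forall fun x => ?_)
  rw [Real.norm_eq_abs]
  simp only [Pi.add_apply]
  nlinarith [sq_nonneg (|f x| - 1), sq_abs (f x), abs_nonneg (f x)]

lemma abs_integral_sub_truncation_le {ν : Measure ℝ} [IsProbabilityMeasure ν] {f : ℝ → ℝ}
    (hf : Continuous f) (h : Integrable (fun x => f x ^ 2) ν) {R C : ℝ} (hR : 0 < R)
    (hC : ∫ x, f x ^ 2 ∂ν ≤ C) :
    |∫ x, f x ∂ν - ∫ x, truncation f hf hR.le x ∂ν| ≤ C / R := by
  have hT : Integrable (truncation f hf hR.le) ν := (truncation f hf hR.le).integrable ν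
  rw [← integral_sub (integrable_of_sq hf h) hT]
  refine (abs_integral_le_integral_abs).trans ?_
  refine (integral_mono_of_nonneg (Eventually.of_forall fun x => abs_nonneg _) (h.div_const R)
    (Eventually.of_forall fun x => abs_sub_truncation_le f hf hR x)).trans ?_
  rw [integral_div]
  gcongr

/-- The Fatou inequality for weak convergence, from the portmanteau lower bound on open sets. -/
lemma integrable_sq_of_tendsto {μs : ℕ → ProbabilityMeasure ℝ} {μ : ProbabilityMeasure ℝ}
    (hμ : Tendsto μs atTop (𝓝 μ)) {f : ℝ → ℝ} (hf : Continuous f) {C : ℝ}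
    (hint : ∀ i, Integrable (fun x => f x ^ 2) (μs i : Measure ℝ))
    (hC : ∀ᶠ i in atTop, ∫ x, f x ^ 2 ∂(μs i : Measure ℝ) ≤ C) :
    Integrable (fun x => f x ^ 2) (μ : Measure ℝ) ∧ ∫ x, f x ^ 2 ∂(μ : Measure ℝ) ≤ C := by
  have hC0 : 0 ≤ C := by
    obtain ⟨i, hi⟩ := hC.exists
    exact (integral_nonneg fun x => sq_nonneg _).trans hi
  have hle : ∫⁻ x, ENNReal.ofReal (f x ^ 2) ∂(μ : Measure ℝ) ≤ ENNReal.ofReal C := by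
    refine (lintegral_le_liminf_lintegral_of_forall_isOpen_measure_le_liminf_measure
      (hf.pow 2) (fun x => sq_nonneg _)
      (fun G hG => ProbabilityMeasure.le_liminf_measure_open_of_tendsto hμ hG)).trans ?_
    refine (liminf_le_limsup).trans (limsup_le_of_le (by isBoundedDefault) ?_)
    filter_upwards [hC] with i hi
    simp only [Pi.pow_apply]
    rw [← ofReal_integral_eq_lintegral_ofReal (hint i) (Eventually.of_forall fun x => sq_nonneg _)]
    exact ENNReal.ofReal_le_ofReal hi
  have hI : Integrable (fun x => f x ^ 2) (μ : Measure ℝ) := by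
    refine ⟨(hf.pow 2).aestronglyMeasurable, ?_⟩
    rw [hasFiniteIntegral_iff_ofReal (Eventually.of_forall fun x => sq_nonneg _)]
    exact hle.trans_lt ENNReal.ofReal_lt_top
  refine ⟨hI, ?_⟩
  rwa [← ofReal_integral_eq_lintegral_ofReal hI (Eventually.of_forall fun x => sq_nonneg _),
    ENNReal.ofReal_le_ofReal_iff hC0] at hle

lemma tendsto_integral_of_sq_bounded {μs : ℕ → ProbabilityMeasure ℝ} {μ : ProbabilityMeasure ℝ}
    (hμ : Tendsto μs atTop (𝓝 μ)) {f : ℝ → ℝ} (hf : Continuous f) {C : ℝ}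
    (hint : ∀ i, Integrable (fun x => f x ^ 2) (μs i : Measure ℝ))
    (hC : ∀ᶠ i in atTop, ∫ x, f x ^ 2 ∂(μs i : Measure ℝ) ≤ C) :
    Tendsto (fun i => ∫ x, f x ∂(μs i : Measure ℝ)) atTop (𝓝 (∫ x, f x ∂(μ : Measure ℝ))) := by
  obtain ⟨hI, hCμ⟩ := integrable_sq_of_tendsto hμ hf hint hC
  have hC0 : 0 ≤ C := (integral_nonneg fun x => sq_nonneg _).trans hCμ
  rw [Metric.tendsto_nhds]
  intro ε hε
  set R := 3 * (C + 1) / ε with hRdef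
  have hR : 0 < R := by positivity
  have hCR : C / R < ε / 3 := by
    rw [div_lt_iff₀ hR, hRdef]
    field_simp
    linarith
  have ht := (ProbabilityMeasure.tendsto_iff_forall_integral_tendsto.1 hμ) (truncation f hf hR.le)
  filter_upwards [hC, Metric.tendsto_nhds.1 ht (ε / 3) (by positivity)] with i h1 h2
  have h3 := abs_integral_sub_truncation_le hf (hint i) hR h1
  have h4 := abs_integral_sub_truncation_le hf hI hR hCμ
  rw [Real.dist_eq] at h2 ⊢
  rw [abs_le] at h3 h4
  rw [abs_lt] at h2 ⊢
  constructor <;> linarith [h3.1, h3.2, h4.1, h4.2, h2.1, h2.2]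

/-! ### Compactness of approximate solutions -/

/-- The recurrence shows that the span contains `1` and is stable under multiplication by `X`. -/
lemma span_orthoP {b : ℕ → ℝ} (hb : ∀ n, 0 < b n) :
    Submodule.span ℝ (Set.range (orthoP (fun _ => 0) b)) = ⊤ := by
  set S := Submodule.span ℝ (Set.range (orthoP (fun _ => 0) b)) with hS
  have hmem : ∀ n, orthoP (fun _ => 0) b n ∈ S := fun n => Submodule.subset_span ⟨n, rfl⟩
  have hX : ∀ q ∈ S, Polynomial.X * q ∈ S := by
    intro q hq
    induction hq using Submodule.span_induction with
    | mem q hq =>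
      obtain ⟨n, rfl⟩ := hq
      match n with
      | 0 =>
        have : Polynomial.X * orthoP (fun _ => 0) b 0 = b 0 • orthoP (fun _ => 0) b 1 := by
          rw [Polynomial.smul_eq_C_mul, orthoP, orthoP, ← mul_assoc, ← Polynomial.C_mul,
            mul_inv_cancel₀ (hb 0).ne']
          simp
        rw [this]
        exact S.smul_mem _ (hmem 1)
      | n + 1 =>
        have : Polynomial.X * orthoP (fun _ => 0) b (n + 1)
            = b (n + 1) • orthoP (fun _ => 0) b (n + 2) + b n • orthoP (fun _ => 0) b n := by
          rw [Polynomial.smul_eq_C_mul, Polynomial.smul_eq_C_mul, orthoP, ← mul_assoc,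
            ← Polynomial.C_mul, mul_inv_cancel₀ (hb (n + 1)).ne']
          simp
        rw [this]
        exact S.add_mem (S.smul_mem _ (hmem _)) (S.smul_mem _ (hmem _))
    | zero => simp
    | add p q _ _ hp hq => rw [mul_add]; exact S.add_mem hp hq
    | smul a p _ hp => rw [mul_smul_comm]; exact S.smul_mem a hp
  have hpow : ∀ n : ℕ, (Polynomial.X : Polynomial ℝ) ^ n ∈ S := by
    intro n
    induction n with
    | zero => simpa [orthoP] using hmem 0
    | succ n ih => rw [pow_succ']; exact hX _ ih
  rw [eq_top_iff]
  intro q _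
  rw [q.as_sum_range_C_mul_X_pow]
  refine S.sum_mem fun i _ => ?_
  rw [← Polynomial.smul_eq_C_mul]
  exact S.smul_mem _ (hpow i)

/-- Probability measures which are eventually orthonormalizing for any two of the `P_n`. -/
structure ApproxSolution (b : ℕ → ℝ) (μs : ℕ → ProbabilityMeasure ℝ) : Prop where
  integrable : ∀ (i : ℕ) (q : Polynomial ℝ), Integrable (fun x => q.eval x) (μs i : Measure ℝ)
  orthonormal : ∀ m n, ∀ᶠ i in atTop, ∫ x, (orthoP (fun _ => 0) b m).eval x *
    (orthoP (fun _ => 0) b n).eval x ∂(μs i : Measure ℝ) = if m = n then 1 else 0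

namespace ApproxSolution

variable {b : ℕ → ℝ} {μs : ℕ → ProbabilityMeasure ℝ}

lemma integrable_sq (h : ApproxSolution b μs) (i : ℕ) (q : Polynomial ℝ) :
    Integrable (fun x => q.eval x ^ 2) (μs i : Measure ℝ) := by
  exact (h.integrable i (q ^ 2)).congr (Eventually.of_forall fun x => Polynomial.eval_pow 2)

lemma exists_bound (hb : ∀ n, 0 < b n) (h : ApproxSolution b μs) (q : Polynomial ℝ) :
    ∃ C, ∀ᶠ i in atTop, ∫ x, q.eval x ^ 2 ∂(μs i : Measure ℝ) ≤ C := by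
  have hq : q ∈ Submodule.span ℝ (Set.range (orthoP (fun _ => 0) b)) := by
    rw [span_orthoP hb]; trivial
  induction hq using Submodule.span_induction with
  | mem q hq =>
    obtain ⟨n, rfl⟩ := hq
    refine ⟨1, ?_⟩
    filter_upwards [h.orthonormal n n] with i hi
    simp_rw [sq]
    rw [hi, if_pos rfl]
  | zero => exact ⟨0, by simp⟩
  | add p q _ _ hp hq =>
    obtain ⟨C, hC⟩ := hp
    obtain ⟨D, hD⟩ := hq
    refine ⟨2 * C + 2 * D, ?_⟩
    filter_upwards [hC, hD] with i h1 h2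
    have hp := (h.integrable_sq i p).const_mul 2
    have hq := (h.integrable_sq i q).const_mul 2
    calc ∫ x, (p + q).eval x ^ 2 ∂(μs i : Measure ℝ)
        ≤ ∫ x, (2 * p.eval x ^ 2 + 2 * q.eval x ^ 2) ∂(μs i : Measure ℝ) := by
          refine integral_mono (h.integrable_sq i _) (hp.add hq) fun x => ?_
          simp only [Polynomial.eval_add]
          nlinarith [sq_nonneg (p.eval x - q.eval x)]
      _ ≤ 2 * C + 2 * D := by
          rw [integral_add hp hq, integral_const_mul, integral_const_mul]
          linarith
  | smul a p _ hp =>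
    obtain ⟨C, hC⟩ := hp
    refine ⟨a ^ 2 * C, ?_⟩
    filter_upwards [hC] with i h1
    simp_rw [Polynomial.eval_smul, smul_eq_mul, mul_pow]
    rw [integral_const_mul]
    gcongr

/-- The eventual bound on the second moment of `X` gives tightness by Chebyshev's inequality. -/
lemma exists_isCompact (hb : ∀ n, 0 < b n) (h : ApproxSolution b μs) :
    ∃ N, IsCompact (closure (Set.range fun i => μs (i + N))) := by
  obtain ⟨C, hC⟩ := h.exists_bound hb Polynomial.X
  obtain ⟨N, hN⟩ := eventually_atTop.1 hC
  refine ⟨N, isCompact_closure_of_isTightMeasureSet ?_⟩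
  rw [isTightMeasureSet_iff_exists_isCompact_measure_compl_le]
  intro ε hε
  by_cases hεt : ε = ⊤
  · exact ⟨∅, isCompact_empty, fun μ _ => by simp [hεt]⟩
  have hε' : 0 < ε.toReal := ENNReal.toReal_pos hε.ne' hεt
  obtain ⟨R, hR, hR1⟩ : ∃ R : ℝ, C / ε.toReal ≤ R ∧ 1 ≤ R :=
    ⟨max (C / ε.toReal) 1, le_max_left _ _, le_max_right _ _⟩
  refine ⟨Metric.closedBall 0 R, isCompact_closedBall 0 R, ?_⟩
  rintro _ ⟨_, ⟨i, rfl⟩, rfl⟩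
  have h1 := mul_meas_ge_le_integral_of_nonneg (μ := (μs (i + N) : Measure ℝ))
    (f := fun x : ℝ => x ^ 2) (Eventually.of_forall fun x => sq_nonneg x)
    (by simpa using h.integrable_sq (i + N) Polynomial.X) (R ^ 2)
  have h2 : ∫ x, x ^ 2 ∂(μs (i + N) : Measure ℝ) ≤ C := by simpa using hN (i + N) (by omega)
  have h3 : (μs (i + N) : Measure ℝ).real {x | R ^ 2 ≤ x ^ 2} ≤ ε.toReal := by
    rw [div_le_iff₀ hε'] at hR
    have h4 := (h1.trans h2).trans hR
    have h5 : R * (μs (i + N) : Measure ℝ).real {x | R ^ 2 ≤ x ^ 2}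
        ≤ R ^ 2 * (μs (i + N) : Measure ℝ).real {x | R ^ 2 ≤ x ^ 2} :=
      mul_le_mul_of_nonneg_right (by nlinarith) measureReal_nonneg
    exact le_of_mul_le_mul_left (h5.trans h4) (by linarith)
  rw [measureReal_def] at h3
  refine le_trans (measure_mono fun x hx => ?_) ((ENNReal.toReal_le_toReal (measure_ne_top _ _)
    hεt).1 h3)
  have hx' : R < |x| := by simpa using hx
  change R ^ 2 ≤ x ^ 2
  rw [← sq_abs x]
  exact pow_le_pow_left₀ (by linarith) hx'.le 2

/-- A subsequence converges weakly to a solution of the moment problem. -/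
lemma exists_solution (hb : ∀ n, 0 < b n) (h : ApproxSolution b μs) :
    ∃ (μ : ProbabilityMeasure ℝ) (φ : ℕ → ℕ), Tendsto φ atTop atTop ∧
      Tendsto (μs ∘ φ) atTop (𝓝 μ) ∧ IsSolution (fun _ => 0) b (μ : Measure ℝ) := by
  obtain ⟨N, hN⟩ := h.exists_isCompact hb
  obtain ⟨μ, -, ψ, hψ, hlim⟩ := hN.tendsto_subseq (x := fun i => μs (i + N))
    fun i => subset_closure ⟨i, rfl⟩
  have hφ : Tendsto (fun i => ψ i + N) atTop atTop :=
    (tendsto_add_atTop_nat N).comp hψ.tendsto_atTop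
  refine ⟨μ, fun i => ψ i + N, hφ, hlim, fun n => ?_, fun m n => ?_⟩
  · obtain ⟨C, hC⟩ := h.exists_bound hb (Polynomial.X ^ n)
    have := (integrable_sq_of_tendsto (f := fun x => (Polynomial.X ^ n : Polynomial ℝ).eval x) hlim
      (Polynomial.continuous _) (fun i => h.integrable_sq _ _) (hφ.eventually hC)).1
    simpa using integrable_of_sq (Polynomial.continuous _) this
  · set q := orthoP (fun _ => 0) b m * orthoP (fun _ => 0) b n with hq
    obtain ⟨C, hC⟩ := h.exists_bound hb q
    have ht := tendsto_integral_of_sq_bounded (f := fun x => q.eval x) hlim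
      (Polynomial.continuous _) (fun i => h.integrable_sq _ _) (hφ.eventually hC)
    have hconst : ∀ᶠ i in atTop, ∫ x, q.eval x ∂(μs (ψ i + N) : Measure ℝ)
        = if m = n then 1 else 0 := by
      filter_upwards [hφ.eventually (h.orthonormal m n)] with i hi
      simpa [hq, Polynomial.eval_mul] using hi
    have := tendsto_nhds_unique (ht.congr' hconst) tendsto_const_nhds
    simpa [hq, Polynomial.eval_mul] using this

end ApproxSolution

section

/-! ### Truncated Jacobi matrices -/

open Matrix

/-- The `N × N` Jacobi matrix with zero diagonal. -/
def jacobi (b : ℕ → ℝ) (N : ℕ) : Matrix (Fin N) (Fin N) ℝ := fun i j =>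
  if (i : ℕ) + 1 = j then b i else if (j : ℕ) + 1 = i then b j else 0

lemma jacobi_transpose (b : ℕ → ℝ) (N : ℕ) : (jacobi b N)ᵀ = jacobi b N := by
  ext i j
  simp only [transpose_apply, jacobi]
  split_ifs <;> first | omega | rfl

lemma jacobi_isHermitian (b : ℕ → ℝ) (N : ℕ) : (jacobi b N).IsHermitian := by
  rw [IsHermitian, conjTranspose_eq_transpose_of_trivial, jacobi_transpose]

/-- The condition `u N = 0` makes the last truncated row agree with the infinite recurrence. -/
lemma jacobi_mulVec (b : ℕ → ℝ) {N : ℕ} (u : ℕ → ℝ) (hu : u N = 0) (i : Fin N) :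
    (jacobi b N *ᵥ fun j => u j) i
      = b i * u (i + 1) + if (i : ℕ) = 0 then 0 else b (i - 1) * u (i - 1) := by
  have hi := i.2
  have h1 : (jacobi b N *ᵥ fun j => u j) i = ∑ j ∈ Finset.range N,
      ((if j = (i : ℕ) + 1 then b i * u j else 0) + if j + 1 = (i : ℕ) then b j * u j else 0) := by
    rw [mulVec, dotProduct, ← Fin.sum_univ_eq_sum_range (fun j =>
      (if j = (i : ℕ) + 1 then b i * u j else 0) + if j + 1 = (i : ℕ) then b j * u j else 0) N]
    refine Finset.sum_congr rfl fun j _ => ?_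
    simp only [jacobi]
    split_ifs <;> first | omega | simp
  rw [h1, Finset.sum_add_distrib, Finset.sum_ite_eq']
  congr 1
  · split_ifs with h
    · rfl
    · rw [Finset.mem_range, not_lt] at h
      rw [show (i : ℕ) + 1 = N by omega, hu, mul_zero]
  · split_ifs with h
    · exact Finset.sum_eq_zero fun j _ => by rw [if_neg (by omega)]
    · rw [Finset.sum_eq_single_of_mem ((i : ℕ) - 1) (Finset.mem_range.2 (by omega))]
      · rw [if_pos (by omega)]
      · intro j _ hj
        rw [if_neg (by omega)]

/-- Eigenvectors of the truncated Jacobi matrix. -/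
def jacobiVec (b : ℕ → ℝ) (N : ℕ) (j : Fin N) : Fin N → ℝ :=
  (jacobi_isHermitian b N).eigenvectorBasis j

/-- Eigenvalues of the truncated Jacobi matrix. -/
def jacobiEig (b : ℕ → ℝ) (N : ℕ) (j : Fin N) : ℝ := (jacobi_isHermitian b N).eigenvalues j

lemma jacobi_mulVec_vec (b : ℕ → ℝ) (N : ℕ) (j : Fin N) :
    jacobi b N *ᵥ jacobiVec b N j = jacobiEig b N j • jacobiVec b N j :=
  (jacobi_isHermitian b N).mulVec_eigenvectorBasis j

lemma vec_dotProduct_mulVec (b : ℕ → ℝ) (N : ℕ) (j : Fin N) (v : Fin N → ℝ) :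
    jacobiVec b N j ⬝ᵥ (jacobi b N *ᵥ v) = jacobiEig b N j * (jacobiVec b N j ⬝ᵥ v) := by
  rw [dotProduct_mulVec, ← mulVec_transpose, jacobi_transpose, jacobi_mulVec_vec, smul_dotProduct,
    smul_eq_mul]

lemma sum_vec_dotProduct_mul (b : ℕ → ℝ) (N : ℕ) (v w : Fin N → ℝ) :
    ∑ j, (jacobiVec b N j ⬝ᵥ v) * (jacobiVec b N j ⬝ᵥ w) = v ⬝ᵥ w := by
  have h := (jacobi_isHermitian b N).eigenvectorBasis.sum_inner_mul_inner
    (WithLp.toLp 2 v) (WithLp.toLp 2 w)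
  have e : ∀ x y : EuclideanSpace ℝ (Fin N), inner ℝ x y = (y : Fin N → ℝ) ⬝ᵥ (x : Fin N → ℝ) := by
    intro x y
    rw [EuclideanSpace.inner_eq_star_dotProduct]
    simp
  simp only [e] at h
  rw [dotProduct_comm v w, ← h]
  exact Finset.sum_congr rfl fun j _ => by rw [dotProduct_comm w]; rfl

lemma sum_vec_mul_vec (b : ℕ → ℝ) (N : ℕ) (m n : Fin N) :
    ∑ j, jacobiVec b N j m * jacobiVec b N j n = if m = n then 1 else 0 := by
  have := sum_vec_dotProduct_mul b N (Pi.single m 1) (Pi.single n 1)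
  simp only [dotProduct_single, mul_one] at this
  rw [this, Pi.single_apply]
  simp [eq_comm]

/-- The eigenvector equation is the three-term recurrence, so the first coordinate determines all
the others. -/
lemma vec_eq_orthoP_mul {b : ℕ → ℝ} (hb : ∀ n, 0 < b n) (M : ℕ) (j : Fin (M + 1)) (k : ℕ)
    (hk : k < M + 1) : jacobiVec b (M + 1) j ⟨k, hk⟩
      = (orthoP (fun _ => 0) b k).eval (jacobiEig b (M + 1) j) * jacobiVec b (M + 1) j 0 := by
  set e := jacobiVec b (M + 1) j
  set x := jacobiEig b (M + 1) j
  set u : ℕ → ℝ := fun k => if h : k < M + 1 then e ⟨k, h⟩ else 0 with hu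
  have hue : ∀ k (h : k < M + 1), u k = e ⟨k, h⟩ := fun k h => by simp only [hu, dif_pos h]
  have huN : u (M + 1) = 0 := by simp [hu]
  have hfun : (fun i : Fin (M + 1) => u i) = e := funext fun i => hue i i.2
  have hrow : ∀ k, k < M + 1 →
      b k * u (k + 1) + (if k = 0 then 0 else b (k - 1) * u (k - 1)) = x * u k := by
    intro k hk
    have h1 := jacobi_mulVec b u huN ⟨k, hk⟩
    rw [hfun, jacobi_mulVec_vec] at h1
    rw [← h1, hue k hk]
    rfl
  have key : ∀ k, (k < M + 1 → u k = (orthoP (fun _ => 0) b k).eval x * u 0) ∧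
      (k + 1 < M + 1 → u (k + 1) = (orthoP (fun _ => 0) b (k + 1)).eval x * u 0) := by
    intro k
    induction k with
    | zero =>
      refine ⟨fun _ => by simp [orthoP], fun h => ?_⟩
      have h1 := hrow 0 (by omega)
      simp only [if_true, add_zero] at h1
      have hb0 := (hb 0).ne'
      simp only [orthoP]
      simp
      field_simp
      linarith
    | succ k ih =>
      refine ⟨ih.2, fun h => ?_⟩
      have h1 := hrow (k + 1) (by omega)
      rw [if_neg (by omega), Nat.add_sub_cancel, ih.1 (by omega), ih.2 (by omega)] at h1
      have hb0 := (hb (k + 1)).ne'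
      simp only [orthoP]
      simp
      field_simp
      linarith
  have := (key k).1 hk
  rw [hue k hk, hue 0 (by omega)] at this
  exact this

/-! ### Gauss quadrature -/

/-- The spectral measure of the truncated Jacobi matrix at the first basis vector. -/
def gaussMeasure (b : ℕ → ℝ) (M : ℕ) : Measure ℝ :=
  ∑ j : Fin (M + 1), ENNReal.ofReal (jacobiVec b (M + 1) j 0 ^ 2) •
    Measure.dirac (jacobiEig b (M + 1) j)

lemma integrable_gaussMeasure (b : ℕ → ℝ) (M : ℕ) (f : ℝ → ℝ) :
    Integrable f (gaussMeasure b M) := by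
  rw [gaussMeasure, integrable_finsetSum_measure]
  exact fun j _ => (integrable_dirac (by simp)).smul_measure ENNReal.ofReal_ne_top

lemma integral_gaussMeasure (b : ℕ → ℝ) (M : ℕ) (f : ℝ → ℝ) : ∫ x, f x ∂(gaussMeasure b M)
    = ∑ j, jacobiVec b (M + 1) j 0 ^ 2 * f (jacobiEig b (M + 1) j) := by
  rw [gaussMeasure, integral_finsetSum_measure fun j _ =>
    (integrable_dirac (by simp)).smul_measure ENNReal.ofReal_ne_top]
  refine Finset.sum_congr rfl fun j _ => ?_
  rw [integral_smul_measure, integral_dirac, ENNReal.toReal_ofReal (sq_nonneg _), smul_eq_mul]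

instance isProbabilityMeasure_gaussMeasure (b : ℕ → ℝ) (M : ℕ) :
    IsProbabilityMeasure (gaussMeasure b M) := by
  refine ⟨?_⟩
  have h := sum_vec_mul_vec b (M + 1) 0 0
  rw [if_pos rfl] at h
  simp only [gaussMeasure, Measure.finsetSum_apply, Measure.smul_apply, measure_univ, smul_eq_mul,
    mul_one]
  rw [← ENNReal.ofReal_sum_of_nonneg fun j _ => sq_nonneg _]
  simp_rw [sq]
  rw [h, ENNReal.ofReal_one]

/-- Rows of the orthogonal matrix of eigenvectors are orthonormal, and its entries are `P_k` at the
nodes times the square root of the quadrature weight up to sign. -/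
lemma integral_gauss_ortho {b : ℕ → ℝ} (hb : ∀ n, 0 < b n) {M m n : ℕ} (hm : m < M + 1)
    (hn : n < M + 1) : ∫ x, (orthoP (fun _ => 0) b m).eval x * (orthoP (fun _ => 0) b n).eval x
      ∂(gaussMeasure b M) = if m = n then 1 else 0 := by
  have h := sum_vec_mul_vec b (M + 1) ⟨m, hm⟩ ⟨n, hn⟩
  rw [integral_gaussMeasure]
  simp only [Fin.mk.injEq] at h
  rw [← h]
  refine Finset.sum_congr rfl fun j _ => ?_
  rw [vec_eq_orthoP_mul hb M j m hm, vec_eq_orthoP_mul hb M j n hn]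
  ring

/-- The Gauss measures as probability measures. -/
def gauss (b : ℕ → ℝ) (M : ℕ) : ProbabilityMeasure ℝ :=
  ⟨gaussMeasure b M, isProbabilityMeasure_gaussMeasure b M⟩

lemma approxSolution_gauss {b : ℕ → ℝ} (hb : ∀ n, 0 < b n) {ψ : ℕ → ℕ}
    (hψ : Tendsto ψ atTop atTop) : ApproxSolution b fun i => gauss b (ψ i) := by
  refine ⟨fun i q => integrable_gaussMeasure b _ _, fun m n => ?_⟩
  filter_upwards [hψ.eventually_ge_atTop (max m n)] with i hi
  exact integral_gauss_ortho hb (by have := le_max_left m n; omega)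
    (by have := le_max_right m n; omega)

/-! ### Two different limits -/

/-- A tent function around `0`. -/
def tent (δ : ℝ) : BoundedContinuousFunction ℝ ℝ :=
  BoundedContinuousFunction.ofNormedAddCommGroup (fun x => max 0 (1 - |x| / δ) ⊓ 1)
    (by fun_prop) 1 fun x => by
      rw [Real.norm_eq_abs, abs_of_nonneg (le_min (le_max_left _ _) zero_le_one)]
      exact min_le_right _ _

lemma tent_apply (δ x : ℝ) : tent δ x = max 0 (1 - |x| / δ) ⊓ 1 := rfl

lemma tent_nonneg (δ x : ℝ) : 0 ≤ tent δ x := le_min (le_max_left _ _) zero_le_one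

lemma tent_zero (δ : ℝ) : tent δ 0 = 1 := by simp [tent_apply]

lemma tent_mul_le {δ : ℝ} (hδ : 0 < δ) (x : ℝ) : x ^ 2 * tent δ x ≤ δ ^ 2 := by
  rcases le_total δ |x| with h | h
  · have : tent δ x = 0 := by
      rw [tent_apply, max_eq_left (by rw [sub_nonpos, one_le_div hδ]; exact h)]
      simp
    rw [this, mul_zero]
    positivity
  · have h1 : tent δ x ≤ 1 := min_le_right _ _
    have h2 : x ^ 2 ≤ δ ^ 2 := by
      rw [← sq_abs x]
      exact pow_le_pow_left₀ (abs_nonneg x) h 2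
    calc x ^ 2 * tent δ x ≤ x ^ 2 * 1 := by gcongr
      _ ≤ δ ^ 2 := by linarith

lemma aeval_zero_eq (p : Polynomial ℝ) :
    Polynomial.aeval (0 : ℂ) p = ((p.eval 0 : ℝ) : ℂ) := by
  rw [← map_zero (algebraMap ℝ ℂ), Polynomial.aeval_algebraMap_apply]
  simp

lemma orthoP_eval_zero {b : ℕ → ℝ} (hb : ∀ n, 0 < b n) (n : ℕ) :
    (orthoP (fun _ => 0) b (2 * n + 1)).eval 0 = 0 := by
  have := (cP_zero hb n).2
  rw [cP, aeval_zero_eq] at this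
  exact_mod_cast this

lemma orthoQ_eval_zero {b : ℕ → ℝ} (hb : ∀ n, 0 < b n) (n : ℕ) :
    (orthoQ (fun _ => 0) b (2 * n)).eval 0 = 0 := by
  have := (cQ_zero hb n).1
  rw [cQ, aeval_zero_eq] at this
  exact_mod_cast this

lemma summable_orthoP_sq {b : ℕ → ℝ} (hb : ∀ n, 0 < b n) (h : Weights (alphaSq b) (betaSq b)) :
    Summable fun k => (orthoP (fun _ => 0) b k).eval 0 ^ 2 := by
  have := (hasSum_PP hb h 0).summable
  rw [← Complex.summable_ofReal]
  refine this.congr fun k => ?_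
  rw [cP, aeval_zero_eq]
  push_cast
  ring

lemma summable_orthoQ_sq {b : ℕ → ℝ} (hb : ∀ n, 0 < b n) (h : Weights (alphaSq b) (betaSq b)) :
    Summable fun k => (orthoQ (fun _ => 0) b k).eval 0 ^ 2 := by
  have := (hasSum_QQ hb h 0).summable
  rw [← Complex.summable_ofReal]
  refine this.congr fun k => ?_
  rw [cQ, aeval_zero_eq]
  push_cast
  ring

lemma orthoP_eval_zero_row {b : ℕ → ℝ} (hb : ∀ n, 0 < b n) (k : ℕ) :
    b k * (orthoP (fun _ => 0) b (k + 1)).eval 0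
      + (if k = 0 then 0 else b (k - 1) * (orthoP (fun _ => 0) b (k - 1)).eval 0) = 0 := by
  rcases k with _ | k
  · simp [orthoP]
  · have := (hb (k + 1)).ne'
    rw [if_neg (by omega), Nat.add_sub_cancel]
    simp only [orthoP]
    simp
    field_simp
    ring

lemma orthoQ_eval_zero_row {b : ℕ → ℝ} (hb : ∀ n, 0 < b n) (k : ℕ) :
    b k * (orthoQ (fun _ => 0) b (k + 1)).eval 0
      + (if k = 0 then 0 else b (k - 1) * (orthoQ (fun _ => 0) b (k - 1)).eval 0)
      = if k = 0 then 1 else 0 := by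
  rcases k with _ | k
  · have := (hb 0).ne'
    simp [orthoQ, this]
  · have := (hb (k + 1)).ne'
    rw [if_neg (by omega), if_neg (by omega), Nat.add_sub_cancel]
    simp only [orthoQ]
    simp
    field_simp
    ring

lemma sum_fin_sq_le_tsum {u : ℕ → ℝ} (hu : Summable fun k => u k ^ 2) (N : ℕ) :
    (fun j : Fin N => u j) ⬝ᵥ (fun j : Fin N => u j) ≤ ∑' k, u k ^ 2 := by
  rw [dotProduct, Fin.sum_univ_eq_sum_range (fun j => u j * u j) N]
  simp_rw [← sq]
  exact hu.sum_le_tsum _ fun k _ => sq_nonneg _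

/-- The matrix has even size `2n + 2` and `Q_{2n+2}(0) = 0`, so `w = (Q_k(0))` solves `Jw = e_0`.
Hence the mass at a node `λ_j` is `λ_j² ⟨e_j, w⟩²`, which is small near the origin. -/
lemma integral_tent_odd_le {b : ℕ → ℝ} (hb : ∀ n, 0 < b n)
    (hQ : Summable fun k => (orthoQ (fun _ => 0) b k).eval 0 ^ 2) {δ : ℝ} (hδ : 0 < δ) (n : ℕ) :
    ∫ x, tent δ x ∂(gauss b (2 * n + 1) : Measure ℝ)
      ≤ δ ^ 2 * ∑' k, (orthoQ (fun _ => 0) b k).eval 0 ^ 2 := by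
  set N := 2 * n + 1 + 1 with hN
  set u : ℕ → ℝ := fun k => (orthoQ (fun _ => 0) b k).eval 0 with hu
  have huN : u N = 0 := orthoQ_eval_zero hb (n + 1)
  set w : Fin N → ℝ := fun j => u j with hw
  have hJ : jacobi b N *ᵥ w = Pi.single 0 1 := by
    funext i
    rw [hw, jacobi_mulVec b u huN, hu]
    simp only
    rw [orthoQ_eval_zero_row hb, Pi.single_apply]
    congr 1
    rw [Fin.ext_iff]; rfl
  have h0 : ∀ j, jacobiVec b N j 0 = jacobiEig b N j * (jacobiVec b N j ⬝ᵥ w) := fun j => by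
    rw [← vec_dotProduct_mulVec, hJ, dotProduct_single, mul_one]
  have hsum := sum_vec_dotProduct_mul b N w w
  calc ∫ x, tent δ x ∂(gauss b (2 * n + 1) : Measure ℝ)
      = ∑ j, jacobiVec b N j 0 ^ 2 * tent δ (jacobiEig b N j) := integral_gaussMeasure b _ _
    _ ≤ ∑ j, δ ^ 2 * ((jacobiVec b N j ⬝ᵥ w) * (jacobiVec b N j ⬝ᵥ w)) := by
        refine Finset.sum_le_sum fun j _ => ?_
        rw [h0 j]
        have := mul_le_mul_of_nonneg_right (tent_mul_le hδ (jacobiEig b N j))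
          (mul_self_nonneg (jacobiVec b N j ⬝ᵥ w))
        linarith
    _ = δ ^ 2 * (w ⬝ᵥ w) := by rw [← Finset.mul_sum, hsum]
    _ ≤ _ := by
        gcongr
        exact sum_fin_sq_le_tsum hQ N

/-- The matrix has odd size and `v = (P_k(0))` lies in its kernel, so only eigenvalue `0`
contributes to `⟨e_0, v⟩ = 1`. Cauchy–Schwarz then bounds the atom at `0` from below by `1/‖v‖²`. -/
lemma le_integral_tent_even {b : ℕ → ℝ} (hb : ∀ n, 0 < b n)
    (hP : Summable fun k => (orthoP (fun _ => 0) b k).eval 0 ^ 2) (δ : ℝ) (n : ℕ) :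
    1 ≤ (∫ x, tent δ x ∂(gauss b (2 * n) : Measure ℝ))
      * ∑' k, (orthoP (fun _ => 0) b k).eval 0 ^ 2 := by
  set N := 2 * n + 1 with hN
  set u : ℕ → ℝ := fun k => (orthoP (fun _ => 0) b k).eval 0 with hu
  have huN : u N = 0 := orthoP_eval_zero hb n
  set v : Fin N → ℝ := fun j => u j with hv
  have hJ : jacobi b N *ᵥ v = 0 := by
    funext i
    rw [hv, jacobi_mulVec b u huN, hu]
    simp only
    rw [orthoP_eval_zero_row hb, Pi.zero_apply]
  have h0 : ∀ j, jacobiEig b N j * (jacobiVec b N j ⬝ᵥ v) = 0 := fun j => by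
    rw [← vec_dotProduct_mulVec, hJ, dotProduct_zero]
  have hsum := sum_vec_dotProduct_mul b N v v
  have h1 := sum_vec_dotProduct_mul b N (Pi.single 0 1) v
  simp only [dotProduct_single, mul_one, single_dotProduct, one_mul] at h1
  have hv0 : v 0 = 1 := by simp [hv, hu, orthoP]
  rw [hv0] at h1
  set f : Fin N → ℝ := fun j => if jacobiEig b N j = 0 then jacobiVec b N j 0 else 0 with hf
  have h2 : ∑ j, f j * (jacobiVec b N j ⬝ᵥ v) = 1 := by
    rw [← h1]
    refine Finset.sum_congr rfl fun j _ => ?_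
    simp only [hf]
    split_ifs with h
    · rfl
    · rw [(mul_eq_zero.1 (h0 j)).resolve_left h, mul_zero, mul_zero]
  have h3 := Finset.sum_mul_sq_le_sq_mul_sq Finset.univ f fun j => jacobiVec b N j ⬝ᵥ v
  rw [h2, one_pow] at h3
  have h4 : ∑ j, f j ^ 2 ≤ ∫ x, tent δ x ∂(gauss b (2 * n) : Measure ℝ) := by
    refine le_of_le_of_eq (Finset.sum_le_sum fun j _ => ?_) (integral_gaussMeasure b _ _).symm
    simp only [hf]
    split_ifs with h
    · rw [show jacobiEig b (2 * n + 1) j = 0 from h, tent_zero, mul_one]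
    · simpa using mul_nonneg (sq_nonneg _) (tent_nonneg _ _)
  refine h3.trans (mul_le_mul h4 ?_ (Finset.sum_nonneg fun j _ => sq_nonneg _)
    ((Finset.sum_nonneg fun j _ => sq_nonneg _).trans h4))
  simp_rw [sq (jacobiVec b N _ ⬝ᵥ v)]
  rw [hsum]
  exact sum_fin_sq_le_tsum hP N

lemma indeterminate_of_summable {b : ℕ → ℝ} (hb : ∀ n, 0 < b n)
    (hP : Summable fun k => (orthoP (fun _ => 0) b k).eval 0 ^ 2)
    (hQ : Summable fun k => (orthoQ (fun _ => 0) b k).eval 0 ^ 2) :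
    Indeterminate (fun _ => 0) b := by
  have hψ1 : Tendsto (fun n : ℕ => 2 * n + 1) atTop atTop :=
    tendsto_atTop_mono (fun n => by simp only [id]; omega) tendsto_id
  have hψ2 : Tendsto (fun n : ℕ => 2 * n) atTop atTop :=
    tendsto_atTop_mono (fun n => by simp only [id]; omega) tendsto_id
  obtain ⟨μ, φ, -, hμ, hμs⟩ := (approxSolution_gauss hb hψ1).exists_solution hb
  obtain ⟨ν, χ, -, hν, hνs⟩ := (approxSolution_gauss hb hψ2).exists_solution hb
  refine ⟨μ, ν, hμs, hνs, fun heq => ?_⟩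
  set S := ∑' k, (orthoP (fun _ => 0) b k).eval 0 ^ 2
  set K := ∑' k, (orthoQ (fun _ => 0) b k).eval 0 ^ 2
  have hK : 0 ≤ K := tsum_nonneg fun k => sq_nonneg _
  have hS : 1 ≤ S := by
    refine le_trans ?_ (hP.sum_le_tsum {0} fun k _ => sq_nonneg _)
    simp [orthoP]
  -- Chosen so that equality of the limits would give `1 ≤ δ² K S = K / (K + 1)`, a contradiction.
  set δ := √(1 / (S * (K + 1))) with hδdef
  have hpos : 0 < 1 / (S * (K + 1)) := by positivity
  have hδ : 0 < δ := Real.sqrt_pos.2 hpos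
  have hδ2 : δ ^ 2 = 1 / (S * (K + 1)) := Real.sq_sqrt hpos.le
  have h1 : ∫ x, tent δ x ∂(μ : Measure ℝ) ≤ δ ^ 2 * K :=
    le_of_tendsto' ((ProbabilityMeasure.tendsto_iff_forall_integral_tendsto.1 hμ) (tent δ))
      fun i => integral_tent_odd_le hb hQ hδ (φ i)
  have h2 : 1 ≤ (∫ x, tent δ x ∂(ν : Measure ℝ)) * S :=
    ge_of_tendsto' (((ProbabilityMeasure.tendsto_iff_forall_integral_tendsto.1 hν)
      (tent δ)).mul_const S) fun i => le_integral_tent_even hb hP δ (χ i)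
  rw [← heq] at h2
  have h3 : 1 ≤ δ ^ 2 * K * S := h2.trans (mul_le_mul_of_nonneg_right h1 (by linarith))
  rw [hδ2, show 1 / (S * (K + 1)) * K * S = K / (K + 1) by field_simp,
    le_div_iff₀ (by linarith)] at h3
  linarith

lemma indeterminate_of_weights {b : ℕ → ℝ} (hb : ∀ n, 0 < b n)
    (h : Weights (alphaSq b) (betaSq b)) : Indeterminate (fun _ => 0) b :=
  indeterminate_of_summable hb (summable_orthoP_sq hb h) (summable_orthoQ_sq hb h)

end

end BergSzwarc

end

theorem mainTheorem7 (c : ℝ) (hc : 1 < c) (b : ℕ → ℝ) (hb0 : 0 < b 0)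
    (hb : ∀ n : ℕ, 1 ≤ n → b n = (n : ℝ) ^ c) :
    BergSzwarc.Indeterminate (fun _ => 0) b ∧
    BergSzwarc.NevanlinnaEntire (fun _ => 0) b ∧
    BergSzwarc.MomentOrder (fun _ => 0) b ((1 / c : ℝ) : EReal) ∧
    BergSzwarc.GZEntire (2 * c) ∧
    BergSzwarc.growthOrder (BergSzwarc.G (2 * c)) = ((1 / (2 * c) : ℝ) : EReal) ∧
    BergSzwarc.growthOrder (BergSzwarc.Z (2 * c)) = ((1 / (2 * c) : ℝ) : EReal) ∧
    ∃ T : EReal,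
      BergSzwarc.growthType (BergSzwarc.G (2 * c)) = T ∧
      BergSzwarc.growthType (BergSzwarc.Z (2 * c)) = T ∧
      BergSzwarc.MomentType (fun _ => 0) b (T / 2) := by
  have hpos := BergSzwarc.pos_of_power hb0 hb
  have hW := BergSzwarc.weights_power hc hb0 hb
  obtain ⟨g1, g2⟩ := BergSzwarc.growth_of_polyLE_sqrt hc (BergSzwarc.G_polyLE hc)
  obtain ⟨z1, z2⟩ := BergSzwarc.growth_of_polyLE_sqrt hc (BergSzwarc.Z_polyLE hc)
  obtain ⟨n1, n2⟩ := BergSzwarc.growth_nevanlinna hc hb0 hb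
  exact ⟨BergSzwarc.indeterminate_of_weights hpos hW, BergSzwarc.nevanlinnaEntire hpos hW, n1,
    BergSzwarc.GZEntire_two_mul hc, g1, z1, BergSzwarc.modelType c, g2, z2, n2⟩
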